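/- Let $n\ge 0$, $Q=[0,1]^n\subset\mathbb R^n$, and let $d$ be the Euclidean distance. For a continuous function $f$ on $Q$, $\operatorname{supp}(f-g)=\overline{\{x\in Q: f(x)\ne g(x)\}}$, and for a map $\psi$ of $Q$, $\operatorname{supp}(\psi)=\overline{\{x\in Q:\psi(x)\neq x\}}$. For homeomorphisms $h,k$ of $Q$ put $$\bar d(h,k)=\max_{x\in Q}\bigl(d(h(x),k(x))+d(h^{-1}(x),k^{-1}(x))\bigr).$$ For finite measures on $Q$ put $d_{\mathcal M}(\mu,\nu)=\sup_\varphi|\int\varphi\,d\mu-\int\varphi\,d\nu|$, the supremum over all $1$-Lipschitz $\varphi:Q\to[0,1]$ (a metric for the weak topology). Write $m_f=f\,dx$. "Closed cube" means a set of the form $\prod_i[a_i,a_i+s]$. **Theorem.** Fix a positive continuous function $g$ on $Q$. Call $f$ *admissible* if $f$ is positive and continuous on $Q$, $\int_Qf\,dx=\int_Qg\,dx$ and $\operatorname{supp}(f-g)\subset\operatorname{Int}Q$. A *solution* for an admissible $f$ is a homeomorphism $\psi:Q\to Q$ with $\operatorname{supp}(\psi)\subset \operatorname{Int}Q$ (so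 $\psi(x)=x$ near $\partial Q$) such that $$\int_{\psi(A)}g\,dy=\int_Af\,dx\quad\text{for every measurable }A\subset Q,$$ such that, whenever $f,g\in C^k(Q)$ with $0\le k\le\infty$, $\psi$ and $\psi^{-1}$ are of class $C^k$, and such that, whenever $f,g\in C^1(Q)$, $\psi$ satisfies $$g(\psi(x))\det\nabla\psi(x)=f(x)\qquad(x\in Q).$$ (In particular, for smooth $f,g$ a solution is a smooth diffeomorphism with $\psi^*(g\,dx)=f\,dx$.) Then: * (Existence.) Every admissible $f$ has a solution $\psi$ such that $\operatorname{supp}(\psi)\subset R$ for every closed cube $R\subset(0,1)^n$ with $\operatorname{supp}(f-g)\subset R$. Moreover there is a function $r:\mathbb R\to\mathbb R$, depending only on $g$, with $r(t)\to0=r(0)$ as $t\to0$, such that: 1. (Coerciveness.) Every admissible $f$ has a solution $\psi$ with $\bar d(\psi,\mathrm{id})\le r(d_{\mathcal M}(m_f,m_g))$. 2. (Localization.) If $f$ is admissible and $R\subset(0,1)^n$ is a closed cube with $\operatorname{supp}(f-g)\subset R$, then $f$ has a solution $\psi$ with both $\operatorname{supp}(\psi)\subset R$ and $\bar d(\psi,\mathrm{id})\le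 r(d_{\mathcal M}(m_f,m_g))$. 3. (Parametric version.) Let $(t,x)\mapsto f_t(x)$ be continuous on $[0,1]\times Q$, each $f_t$ being admissible, with $\operatorname{supp}(f_t-g)\subset R$ for all $t\in[0,1]$ and one closed cube $R\subset(0,1)^n$, and let $c\in\mathbb R$ satisfy $d_{\mathcal M}(m_{f_t},m_g)\le c$ for all $t\in[0,1]$. Then there are solutions $\psi_t$ for $f_t$, $t\in[0,1]$, with $\operatorname{supp}(\psi_t)\subset R$ and $\bar d(\psi_t,\mathrm{id})\le r(c)$ for all $t$, such that $t\mapsto\psi_t$ is continuous for $\bar d$ (that is, in the compact-open topology), and such that $(t,x)\mapsto\psi_t(x)$ is $C^k$ on $[0,1]\times Q$ whenever $(t,x)\mapsto f_t(x)$ is $C^k$ on $[0,1]\times Q$ and $g$ is $C^k$ on $Q$, for every $0\le k\le\infty$. -/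

import Mathlib

open Set Filter Topology MeasureTheory

noncomputable section

/-- The closed axis-parallel cube with lowest corner `a` and side length `s`. -/
def closedCube {n : ℕ} (a : EuclideanSpace ℝ (Fin n)) (s : ℝ) :
    Set (EuclideanSpace ℝ (Fin n)) :=
  {x | ∀ i, a i ≤ x i ∧ x i ≤ a i + s}

/-- The unit cube `Q = [0,1]^n`. -/
def unitCube (n : ℕ) : Set (EuclideanSpace ℝ (Fin n)) :=
  {x | ∀ i, 0 ≤ x i ∧ x i ≤ 1}

/-- The open unit cube `(0,1)^n`, the interior of `Q`. -/
def openUnitCube (n : ℕ) : Set (EuclideanSpace ℝ (Fin n)) :=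
  {x | ∀ i, 0 < x i ∧ x i < 1}

/-- The support of `f - g`, for functions `f`, `g` on `Q` (values off `Q` play no role). -/
def diffSupport {n : ℕ} (f g : EuclideanSpace ℝ (Fin n) → ℝ) :
    Set (EuclideanSpace ℝ (Fin n)) :=
  closure {x | x ∈ unitCube n ∧ f x - g x ≠ 0}

/-- The support of a map: the closure of the set of points of `Q` that it moves. -/
def moveSupport {n : ℕ} (ψ : EuclideanSpace ℝ (Fin n) ≃ₜ EuclideanSpace ℝ (Fin n)) :
    Set (EuclideanSpace ℝ (Fin n)) :=
  closure {x | x ∈ unitCube n ∧ ψ x ≠ x}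

/-- The measure `m_f = f dx` on `Q`. -/
def cubeMeasure {n : ℕ} (f : EuclideanSpace ℝ (Fin n) → ℝ) :
    Measure (EuclideanSpace ℝ (Fin n)) :=
  (volume.restrict (unitCube n)).withDensity (fun x => ENNReal.ofReal (f x))

/-- The metric of the weak topology on finite measures on `Q`: the supremum of
`|μ(φ) - ν(φ)|` over all `1`-Lipschitz functions `φ : Q → [0,1]`. -/
def weakDist {n : ℕ} (μ ν : Measure (EuclideanSpace ℝ (Fin n))) : ℝ :=
  sSup {r | ∃ φ : EuclideanSpace ℝ (Fin n) → ℝ,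
    LipschitzOnWith 1 φ (unitCube n) ∧ (∀ x ∈ unitCube n, φ x ∈ Icc (0 : ℝ) 1) ∧
    r = |(∫ x in unitCube n, φ x ∂μ) - ∫ x in unitCube n, φ x ∂ν|}

/-- The uniform distance of homeomorphisms on `Q`:
`max over x in Q of d(h x, k x) + d(h⁻¹ x, k⁻¹ x)`. -/
def homeoDist {n : ℕ} (h k : EuclideanSpace ℝ (Fin n) ≃ₜ EuclideanSpace ℝ (Fin n)) : ℝ :=
  sSup ((fun x => dist (h x) (k x) + dist (h.symm x) (k.symm x)) '' unitCube n)

/-- `f` is a positive continuous density on `Q` with the same integral as `g`, such that `f - g`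
has support in the interior of `Q`. -/
structure IsAdmissible {n : ℕ} (g f : EuclideanSpace ℝ (Fin n) → ℝ) : Prop where
  continuousOn : ContinuousOn f (unitCube n)
  pos : ∀ x ∈ unitCube n, 0 < f x
  integral_eq : ∫ x in unitCube n, f x = ∫ x in unitCube n, g x
  support_subset : diffSupport f g ⊆ openUnitCube n

/-- `ψ` is a homeomorphism of `Q`, equal to the identity near the boundary of `Q`, which pulls the
density `g` back to the density `f`.  Such a homeomorphism of `Q` is the same thing as a
homeomorphism of `ℝⁿ` that is the identity off a compact subset of the interior of `Q`.
For continuous densities the pull-back condition is the mass equation `m_g(ψ(E)) = m_f(E)`.  As soon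
as both densities are of class `C^k` on `Q`, for some `0 ≤ k ≤ ∞`, the map `ψ` is a
`C^k` diffeomorphism, and for `k ≥ 1` it satisfies the Jacobian equation at every point of `Q`. -/
structure IsSolution {n : ℕ} (g f : EuclideanSpace ℝ (Fin n) → ℝ)
    (ψ : EuclideanSpace ℝ (Fin n) ≃ₜ EuclideanSpace ℝ (Fin n)) : Prop where
  eq_off_cube : ∀ x, x ∉ unitCube n → ψ x = x
  eq_near_boundary : moveSupport ψ ⊆ openUnitCube n
  mass_eq : ∀ A, MeasurableSet A → A ⊆ unitCube n → ∫ y in ψ '' A, g y = ∫ x in A, f x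
  contDiff : ∀ k : ℕ∞, ContDiffOn ℝ k f (unitCube n) → ContDiffOn ℝ k g (unitCube n) →
    ContDiff ℝ k ψ ∧ ContDiff ℝ k ψ.symm
  jacobian_eq : ContDiffOn ℝ 1 f (unitCube n) → ContDiffOn ℝ 1 g (unitCube n) →
    ∀ x ∈ unitCube n, g (ψ x) * (fderiv ℝ ψ x).det = f x

end

/-!
# Homeomorphisms of the cube with prescribed densities

The transport maps are compositions of monotone transports along coordinate lines, so no elliptic
regularity is involved and no derivative is lost.

*One line direction.*  If two positive densities have the same mass on every line parallel to the
`i`-th axis, then the monotone rearrangement on each of these lines transports one to the other.  Its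
`i`-th coordinate solves a scalar equation between primitives, so the map is `C^k` if the densities are
(`ContDiffOn.implicit`), and its Jacobian is a transvection
(`exists_transports_of_lineBalanced`).

*One box.*  Let `f - g` vanish off a box and have integral zero.  Replacing `h = f - g` by its averages
along the lines in the direction `i`, spread out with a bump function of the `i`-th coordinate, does not
change the line integrals.  After averaging in all directions only a multiple of the product of the
bump functions is left, and it is zero because the integral is.  Doing this with `h / N`, `N` times,
keeps all the intermediate densities positive (`exists_transports_of_eq_off_coordBox`).  The resulting
map is the identity off the box.  Applied to the bounding box of the support of `f - g`, this gives a
solution that is localized in all admissible cubes at once.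

*Small displacement.*  A fine partition of unity of the cube splits `f - g` into pieces, which need not
have integral zero.  The masses of the pieces are exchanged between overlapping cells; the amounts are
differences of a potential, which solves a Poisson equation for the graph Laplacian of the cells
(`exists_laplacian_inverse`).  They are small if `f` is weakly close to `g`, so that the pieces can
be removed one after the other without losing positivity (`pos_add_sum_cells`), each by a map
supported in the box of its cell.  Cells of one colour are disjoint and `2 ^ n` colours suffice, so that
no point moves by more than `2 ^ n` cell diameters (`exists_transports_of_coloring`,
`exists_transports_small_of_le_side`).  In a cube of small side, every map is close to the identity.  The
modulus `r` is then a formal consequence (`exists_modulus`).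

*Parameters.*  All the constructions are linear or pointwise in the time `t`, with numbers of steps that
do not depend on `t`.  Joint regularity in `(t, x)` and regularity in `x` at a single time are treated
together through `IsRegularitySystem`.
-/

/-! ### Differentiability within a set: parametric integrals and implicit functions -/

section Continuity

variable {P F Y : Type} [NormedAddCommGroup P] [NormedAddCommGroup F]

/-- A jointly continuous function on `S × K`, with `K` compact, is continuous in the first variable
uniformly with respect to the second. -/
lemma eventually_forall_dist_lt_of_continuousOn_prod [TopologicalSpace Y] {S : Set P}
    {K : Set Y} (hK : IsCompact K) {W : P × Y → F} (hW : ContinuousOn W (S ×ˢ univ))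
    {p : P} (hp : p ∈ S) {ε : ℝ} (hε : 0 < ε) :
    ∀ᶠ q in 𝓝[S] p, ∀ y ∈ K, ‖W (q, y) - W (p, y)‖ < ε := by
  have key : ∀ y ∈ K, ∃ U ∈ 𝓝[S] p, ∃ V ∈ 𝓝 y, ∀ q ∈ U, ∀ z ∈ V,
      ‖W (q, z) - W (p, z)‖ < ε := by
    intro y _
    have h1 : Tendsto (fun r : P × Y => W r) (𝓝[S] p ×ˢ 𝓝 y) (𝓝 (W (p, y))) := by
      have := hW (p, y) ⟨hp, mem_univ _⟩
      rwa [ContinuousWithinAt, nhdsWithin_prod_eq, nhdsWithin_univ] at this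
    have h2 : Tendsto (fun r : P × Y => W (p, r.2)) (𝓝[S] p ×ˢ 𝓝 y) (𝓝 (W (p, y))) := by
      have h3 : Tendsto (fun r : P × Y => ((p, r.2) : P × Y)) (𝓝[S] p ×ˢ 𝓝 y)
          (𝓝[S] p ×ˢ 𝓝 y) :=
        Tendsto.prodMk (tendsto_const_nhdsWithin hp) tendsto_snd
      exact h1.comp h3
    have h4 := (h1.sub h2).norm
    simp only [sub_self, norm_zero] at h4
    have h5 := h4.eventually (gt_mem_nhds hε)
    obtain ⟨U, hU, V, hV, hUV⟩ := Filter.mem_prod_iff.1 h5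
    exact ⟨U, hU, V, hV, fun q hq z hz => hUV (mk_mem_prod hq hz)⟩
  choose! U hU V hV hUV using key
  obtain ⟨t, htK, ht⟩ := hK.elim_nhds_subcover V hV
  have : ∀ᶠ q in 𝓝[S] p, ∀ y ∈ t, q ∈ U y :=
    (Filter.eventually_all_finset t).2 fun y hy => hU y (htK y hy)
  filter_upwards [this] with q hq y hy
  obtain ⟨z, hz, hyz⟩ := mem_iUnion₂.1 (ht hy)
  exact hUV z (htK z hz) q (hq z hz) y hyz

lemma ContinuousOn.continuous_section [TopologicalSpace Y] {S : Set P} {W : P × Y → F}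
    (hW : ContinuousOn W (S ×ˢ univ)) {p : P} (hp : p ∈ S) : Continuous fun y => W (p, y) := by
  rw [← continuousOn_univ]
  exact hW.comp (by fun_prop) fun y _ => ⟨hp, mem_univ _⟩

/-- A continuous selection of the zeros of functions `H (p, ·)` that increase strictly. -/
lemma continuousOn_implicit_of_strictMono {S : Set P} {H : P × ℝ → ℝ} {y : P → ℝ}
    (hH : ContinuousOn H (S ×ˢ univ)) (hmono : ∀ q ∈ S, StrictMono fun η => H (q, η))
    (h0 : ∀ q ∈ S, H (q, y q) = 0) : ContinuousOn y S := by
  intro p hp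
  have hsec : ∀ η : ℝ, Tendsto (fun q => H (q, η)) (𝓝[S] p) (𝓝 (H (p, η))) := fun η =>
    (hH.comp (f := fun q => ((q, η) : P × ℝ)) (by fun_prop) fun q hq => ⟨hq, mem_univ _⟩) p hp
  refine tendsto_order.2 ⟨fun a ha => ?_, fun a ha => ?_⟩
  · have h1 : H (p, a) < 0 := by rw [← h0 p hp]; exact hmono p hp ha
    filter_upwards [(hsec a).eventually (gt_mem_nhds h1), self_mem_nhdsWithin] with q hq hqS
    rw [← h0 q hqS] at hq
    exact (hmono q hqS).lt_iff_lt.1 hq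
  · have h1 : 0 < H (p, a) := by rw [← h0 p hp]; exact hmono p hp ha
    filter_upwards [(hsec a).eventually (lt_mem_nhds h1), self_mem_nhdsWithin] with q hq hqS
    rw [← h0 q hqS] at hq
    exact (hmono q hqS).lt_iff_lt.1 hq

end Continuity

section Calculus

variable {P F Y : Type} [NormedAddCommGroup P] [NormedAddCommGroup F] [NormedSpace ℝ F]

/-- Integrals over a compact set depend continuously on parameters. -/
lemma continuousOn_setIntegral_param [TopologicalSpace Y] [T2Space Y] [MeasurableSpace Y]
    [OpensMeasurableSpace Y] [SecondCountableTopologyEither Y F] [CompleteSpace F]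
    {μ : Measure Y} [IsFiniteMeasureOnCompacts μ]
    {S : Set P} {K : Set Y} (hK : IsCompact K) {W : P × Y → F}
    (hW : ContinuousOn W (S ×ˢ univ)) : ContinuousOn (fun p => ∫ y in K, W (p, y) ∂μ) S := by
  intro p hp
  rw [ContinuousWithinAt, Metric.tendsto_nhds]
  intro ε hε
  set m := μ.real K
  have hm : 0 ≤ m := measureReal_nonneg
  have h := eventually_forall_dist_lt_of_continuousOn_prod hK hW hp
    (ε := ε / (m + 1)) (by positivity)
  filter_upwards [h, self_mem_nhdsWithin] with q hq hqS
  have hint : ∀ r ∈ S, IntegrableOn (fun y => W (r, y)) K μ := fun r hr =>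
    (hW.continuous_section hr).continuousOn.integrableOn_compact hK
  rw [dist_eq_norm, ← integral_sub (hint q hqS) (hint p hp)]
  calc _ ≤ (ε / (m + 1)) * m :=
        norm_setIntegral_le_of_norm_le_const hK.measure_lt_top fun y hy => (hq y hy).le
    _ < ε := by
        rw [div_mul_eq_mul_div, div_lt_iff₀ (by positivity)]
        nlinarith

variable [NormedSpace ℝ P]

/-- Differentiation under the integral sign over a compact set, within a convex set of
parameters. -/
lemma hasFDerivWithinAt_setIntegral_param [TopologicalSpace Y] [T2Space Y] [MeasurableSpace Y]
    [OpensMeasurableSpace Y] [SecondCountableTopology Y] [CompleteSpace F]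
    {μ : Measure Y} [IsFiniteMeasureOnCompacts μ]
    {S : Set P} (hS : Convex ℝ S) {K : Set Y} (hK : IsCompact K) {W : P × Y → F}
    {D : P × Y → P →L[ℝ] F} (hW : ContinuousOn W (S ×ˢ univ)) (hD : ContinuousOn D (S ×ˢ univ))
    (hWD : ∀ p ∈ S, ∀ y, HasFDerivWithinAt (fun q => W (q, y)) (D (p, y)) S p)
    {p : P} (hp : p ∈ S) :
    HasFDerivWithinAt (fun p => ∫ y in K, W (p, y) ∂μ) (∫ y in K, D (p, y) ∂μ) S p := by
  rw [hasFDerivWithinAt_iff_isLittleO, Asymptotics.isLittleO_iff]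
  intro ε hε
  set m := μ.real K
  have hm : 0 ≤ m := measureReal_nonneg
  have h := eventually_forall_dist_lt_of_continuousOn_prod hK hD hp
    (ε := ε / (m + 1)) (by positivity)
  obtain ⟨δ, hδ, hball⟩ := Metric.mem_nhdsWithin_iff.1 h
  have hint : ∀ r ∈ S, IntegrableOn (fun y => W (r, y)) K μ := fun r hr =>
    (hW.continuous_section hr).continuousOn.integrableOn_compact hK
  have hintD : IntegrableOn (fun y => D (p, y)) K μ :=
    (hD.continuous_section hp).continuousOn.integrableOn_compact hK
  have hmem : Metric.ball p δ ∩ S ∈ 𝓝[S] p :=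
    inter_mem (mem_nhdsWithin_of_mem_nhds (Metric.ball_mem_nhds p hδ)) self_mem_nhdsWithin
  filter_upwards [hmem] with q hq
  have hpball : p ∈ Metric.ball p δ ∩ S := ⟨Metric.mem_ball_self hδ, hp⟩
  have hconv : Convex ℝ (Metric.ball p δ ∩ S) := (convex_ball p δ).inter hS
  have hDq : (∫ y in K, D (p, y) ∂μ) (q - p) = ∫ y in K, D (p, y) (q - p) ∂μ :=
    (ContinuousLinearMap.integral_apply hintD _)
  rw [hDq, ← integral_sub (hint q hq.2) (hint p hp),
    ← integral_sub (f := fun y => W (q, y) - W (p, y)) ((hint q hq.2).sub (hint p hp))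
      (hintD.apply_continuousLinearMap _)]
  calc _ ≤ (ε / (m + 1) * ‖q - p‖) * m := by
        refine norm_setIntegral_le_of_norm_le_const hK.measure_lt_top fun y hy => ?_
        exact hconv.norm_image_sub_le_of_norm_hasFDerivWithin_le'
          (fun z hz => (hWD z hz.2 y).mono inter_subset_right)
          (fun z hz => (hball hz y hy).le) hpball hq
    _ ≤ ε * ‖q - p‖ := by
        rw [mul_right_comm]
        refine mul_le_mul_of_nonneg_right ?_ (norm_nonneg _)
        rw [div_mul_eq_mul_div, div_le_iff₀ (by positivity)]
        nlinarith

lemma contDiffOn_natCast_setIntegral_param [NormedAddCommGroup Y] [NormedSpace ℝ Y]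
    [MeasurableSpace Y] [OpensMeasurableSpace Y] [SecondCountableTopology Y] [CompleteSpace F]
    {μ : Measure Y} [IsFiniteMeasureOnCompacts μ]
    {S : Set P} (hS : Convex ℝ S) (hS' : UniqueDiffOn ℝ S) {K : Set Y} (hK : IsCompact K)
    (k : ℕ) {W : P × Y → F} (hW : ContDiffOn ℝ k W (S ×ˢ univ)) :
    ContDiffOn ℝ k (fun p => ∫ y in K, W (p, y) ∂μ) S := by
  induction k generalizing F with
  | zero =>
    simp only [Nat.cast_zero, contDiffOn_zero] at hW ⊢
    exact continuousOn_setIntegral_param hK hW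
  | succ k ih =>
    have hu : UniqueDiffOn ℝ (S ×ˢ (univ : Set Y)) := hS'.prod uniqueDiffOn_univ
    push_cast at hW ⊢
    obtain ⟨-, W', hW'c, hW'⟩ :=
      (contDiffOn_succ_iff_hasFDerivWithinAt_of_uniqueDiffOn hu).1 hW
    rw [contDiffOn_succ_iff_hasFDerivWithinAt_of_uniqueDiffOn hS']
    refine ⟨fun h => by simp at h, _,
      ih (W := fun r => (W' r).comp (ContinuousLinearMap.inl ℝ P Y)) ?_, fun p hp => ?_⟩
    · exact hW'c.clm_comp contDiffOn_const
    · refine hasFDerivWithinAt_setIntegral_param hS hK hW.continuousOn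
        (hW'c.clm_comp contDiffOn_const).continuousOn (fun q hq y => ?_) hp
      exact (hW' (q, y) ⟨hq, mem_univ _⟩).comp (f := fun z => ((z, y) : P × Y)) q
        (hasFDerivAt_prodMk_left q y).hasFDerivWithinAt fun z hz => ⟨hz, mem_univ _⟩

/-- Integrals over a compact set inherit the class `C^k` from the integrand, also up to the
boundary of a convex set of parameters. -/
lemma ContDiffOn.setIntegral_param [NormedAddCommGroup Y] [NormedSpace ℝ Y]
    [MeasurableSpace Y] [OpensMeasurableSpace Y] [SecondCountableTopology Y] [CompleteSpace F]
    {μ : Measure Y} [IsFiniteMeasureOnCompacts μ]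
    {S : Set P} (hS : Convex ℝ S) (hS' : UniqueDiffOn ℝ S) {K : Set Y} (hK : IsCompact K)
    {k : ℕ∞} {W : P × Y → F} (hW : ContDiffOn ℝ k W (S ×ˢ univ)) :
    ContDiffOn ℝ k (fun p => ∫ y in K, W (p, y) ∂μ) S := by
  cases k with
  | top =>
    exact contDiffOn_infty.2 fun m => contDiffOn_natCast_setIntegral_param hS hS' hK m
      (contDiffOn_infty.1 hW m)
  | coe m => exact contDiffOn_natCast_setIntegral_param hS hS' hK m hW

/-- A continuous solution `y` of `H (p, y p) = 0` is differentiable within `S` as soon as `H` is and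
`∂H/∂y ≠ 0`. -/
lemma hasFDerivWithinAt_implicit {S : Set P} {H : P × ℝ → ℝ} {y : P → ℝ} {p : P} (hp : p ∈ S)
    {L : P × ℝ →L[ℝ] ℝ} (hL : HasFDerivWithinAt H L (S ×ˢ univ) (p, y p))
    (hy : ContinuousWithinAt y S p) (h0 : ∀ q ∈ S, H (q, y q) = 0) (hd : L (0, 1) ≠ 0) :
    HasFDerivWithinAt y (-(L (0, 1))⁻¹ • L.comp (ContinuousLinearMap.inl ℝ P ℝ)) S p := by
  set d := L (0, 1) with hdd
  have hd' : 0 < |d| := abs_pos.2 hd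
  have hLsplit : ∀ (v : P) (e : ℝ), L (v, e) = L (v, 0) + d * e := by
    intro v e
    have : ((v, e) : P × ℝ) = (v, 0) + e • ((0 : P), (1 : ℝ)) := by simp
    rw [this, map_add, map_smul, smul_eq_mul, mul_comm]
  rw [hasFDerivWithinAt_iff_isLittleO, Asymptotics.isLittleO_iff] at hL ⊢
  have htend : Tendsto (fun q => ((q, y q) : P × ℝ)) (𝓝[S] p) (𝓝[S ×ˢ univ] (p, y p)) := by
    refine tendsto_nhdsWithin_iff.2 ⟨?_, ?_⟩
    · exact Tendsto.prodMk_nhds (tendsto_id.mono_left nhdsWithin_le_nhds) hy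
    · filter_upwards [self_mem_nhdsWithin] with q hq using ⟨hq, mem_univ _⟩
  -- the linearized equation, with an error controlled by both increments
  have hsmall : ∀ c : ℝ, 0 < c → ∀ᶠ q in 𝓝[S] p,
      |L (q - p, 0) + d * (y q - y p)| ≤ c * (‖q - p‖ + |y q - y p|) := by
    intro c hc
    filter_upwards [htend.eventually (hL hc), self_mem_nhdsWithin] with q hq hqS
    rw [h0 q hqS, h0 p hp] at hq
    simp only [sub_self, zero_sub, norm_neg, Real.norm_eq_abs, Prod.mk_sub_mk] at hq
    rw [hLsplit] at hq
    refine hq.trans (mul_le_mul_of_nonneg_left ?_ hc.le)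
    rw [Prod.norm_mk]
    exact max_le (le_add_of_nonneg_right (abs_nonneg _)) (le_add_of_nonneg_left (norm_nonneg _))
  -- a Lipschitz bound for the increment of `y`
  set C := 2 * (‖L‖ + |d|) / |d| with hC
  have hC0 : 0 ≤ C := by positivity
  have hLip : ∀ᶠ q in 𝓝[S] p, |y q - y p| ≤ C * ‖q - p‖ := by
    filter_upwards [hsmall (|d| / 2) (by positivity)] with q hq
    have h1 : |L (q - p, 0)| ≤ ‖L‖ * ‖q - p‖ := by
      have := L.le_opNorm (q - p, 0)
      rwa [Prod.norm_mk, norm_zero, max_eq_left (norm_nonneg _)] at this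
    have h2 : |d| * |y q - y p| ≤ |L (q - p, 0) + d * (y q - y p)| + |L (q - p, 0)| := by
      rw [← abs_mul]
      have := abs_sub (L (q - p, 0) + d * (y q - y p)) (L (q - p, 0))
      rwa [add_sub_cancel_left] at this
    rw [hC, div_mul_eq_mul_div, le_div_iff₀ hd']
    nlinarith [norm_nonneg (q - p), abs_nonneg (y q - y p), norm_nonneg L]
  intro c hc
  filter_upwards [hsmall (c * |d| / (1 + C)) (by positivity), hLip] with q hq hq2
  have e : y q - y p - (-d⁻¹ • L.comp (ContinuousLinearMap.inl ℝ P ℝ)) (q - p)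
      = d⁻¹ * (L (q - p, 0) + d * (y q - y p)) := by
    simp
    field_simp
    ring
  rw [e, Real.norm_eq_abs, abs_mul, abs_inv, inv_mul_le_iff₀ hd']
  refine hq.trans ?_
  rw [div_mul_eq_mul_div, div_le_iff₀ (by positivity)]
  have : ‖q - p‖ + |y q - y p| ≤ (1 + C) * ‖q - p‖ := by linarith
  calc c * |d| * (‖q - p‖ + |y q - y p|) ≤ c * |d| * ((1 + C) * ‖q - p‖) :=
        mul_le_mul_of_nonneg_left this (by positivity)
    _ = _ := by ring

/-- Regularity in the implicit function theorem for a scalar unknown, within a set of parameters. -/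
lemma ContDiffOn.implicit {S : Set P} (hS : UniqueDiffOn ℝ S) {H : P × ℝ → ℝ} {y : P → ℝ}
    {k : ℕ∞} (hH : ContDiffOn ℝ k H (S ×ˢ univ)) (hy : ContinuousOn y S)
    (h0 : ∀ q ∈ S, H (q, y q) = 0)
    (hd : ∀ q ∈ S, ∃ d ≠ 0, HasDerivAt (fun η => H (q, η)) d (y q)) :
    ContDiffOn ℝ k y S := by
  have main : ∀ m : ℕ, ContDiffOn ℝ m H (S ×ˢ univ) → ContDiffOn ℝ m y S := by
    intro m
    induction m with
    | zero => intro _; simpa [contDiffOn_zero] using hy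
    | succ m ih =>
      intro hm
      have hu : UniqueDiffOn ℝ (S ×ˢ (univ : Set ℝ)) := hS.prod uniqueDiffOn_univ
      have hym := ih (hm.of_le (by exact_mod_cast Nat.le_succ m))
      push_cast at hm ⊢
      obtain ⟨-, H', hH'c, hH'⟩ :=
        (contDiffOn_succ_iff_hasFDerivWithinAt_of_uniqueDiffOn hu).1 hm
      have hne : ∀ q ∈ S, H' (q, y q) (0, 1) ≠ 0 := by
        intro q hq
        obtain ⟨d, hd0, hd1⟩ := hd q hq
        have h1 : HasDerivAt (fun η : ℝ => ((q, η) : P × ℝ)) (0, 1) (y q) :=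
          (hasDerivAt_const (y q) q).prodMk (hasDerivAt_id (y q))
        have h2 := (hH' (q, y q) ⟨hq, mem_univ _⟩).comp_hasDerivAt_of_eq (y q) h1
          (Eventually.of_forall fun η => ⟨hq, mem_univ _⟩) rfl
        rw [h2.unique hd1]
        exact hd0
      rw [contDiffOn_succ_iff_hasFDerivWithinAt_of_uniqueDiffOn hS]
      refine ⟨fun h => by simp at h, fun q => -(H' (q, y q) (0, 1))⁻¹ •
        (H' (q, y q)).comp (ContinuousLinearMap.inl ℝ P ℝ), ?_, fun q hq =>
        hasFDerivWithinAt_implicit hq (hH' _ ⟨hq, mem_univ _⟩) (hy q hq) h0 (hne q hq)⟩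
      have hc : ContDiffOn ℝ m (fun q => H' (q, y q)) S :=
        hH'c.comp (contDiffOn_id.prodMk hym) fun q hq => ⟨hq, mem_univ _⟩
      exact ((hc.clm_apply contDiffOn_const).inv hne).neg.smul (hc.clm_comp contDiffOn_const)
  cases k with
  | top => exact contDiffOn_infty.2 fun m => main m (contDiffOn_infty.1 hH m)
  | coe m => exact main m hH

end Calculus

/-! ### Boxes and lines parallel to a coordinate axis -/

section Coordinates

variable {n : ℕ}

/-- The closed axis-parallel box with opposite corners `lo` and `hi`. -/
def coordBox (lo hi : Fin n → ℝ) : Set (EuclideanSpace ℝ (Fin n)) :=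
  {x | ∀ i, lo i ≤ x i ∧ x i ≤ hi i}

/-- The point obtained from `x` by giving the value `y` to its `i`-th coordinate.  It is written as
an affine expression, so that its smoothness in `(x, y)` is immediate. -/
noncomputable def setCoord (i : Fin n) (x : EuclideanSpace ℝ (Fin n)) (y : ℝ) :
    EuclideanSpace ℝ (Fin n) :=
  x + (y - x i) • EuclideanSpace.single i (1 : ℝ)

lemma setCoord_apply (i j : Fin n) (x : EuclideanSpace ℝ (Fin n)) (y : ℝ) :
    setCoord i x y j = if j = i then y else x j := by
  by_cases h : j = i
  · subst h; simp [setCoord]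
  · simp [setCoord, h]

@[simp] lemma setCoord_same (i : Fin n) (x : EuclideanSpace ℝ (Fin n)) (y : ℝ) :
    setCoord i x y i = y := by simp [setCoord_apply]

lemma setCoord_of_ne {i j : Fin n} (h : j ≠ i) (x : EuclideanSpace ℝ (Fin n)) (y : ℝ) :
    setCoord i x y j = x j := by simp [setCoord_apply, h]

@[simp] lemma setCoord_self (i : Fin n) (x : EuclideanSpace ℝ (Fin n)) :
    setCoord i x (x i) = x := by simp [setCoord]

@[simp] lemma setCoord_setCoord (i : Fin n) (x : EuclideanSpace ℝ (Fin n)) (y z : ℝ) :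
    setCoord i (setCoord i x y) z = setCoord i x z := by
  ext j; simp only [setCoord_apply]; split_ifs <;> rfl

lemma setCoord_comm {i j : Fin n} (h : i ≠ j) (x : EuclideanSpace ℝ (Fin n)) (y z : ℝ) :
    setCoord i (setCoord j x y) z = setCoord j (setCoord i x z) y := by
  ext l; simp only [setCoord_apply]; split_ifs <;> simp_all

lemma setCoord_eq_toLp_update (i : Fin n) (x : Fin n → ℝ) (y : ℝ) :
    setCoord i (WithLp.toLp 2 x) y = WithLp.toLp 2 (Function.update x i y) := by
  ext j
  by_cases h : j = i
  · subst h; simp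
  · simp [setCoord_apply, h]

lemma contDiff_coord {k : WithTop ℕ∞} (i : Fin n) :
    ContDiff ℝ k fun x : EuclideanSpace ℝ (Fin n) => x i :=
  (EuclideanSpace.proj i : EuclideanSpace ℝ (Fin n) →L[ℝ] ℝ).contDiff

lemma contDiff_setCoord {k : WithTop ℕ∞} (i : Fin n) :
    ContDiff ℝ k fun r : EuclideanSpace ℝ (Fin n) × ℝ => setCoord i r.1 r.2 := by
  unfold setCoord
  exact contDiff_fst.add ((contDiff_snd.sub ((contDiff_coord i).comp contDiff_fst)).smul
    contDiff_const)

lemma continuous_setCoord (i : Fin n) (x : EuclideanSpace ℝ (Fin n)) :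
    Continuous (setCoord i x) :=
  (contDiff_setCoord (k := 0) i).continuous.comp (by fun_prop : Continuous fun y : ℝ => (x, y))

lemma isCompact_coordBox (lo hi : Fin n → ℝ) : IsCompact (coordBox lo hi) := by
  have h : coordBox lo hi = WithLp.toLp 2 '' (univ.pi fun i => Icc (lo i) (hi i)) := by
    ext x
    constructor
    · intro hx
      exact ⟨WithLp.ofLp x, fun i _ => hx i, rfl⟩
    · rintro ⟨z, hz, rfl⟩ i
      exact hz i (mem_univ i)
  rw [h]
  exact (isCompact_univ_pi fun i => isCompact_Icc).image (PiLp.continuous_toLp 2 _)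

/-- Tonelli's theorem along one coordinate: functions with equal integrals along all lines in the
direction `i` have equal integrals. -/
lemma lintegral_eq_of_line {i : Fin n} {u v : EuclideanSpace ℝ (Fin n) → ENNReal}
    (hu : Measurable u) (hv : Measurable v)
    (h : ∀ x, ∫⁻ s, u (setCoord i x s) = ∫⁻ s, v (setCoord i x s)) : ∫⁻ x, u x = ∫⁻ x, v x := by
  have hm : Measurable (WithLp.toLp 2 : (Fin n → ℝ) → EuclideanSpace ℝ (Fin n)) :=
    (PiLp.continuous_toLp 2 _).measurable
  have e := PiLp.volume_preserving_toLp (Fin n)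
  rw [← e.lintegral_comp hu, ← e.lintegral_comp hv]
  refine lintegral_eq_of_lmarginal_eq {i} (hu.comp hm) (hv.comp hm) ?_
  rw [lmarginal_singleton, lmarginal_singleton]
  ext x
  simpa only [setCoord_eq_toLp_update] using h (WithLp.toLp 2 x)

lemma lintegral_pos_eq_neg_of_integral_eq_zero {α : Type*} [MeasurableSpace α] {μ : Measure α}
    {w : α → ℝ} (hw : Integrable w μ) (h : ∫ x, w x ∂μ = 0) :
    ∫⁻ x, ENNReal.ofReal (w x) ∂μ = ∫⁻ x, ENNReal.ofReal (-w x) ∂μ := by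
  rw [integral_eq_lintegral_pos_part_sub_lintegral_neg_part hw, sub_eq_zero] at h
  refine (ENNReal.toReal_eq_toReal_iff' ?_ ?_).1 h
  · exact ((lintegral_mono fun x => Real.ofReal_le_enorm (w x)).trans_lt
      hw.hasFiniteIntegral).ne
  · exact ((lintegral_mono fun x => by
      simpa using Real.ofReal_le_enorm (-w x)).trans_lt hw.hasFiniteIntegral).ne

/-- A continuous function that vanishes off a box and has zero integral along all lines in one
coordinate direction has zero integral. -/
lemma integral_eq_zero_of_line {i : Fin n} {lo hi : Fin n → ℝ}
    {w : EuclideanSpace ℝ (Fin n) → ℝ} (hw : Continuous w) (hoff : ∀ x ∉ coordBox lo hi, w x = 0)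
    (h : ∀ x, ∫ s in Icc (lo i) (hi i), w (setCoord i x s) = 0) : ∫ x, w x = 0 := by
  have hsupp : HasCompactSupport w :=
    HasCompactSupport.intro (isCompact_coordBox lo hi) hoff
  rw [integral_eq_lintegral_pos_part_sub_lintegral_neg_part (hw.integrable_of_hasCompactSupport
    hsupp), sub_eq_zero]
  congr 1
  refine lintegral_eq_of_line (i := i) (by fun_prop) (by fun_prop) fun x => ?_
  have hc : Continuous fun s => w (setCoord i x s) := hw.comp (continuous_setCoord i x)
  have hoff' : ∀ s ∉ Icc (lo i) (hi i), w (setCoord i x s) = 0 := by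
    intro s hs
    refine hoff _ fun hmem => hs ?_
    simpa using hmem i
  refine lintegral_pos_eq_neg_of_integral_eq_zero
    (hc.integrable_of_hasCompactSupport (HasCompactSupport.intro isCompact_Icc hoff')) ?_
  rw [← h x, setIntegral_eq_integral_of_forall_compl_eq_zero hoff']

end Coordinates

/-! ### Monotone transport along one coordinate -/

section LineTransport

/-- The measure on a space with a volume that has the density `f`. -/
noncomputable def densityMeasure {α : Type*} [MeasureSpace α] (f : α → ℝ) : Measure α :=
  volume.withDensity fun x => ENNReal.ofReal (f x)

lemma densityMeasure_Ioc {f : ℝ → ℝ} (hf : Continuous f) (hf0 : ∀ x, 0 < f x) {c d : ℝ}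
    (hcd : c ≤ d) : densityMeasure f (Ioc c d) = ENNReal.ofReal (∫ s in c..d, f s) := by
  rw [densityMeasure, withDensity_apply _ measurableSet_Ioc, intervalIntegral.integral_of_le hcd,
    ofReal_integral_eq_lintegral_ofReal]
  · exact (hf.integrableOn_Icc (a := c) (b := d)).mono_set Ioc_subset_Icc_self
  · exact Eventually.of_forall fun x => (hf0 x).le

/-- On the line, a monotone bijection that matches the distribution functions transports one density
to the other. -/
lemma map_densityMeasure_of_primitive_eq {f g : ℝ → ℝ} (hf : Continuous f) (hg : Continuous g)
    (hf0 : ∀ x, 0 < f x) (hg0 : ∀ x, 0 < g x) {T : ℝ → ℝ} (hT : StrictMono T)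
    (hT' : Function.Surjective T) {a : ℝ} (h : ∀ y, ∫ s in a..T y, g s = ∫ s in a..y, f s) :
    (densityMeasure f).map T = densityMeasure g := by
  have hkey : ∀ c d : ℝ, c ≤ d →
      (densityMeasure f).map T (Ioc (T c) (T d)) = densityMeasure g (Ioc (T c) (T d)) := by
    intro c d hcd
    rw [Measure.map_apply hT.monotone.measurable measurableSet_Ioc,
      densityMeasure_Ioc hg hg0 (hT.monotone hcd)]
    have : T ⁻¹' Ioc (T c) (T d) = Ioc c d := by
      ext x; simp [hT.lt_iff_lt, hT.le_iff_le]
    rw [this, densityMeasure_Ioc hf hf0 hcd]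
    congr 1
    rw [← intervalIntegral.integral_interval_sub_left (hf.intervalIntegrable a d)
      (hf.intervalIntegrable a c), ← intervalIntegral.integral_interval_sub_left
      (hg.intervalIntegrable a _) (hg.intervalIntegrable a _), h, h]
  refine Measure.ext_of_Ioc' _ _ (fun c d hcd => ?_) fun c d hcd => ?_
  all_goals
    obtain ⟨c, rfl⟩ := hT' c
    obtain ⟨d, rfl⟩ := hT' d
  · rw [hkey c d (hT.lt_iff_lt.1 hcd).le, densityMeasure_Ioc hg hg0 hcd.le]
    exact ENNReal.ofReal_ne_top
  · exact hkey c d (hT.lt_iff_lt.1 hcd).le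

variable {n : ℕ}

/-- The primitive of `f`, based at `a`, along the line through `x` in the direction `i`. -/
noncomputable def linePrim (i : Fin n) (a : ℝ) (f : EuclideanSpace ℝ (Fin n) → ℝ)
    (x : EuclideanSpace ℝ (Fin n)) (y : ℝ) : ℝ :=
  ∫ s in a..y, f (setCoord i x s)

/-- Two positive continuous densities that agree where the `i`-th coordinate is outside `(a, b)`, and
that have the same mass on every line in the direction `i`. -/
structure LineBalanced (i : Fin n) (a b : ℝ) (f g : EuclideanSpace ℝ (Fin n) → ℝ) : Prop where
  le : a ≤ b
  cont_left : Continuous f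
  cont_right : Continuous g
  pos_left : ∀ x, 0 < f x
  pos_right : ∀ x, 0 < g x
  eq_off : ∀ x : EuclideanSpace ℝ (Fin n), x i ≤ a ∨ b ≤ x i → f x = g x
  line_eq : ∀ x, linePrim i a f x b = linePrim i a g x b

variable {i : Fin n} {a b : ℝ} {f g : EuclideanSpace ℝ (Fin n) → ℝ}

lemma LineBalanced.symm (h : LineBalanced i a b f g) : LineBalanced i a b g f :=
  ⟨h.le, h.cont_right, h.cont_left, h.pos_right, h.pos_left, fun x hx => (h.eq_off x hx).symm,
    fun x => (h.line_eq x).symm⟩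

@[simp] lemma linePrim_setCoord (x : EuclideanSpace ℝ (Fin n)) (y z : ℝ) :
    linePrim i a f (setCoord i x y) z = linePrim i a f x z := by
  simp [linePrim]

lemma hasDerivAt_linePrim (hf : Continuous f) (x : EuclideanSpace ℝ (Fin n)) (y : ℝ) :
    HasDerivAt (linePrim i a f x) (f (setCoord i x y)) y :=
  intervalIntegral.integral_hasDerivAt_right
    ((hf.comp (continuous_setCoord i x)).intervalIntegrable _ _)
    ((hf.comp (continuous_setCoord i x)).stronglyMeasurableAtFilter _ _)
    (hf.comp (continuous_setCoord i x)).continuousAt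

lemma strictMono_linePrim (hf : Continuous f) (hf0 : ∀ x, 0 < f x)
    (x : EuclideanSpace ℝ (Fin n)) : StrictMono (linePrim i a f x) :=
  strictMono_of_hasDerivAt_pos (hasDerivAt_linePrim hf x) fun _ => hf0 _

lemma LineBalanced.linePrim_eq_of_off (h : LineBalanced i a b f g)
    (x : EuclideanSpace ℝ (Fin n)) {y : ℝ} (hy : y ≤ a ∨ b ≤ y) :
    linePrim i a f x y = linePrim i a g x y := by
  have hcf := h.cont_left.comp (continuous_setCoord i x)
  have hcg := h.cont_right.comp (continuous_setCoord i x)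
  rcases hy with hy | hy
  · refine intervalIntegral.integral_congr fun s hs => h.eq_off _ (Or.inl ?_)
    rw [uIcc_of_ge hy] at hs
    simpa using hs.2
  · have e1 := intervalIntegral.integral_add_adjacent_intervals (hcf.intervalIntegrable a b)
      (hcf.intervalIntegrable b y) (μ := volume)
    have e2 := intervalIntegral.integral_add_adjacent_intervals (hcg.intervalIntegrable a b)
      (hcg.intervalIntegrable b y) (μ := volume)
    have e3 : ∫ s in b..y, f (setCoord i x s) = ∫ s in b..y, g (setCoord i x s) := by
      refine intervalIntegral.integral_congr fun s hs => h.eq_off _ (Or.inr ?_)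
      rw [uIcc_of_le hy] at hs
      simpa using hs.1
    have e4 := h.line_eq x
    simp only [linePrim, Function.comp_def] at *
    linarith

lemma LineBalanced.exists_linePrim_eq (h : LineBalanced i a b f g)
    (x : EuclideanSpace ℝ (Fin n)) (z : ℝ) : ∃ y, linePrim i a g x y = linePrim i a f x z := by
  have hc : Continuous (linePrim i a g x) :=
    continuous_iff_continuousAt.2 fun y => (hasDerivAt_linePrim h.cont_right x y).continuousAt
  have hm := strictMono_linePrim (i := i) (a := a) h.cont_left h.pos_left x
  refine mem_range_of_exists_le_of_exists_ge hc ⟨min a z, ?_⟩ ⟨max b z, ?_⟩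
  · rw [← h.linePrim_eq_of_off x (Or.inl (min_le_left a z))]
    exact hm.monotone (min_le_right a z)
  · rw [← h.linePrim_eq_of_off x (Or.inr (le_max_left b z))]
    exact hm.monotone (le_max_right b z)

/-- The new `i`-th coordinate of `x` under the monotone transport of `f` to `g` along the lines in
the direction `i`. -/
noncomputable def lineCoord (i : Fin n) (a : ℝ) (f g : EuclideanSpace ℝ (Fin n) → ℝ)
    (x : EuclideanSpace ℝ (Fin n)) : ℝ :=
  Function.invFun (linePrim i a g x) (linePrim i a f x (x i))

/-- The monotone transport of `f` to `g` along the lines in the direction `i`. -/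
noncomputable def lineMap (i : Fin n) (a : ℝ) (f g : EuclideanSpace ℝ (Fin n) → ℝ)
    (x : EuclideanSpace ℝ (Fin n)) : EuclideanSpace ℝ (Fin n) :=
  setCoord i x (lineCoord i a f g x)

lemma LineBalanced.linePrim_lineCoord (h : LineBalanced i a b f g)
    (x : EuclideanSpace ℝ (Fin n)) :
    linePrim i a g x (lineCoord i a f g x) = linePrim i a f x (x i) :=
  Function.invFun_eq (h.exists_linePrim_eq x (x i))

lemma LineBalanced.lineCoord_eq_iff (h : LineBalanced i a b f g)
    (x : EuclideanSpace ℝ (Fin n)) (y : ℝ) :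
    lineCoord i a f g x = y ↔ linePrim i a g x y = linePrim i a f x (x i) := by
  rw [← h.linePrim_lineCoord x]
  constructor
  · rintro rfl; rfl
  · exact fun e => ((strictMono_linePrim h.cont_right h.pos_right x).injective e).symm

lemma LineBalanced.lineMap_lineMap (h : LineBalanced i a b f g)
    (x : EuclideanSpace ℝ (Fin n)) : lineMap i a g f (lineMap i a f g x) = x := by
  have : lineCoord i a g f (lineMap i a f g x) = x i := by
    rw [h.symm.lineCoord_eq_iff]
    simp only [lineMap, linePrim_setCoord, setCoord_same]
    exact (h.linePrim_lineCoord x).symm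
  rw [lineMap, this, lineMap, setCoord_setCoord, setCoord_self]

lemma LineBalanced.lineMap_eq_self (h : LineBalanced i a b f g) {lo hi : Fin n → ℝ}
    (ha : lo i = a) (hb : hi i = b) (hoff : ∀ x ∉ coordBox lo hi, f x = g x)
    {x : EuclideanSpace ℝ (Fin n)} (hx : x ∉ coordBox lo hi) : lineMap i a f g x = x := by
  have : lineCoord i a f g x = x i := by
    rw [h.lineCoord_eq_iff]
    by_cases hxi : x i ≤ a ∨ b ≤ x i
    · exact (h.linePrim_eq_of_off x hxi).symm
    · push Not at hxi
      simp only [coordBox, mem_ofPred_eq, not_forall] at hx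
      obtain ⟨j, hj⟩ := hx
      have hji : j ≠ i := by
        rintro rfl
        exact hj ⟨by rw [ha]; exact hxi.1.le, by rw [hb]; exact hxi.2.le⟩
      refine intervalIntegral.integral_congr fun s _ => (hoff _ fun hmem => hj ?_).symm
      have := hmem j
      rwa [setCoord_of_ne hji] at this
  rw [lineMap, this, setCoord_self]

/-- The line transport pushes `f dx` forward to `g dx`: on every line this is the one-dimensional
statement. -/
lemma LineBalanced.map_densityMeasure (h : LineBalanced i a b f g)
    (hm : Measurable (lineMap i a f g)) :
    (densityMeasure f).map (lineMap i a f g) = densityMeasure g := by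
  ext A hA
  have hfm : Measurable f := h.cont_left.measurable
  have hgm : Measurable g := h.cont_right.measurable
  rw [Measure.map_apply hm hA, densityMeasure, densityMeasure, withDensity_apply _ (hm hA),
    withDensity_apply _ hA, ← lintegral_indicator (hm hA), ← lintegral_indicator hA]
  refine lintegral_eq_of_line (i := i) ((hfm.ennreal_ofReal).indicator (hm hA))
    ((hgm.ennreal_ofReal).indicator hA) fun x => ?_
  have hline : Measurable (setCoord i x) := (continuous_setCoord i x).measurable
  set T : ℝ → ℝ := fun s => lineCoord i a f g (setCoord i x s) with hT
  have hTspec : ∀ s, linePrim i a g x (T s) = linePrim i a f x s := by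
    intro s
    have := h.linePrim_lineCoord (setCoord i x s)
    simpa using this
  have hfmono := strictMono_linePrim (i := i) (a := a) h.cont_left h.pos_left x
  have hgmono := strictMono_linePrim (i := i) (a := a) h.cont_right h.pos_right x
  have hTmono : StrictMono T := by
    intro s s' hs
    rw [← hgmono.lt_iff_lt, hTspec, hTspec]
    exact hfmono hs
  have hTsurj : Function.Surjective T := by
    intro y
    obtain ⟨s, hs⟩ := h.symm.exists_linePrim_eq x y
    exact ⟨s, hgmono.injective (by rw [hTspec, hs])⟩
  have hmap := map_densityMeasure_of_primitive_eq (h.cont_left.comp (continuous_setCoord i x))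
    (h.cont_right.comp (continuous_setCoord i x)) (fun s => h.pos_left _)
    (fun s => h.pos_right _) hTmono hTsurj (a := a) hTspec
  have e := congrArg (fun μ => μ (setCoord i x ⁻¹' A)) hmap
  rw [Measure.map_apply hTmono.monotone.measurable (hline hA), densityMeasure, densityMeasure,
    withDensity_apply _ (hTmono.monotone.measurable (hline hA)), withDensity_apply _ (hline hA),
    ← lintegral_indicator (hTmono.monotone.measurable (hline hA)),
    ← lintegral_indicator (hline hA)] at e
  refine Eq.trans (lintegral_congr fun s => ?_) (e.trans (lintegral_congr fun s => ?_))
  · have : setCoord i x s ∈ lineMap i a f g ⁻¹' A ↔ s ∈ T ⁻¹' (setCoord i x ⁻¹' A) := by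
      simp [lineMap, hT]
    by_cases hs : s ∈ T ⁻¹' (setCoord i x ⁻¹' A)
    · rw [indicator_of_mem hs, indicator_of_mem (this.2 hs)]; rfl
    · rw [indicator_of_notMem hs, indicator_of_notMem (fun h' => hs (this.1 h'))]
  · rfl

end LineTransport

/-! ### Families of densities and of transport maps -/

section Families

variable {n : ℕ}

lemma convex_slab : Convex ℝ (Icc (0 : ℝ) 1 ×ˢ (univ : Set (EuclideanSpace ℝ (Fin n)))) :=
  (convex_Icc 0 1).prod convex_univ

lemma uniqueDiffOn_slab :
    UniqueDiffOn ℝ (Icc (0 : ℝ) 1 ×ˢ (univ : Set (EuclideanSpace ℝ (Fin n)))) :=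
  (uniqueDiffOn_Icc zero_lt_one).prod uniqueDiffOn_univ

/-- A system of regularity hypotheses.  `Φ τ k` stands for "the given data, with time changed by
`τ`, are of class `C^k`": `τ = id` encodes regularity jointly in time and space, and a constant `τ`
encodes regularity in space at one time.  Both are treated together, because all the constructions
below act at each time separately and so commute with the change of time. -/
structure IsRegularitySystem (Φ : (ℝ → ℝ) → ℕ∞ → Prop) : Prop where
  mapsTo : ∀ τ k, Φ τ k → MapsTo τ (Icc (0 : ℝ) 1) (Icc (0 : ℝ) 1)
  id_zero : Φ id 0

/-- The family `u`, seen through every change of time `τ`, has the regularity that `Φ` asserts for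
the data. -/
def RegularFamily (Φ : (ℝ → ℝ) → ℕ∞ → Prop) (u : ℝ → EuclideanSpace ℝ (Fin n) → ℝ) : Prop :=
  ∀ τ k, Φ τ k → ContDiffOn ℝ k (fun p : ℝ × EuclideanSpace ℝ (Fin n) => u (τ p.1) p.2)
    (Icc (0 : ℝ) 1 ×ˢ univ)

/-- The homeomorphisms `ψ t` transport `f t dx` to `g t dx` for `t ∈ [0,1]`, with the regularity that
`Φ` asserts for the data. -/
structure Transports (Φ : (ℝ → ℝ) → ℕ∞ → Prop) (f g : ℝ → EuclideanSpace ℝ (Fin n) → ℝ)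
    (ψ : ℝ → EuclideanSpace ℝ (Fin n) ≃ₜ EuclideanSpace ℝ (Fin n)) : Prop where
  map_eq : ∀ t ∈ Icc (0 : ℝ) 1, (densityMeasure (f t)).map (ψ t) = densityMeasure (g t)
  contDiffOn : ∀ τ k, Φ τ k → ContDiffOn ℝ k
    (fun p : ℝ × EuclideanSpace ℝ (Fin n) => ψ (τ p.1) p.2) (Icc (0 : ℝ) 1 ×ˢ univ)
  contDiffOn_symm : ∀ τ k, Φ τ k → ContDiffOn ℝ k
    (fun p : ℝ × EuclideanSpace ℝ (Fin n) => (ψ (τ p.1)).symm p.2) (Icc (0 : ℝ) 1 ×ˢ univ)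
  jacobian : ∀ t ∈ Icc (0 : ℝ) 1, Φ (fun _ => t) 1 → ∀ x,
    g t (ψ t x) * (fderiv ℝ (ψ t) x).det = f t x

variable {Φ : (ℝ → ℝ) → ℕ∞ → Prop} {f g h : ℝ → EuclideanSpace ℝ (Fin n) → ℝ}
  {ψ φ : ℝ → EuclideanSpace ℝ (Fin n) ≃ₜ EuclideanSpace ℝ (Fin n)}

/-- A family of maps that is `C^k` on `[0,1] × ℝⁿ` and constant in time is a `C^k` map. -/
lemma contDiff_of_contDiffOn_slab {F : Type*} [NormedAddCommGroup F] [NormedSpace ℝ F]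
    {k : WithTop ℕ∞} {v : EuclideanSpace ℝ (Fin n) → F}
    (hv : ContDiffOn ℝ k (fun p : ℝ × EuclideanSpace ℝ (Fin n) => v p.2)
      (Icc (0 : ℝ) 1 ×ˢ univ)) : ContDiff ℝ k v := by
  rw [← contDiffOn_univ]
  exact hv.comp (f := fun x => ((0 : ℝ), x)) (contDiff_const.prodMk contDiff_id).contDiffOn
    fun x _ => ⟨by simp, mem_univ _⟩

lemma Transports.contDiff (hψ : Transports Φ f g ψ) {t : ℝ} {k : ℕ∞} (ht : Φ (fun _ => t) k) :
    ContDiff ℝ k (ψ t) ∧ ContDiff ℝ k (ψ t).symm :=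
  ⟨contDiff_of_contDiffOn_slab (hψ.contDiffOn _ k ht),
    contDiff_of_contDiffOn_slab (hψ.contDiffOn_symm _ k ht)⟩

lemma Transports.refl (hfg : ∀ t ∈ Icc (0 : ℝ) 1, f t = g t) :
    Transports Φ f g fun _ => Homeomorph.refl _ where
  map_eq t ht := by
    rw [hfg t ht]
    exact Measure.map_id
  contDiffOn _ _ _ := contDiff_snd.contDiffOn
  contDiffOn_symm _ _ _ := contDiff_snd.contDiffOn
  jacobian t ht _ x := by
    have : (fderiv ℝ (Homeomorph.refl (EuclideanSpace ℝ (Fin n))) x) =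
        ContinuousLinearMap.id ℝ _ := fderiv_id
    have hdet : (ContinuousLinearMap.id ℝ (EuclideanSpace ℝ (Fin n))).det = 1 := LinearMap.det_id
    rw [this, hfg t ht, hdet, mul_one]
    rfl

lemma Transports.trans (hψ : Transports Φ f g ψ) (hφ : Transports Φ g h φ) :
    Transports Φ f h fun t => (ψ t).trans (φ t) where
  map_eq t ht := by
    rw [← hφ.map_eq t ht, ← hψ.map_eq t ht,
      Measure.map_map (φ t).continuous.measurable (ψ t).continuous.measurable]
    rfl
  contDiffOn τ k hk :=
    (hφ.contDiffOn τ k hk).comp (contDiff_fst.contDiffOn.prodMk (hψ.contDiffOn τ k hk))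
      fun p hp => ⟨hp.1, mem_univ _⟩
  contDiffOn_symm τ k hk :=
    (hψ.contDiffOn_symm τ k hk).comp (contDiff_fst.contDiffOn.prodMk (hφ.contDiffOn_symm τ k hk))
      fun p hp => ⟨hp.1, mem_univ _⟩
  jacobian t ht h1 x := by
    have hd1 : DifferentiableAt ℝ (ψ t) x := (hψ.contDiff h1).1.differentiable (by simp) x
    have hd2 : DifferentiableAt ℝ (φ t) (ψ t x) := (hφ.contDiff h1).1.differentiable (by simp) _
    have e : fderiv ℝ ((ψ t).trans (φ t)) x =
        (fderiv ℝ (φ t) (ψ t x)).comp (fderiv ℝ (ψ t) x) := fderiv_comp x hd2 hd1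
    have edet : ((fderiv ℝ (φ t) (ψ t x)).comp (fderiv ℝ (ψ t) x)).det =
        (fderiv ℝ (φ t) (ψ t x)).det * (fderiv ℝ (ψ t) x).det := LinearMap.det_comp _ _
    rw [e, edet, ← hψ.jacobian t ht h1 x, ← hφ.jacobian t ht h1 (ψ t x)]
    simp only [Homeomorph.trans_apply]
    ring

lemma RegularFamily.continuousOn (hΦ : IsRegularitySystem Φ) (hf : RegularFamily Φ f) :
    ContinuousOn (fun p : ℝ × EuclideanSpace ℝ (Fin n) => f p.1 p.2) (Icc (0 : ℝ) 1 ×ˢ univ) :=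
  (hf id 0 hΦ.id_zero).continuousOn

lemma RegularFamily.continuous (hΦ : IsRegularitySystem Φ) (hf : RegularFamily Φ f)
    {t : ℝ} (ht : t ∈ Icc (0 : ℝ) 1) : Continuous (f t) :=
  (hf.continuousOn hΦ).continuous_section (W := fun p => f p.1 p.2) ht

lemma RegularFamily.add (hf : RegularFamily Φ f) (hg : RegularFamily Φ g) :
    RegularFamily Φ fun t x => f t x + g t x := fun τ k hk => (hf τ k hk).add (hg τ k hk)

lemma RegularFamily.sub (hf : RegularFamily Φ f) (hg : RegularFamily Φ g) :
    RegularFamily Φ fun t x => f t x - g t x := fun τ k hk => (hf τ k hk).sub (hg τ k hk)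

lemma RegularFamily.mul (hf : RegularFamily Φ f) (hg : RegularFamily Φ g) :
    RegularFamily Φ fun t x => f t x * g t x := fun τ k hk => (hf τ k hk).mul (hg τ k hk)

lemma RegularFamily.sum {ι : Type*} {s : Finset ι} {u : ι → ℝ → EuclideanSpace ℝ (Fin n) → ℝ}
    (hu : ∀ j ∈ s, RegularFamily Φ (u j)) : RegularFamily Φ fun t x => ∑ j ∈ s, u j t x :=
  fun τ k hk => ContDiffOn.sum fun j hj => hu j hj τ k hk

lemma RegularFamily.of_contDiff {v : EuclideanSpace ℝ (Fin n) → ℝ}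
    (hv : ∀ k : ℕ∞, ContDiff ℝ k v) : RegularFamily Φ fun _ x => v x :=
  fun _ k _ => ((hv k).comp contDiff_snd).contDiffOn

lemma RegularFamily.const (c : ℝ) :
    RegularFamily Φ fun (_ : ℝ) (_ : EuclideanSpace ℝ (Fin n)) => c :=
  RegularFamily.of_contDiff fun _ => contDiff_const

lemma RegularFamily.setIntegral (hf : RegularFamily Φ f) {K : Set (EuclideanSpace ℝ (Fin n))}
    (hK : IsCompact K) : RegularFamily Φ fun t (_ : EuclideanSpace ℝ (Fin n)) =>
      ∫ y in K, f t y := by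
  intro τ k hk
  refine ContDiffOn.setIntegral_param convex_slab uniqueDiffOn_slab hK
    (W := fun r : (ℝ × EuclideanSpace ℝ (Fin n)) × EuclideanSpace ℝ (Fin n) => f (τ r.1.1) r.2) ?_
  exact (hf τ k hk).comp (f := fun r : (ℝ × EuclideanSpace ℝ (Fin n)) ×
    EuclideanSpace ℝ (Fin n) => (r.1.1, r.2)) (by fun_prop) fun r hr => ⟨hr.1.1, mem_univ _⟩

lemma RegularFamily.setIntegral_line (hf : RegularFamily Φ f) (i : Fin n) (a b : ℝ) :
    RegularFamily Φ fun t x => ∫ s in Icc a b, f t (setCoord i x s) := by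
  intro τ k hk
  refine ContDiffOn.setIntegral_param convex_slab uniqueDiffOn_slab isCompact_Icc
    (W := fun r : (ℝ × EuclideanSpace ℝ (Fin n)) × ℝ => f (τ r.1.1) (setCoord i r.1.2 r.2)) ?_
  refine (hf τ k hk).comp (f := fun r : (ℝ × EuclideanSpace ℝ (Fin n)) × ℝ =>
    (r.1.1, setCoord i r.1.2 r.2)) ?_ fun r hr => ⟨hr.1.1, mem_univ _⟩
  exact ((contDiff_fst.comp contDiff_fst).prodMk ((contDiff_setCoord i).comp
    ((contDiff_snd.comp contDiff_fst).prodMk contDiff_snd))).contDiffOn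

end Families

section LineFamilies

variable {n : ℕ} {i : Fin n}

lemma linePrim_eq_mul_integral (a : ℝ) (f : EuclideanSpace ℝ (Fin n) → ℝ)
    (x : EuclideanSpace ℝ (Fin n)) (y : ℝ) :
    linePrim i a f x y =
      (y - a) * ∫ σ in Icc (0 : ℝ) 1, f (setCoord i x (a + (y - a) * σ)) := by
  rw [integral_Icc_eq_integral_Ioc, ← intervalIntegral.integral_of_le zero_le_one,
    intervalIntegral.mul_integral_comp_add_mul (f := fun s => f (setCoord i x s)), linePrim]
  simp

lemma contDiffOn_linePrim {k : ℕ∞} {f : ℝ → EuclideanSpace ℝ (Fin n) → ℝ}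
    (hf : ContDiffOn ℝ k (fun p : ℝ × EuclideanSpace ℝ (Fin n) => f p.1 p.2)
      (Icc (0 : ℝ) 1 ×ˢ univ)) (a : ℝ) :
    ContDiffOn ℝ k (fun r : (ℝ × EuclideanSpace ℝ (Fin n)) × ℝ =>
      linePrim i a (f r.1.1) r.1.2 r.2) ((Icc (0 : ℝ) 1 ×ˢ univ) ×ˢ univ) := by
  simp only [linePrim_eq_mul_integral]
  refine ContDiffOn.mul (by fun_prop) (ContDiffOn.setIntegral_param
    (convex_slab.prod convex_univ) (uniqueDiffOn_slab.prod uniqueDiffOn_univ) isCompact_Icc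
    (W := fun r : ((ℝ × EuclideanSpace ℝ (Fin n)) × ℝ) × ℝ =>
      f r.1.1.1 (setCoord i r.1.1.2 (a + (r.1.2 - a) * r.2))) ?_)
  refine hf.comp (f := fun r : ((ℝ × EuclideanSpace ℝ (Fin n)) × ℝ) × ℝ =>
      (r.1.1.1, setCoord i r.1.1.2 (a + (r.1.2 - a) * r.2))) ?_ fun r hr => ⟨hr.1.1.1, mem_univ _⟩
  have h1 : ContDiff ℝ k fun r : ((ℝ × EuclideanSpace ℝ (Fin n)) × ℝ) × ℝ =>
      (r.1.1.2, a + (r.1.2 - a) * r.2) := by fun_prop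
  have h2 : ContDiff ℝ k fun r : ((ℝ × EuclideanSpace ℝ (Fin n)) × ℝ) × ℝ => r.1.1.1 := by fun_prop
  exact (h2.prodMk ((contDiff_setCoord i).comp h1)).contDiffOn

lemma contDiffOn_lineCoord {k : ℕ∞} {a b : ℝ} {f g : ℝ → EuclideanSpace ℝ (Fin n) → ℝ}
    (hb : ∀ t ∈ Icc (0 : ℝ) 1, LineBalanced i a b (f t) (g t))
    (hf : ContDiffOn ℝ k (fun p : ℝ × EuclideanSpace ℝ (Fin n) => f p.1 p.2)
      (Icc (0 : ℝ) 1 ×ˢ univ))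
    (hg : ContDiffOn ℝ k (fun p : ℝ × EuclideanSpace ℝ (Fin n) => g p.1 p.2)
      (Icc (0 : ℝ) 1 ×ˢ univ)) :
    ContDiffOn ℝ k (fun p : ℝ × EuclideanSpace ℝ (Fin n) => lineCoord i a (f p.1) (g p.1) p.2)
      (Icc (0 : ℝ) 1 ×ˢ univ) := by
  set H : (ℝ × EuclideanSpace ℝ (Fin n)) × ℝ → ℝ := fun r =>
    linePrim i a (g r.1.1) r.1.2 r.2 - linePrim i a (f r.1.1) r.1.2 (r.1.2 i) with hHdef
  have hH : ContDiffOn ℝ k H ((Icc (0 : ℝ) 1 ×ˢ univ) ×ˢ univ) := by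
    refine (contDiffOn_linePrim hg a).sub ((contDiffOn_linePrim hf a).comp
      (f := fun r : (ℝ × EuclideanSpace ℝ (Fin n)) × ℝ => (r.1, r.1.2 i)) ?_
      fun r hr => ⟨hr.1, mem_univ _⟩)
    exact (contDiff_fst.prodMk
      ((contDiff_coord i).comp (contDiff_snd.comp contDiff_fst))).contDiffOn
  have h0 : ∀ p ∈ Icc (0 : ℝ) 1 ×ˢ (univ : Set (EuclideanSpace ℝ (Fin n))),
      H (p, lineCoord i a (f p.1) (g p.1) p.2) = 0 := fun p hp =>
    sub_eq_zero.2 ((hb p.1 hp.1).linePrim_lineCoord p.2)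
  refine ContDiffOn.implicit uniqueDiffOn_slab hH
    (continuousOn_implicit_of_strictMono hH.continuousOn (fun p hp => ?_) h0) h0 fun p hp => ?_
  · intro y z hyz
    exact sub_lt_sub_right
      (strictMono_linePrim (hb p.1 hp.1).cont_right (hb p.1 hp.1).pos_right p.2 hyz) _
  · have := (hasDerivAt_linePrim (i := i) (a := a) (hb p.1 hp.1).cont_right p.2
      (lineCoord i a (f p.1) (g p.1) p.2)).sub_const (linePrim i a (f p.1) p.2 (p.2 i))
    exact ⟨_, ((hb p.1 hp.1).pos_right _).ne', this⟩

lemma contDiffOn_lineMap {k : ℕ∞} {a b : ℝ} {f g : ℝ → EuclideanSpace ℝ (Fin n) → ℝ}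
    (hb : ∀ t ∈ Icc (0 : ℝ) 1, LineBalanced i a b (f t) (g t))
    (hf : ContDiffOn ℝ k (fun p : ℝ × EuclideanSpace ℝ (Fin n) => f p.1 p.2)
      (Icc (0 : ℝ) 1 ×ˢ univ))
    (hg : ContDiffOn ℝ k (fun p : ℝ × EuclideanSpace ℝ (Fin n) => g p.1 p.2)
      (Icc (0 : ℝ) 1 ×ˢ univ)) :
    ContDiffOn ℝ k (fun p : ℝ × EuclideanSpace ℝ (Fin n) => lineMap i a (f p.1) (g p.1) p.2)
      (Icc (0 : ℝ) 1 ×ˢ univ) :=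
  (contDiff_setCoord i).comp_contDiffOn
    (contDiff_snd.contDiffOn.prodMk (contDiffOn_lineCoord hb hf hg))

variable {a b : ℝ} {f g : EuclideanSpace ℝ (Fin n) → ℝ}

lemma LineBalanced.continuous_lineMap (h : LineBalanced i a b f g) :
    Continuous (lineMap i a f g) := by
  refine (contDiff_of_contDiffOn_slab (k := 0) ?_).continuous
  refine contDiffOn_lineMap (k := 0) (f := fun _ => f) (g := fun _ => g) (fun _ _ => h) ?_ ?_
  · exact contDiffOn_zero.2 (h.cont_left.comp continuous_snd).continuousOn
  · exact contDiffOn_zero.2 (h.cont_right.comp continuous_snd).continuousOn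

/-- The line transport as a homeomorphism; its inverse is the transport in the other direction. -/
noncomputable def LineBalanced.homeomorph (h : LineBalanced i a b f g) :
    EuclideanSpace ℝ (Fin n) ≃ₜ EuclideanSpace ℝ (Fin n) where
  toFun := lineMap i a f g
  invFun := lineMap i a g f
  left_inv := h.lineMap_lineMap
  right_inv := h.symm.lineMap_lineMap
  continuous_toFun := h.continuous_lineMap
  continuous_invFun := h.symm.continuous_lineMap

/-- The derivative of the line transport is a transvection, so its determinant is the derivative of
the new coordinate along the line. -/
lemma LineBalanced.jacobian (h : LineBalanced i a b f g) {x : EuclideanSpace ℝ (Fin n)}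
    (hd : DifferentiableAt ℝ (lineCoord i a f g) x) :
    g (lineMap i a f g x) * (fderiv ℝ (lineMap i a f g) x).det = f x := by
  set e : EuclideanSpace ℝ (Fin n) := EuclideanSpace.single i 1 with he
  set L := fderiv ℝ (lineCoord i a f g) x with hL
  set π : EuclideanSpace ℝ (Fin n) →L[ℝ] ℝ := EuclideanSpace.proj i with hπ
  have hder : HasFDerivAt (lineMap i a f g)
      (ContinuousLinearMap.id ℝ _ + (L - π).smulRight e) x :=
    (hasFDerivAt_id x).add ((hd.hasFDerivAt.sub π.hasFDerivAt).smul_const e)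
  have hdet : (ContinuousLinearMap.id ℝ _ + (L - π).smulRight e).det = L e := by
    have h1 : ((ContinuousLinearMap.id ℝ _ + (L - π).smulRight e : EuclideanSpace ℝ (Fin n) →L[ℝ]
        EuclideanSpace ℝ (Fin n)) : EuclideanSpace ℝ (Fin n) →ₗ[ℝ] EuclideanSpace ℝ (Fin n)) =
        LinearMap.transvection ((L - π : EuclideanSpace ℝ (Fin n) →L[ℝ] ℝ) :
          EuclideanSpace ℝ (Fin n) →ₗ[ℝ] ℝ) e := by
      ext v; simp [LinearMap.transvection]
    have h2 : π e = 1 := by simp [hπ, he]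
    rw [ContinuousLinearMap.det, h1, LinearMap.transvection.det]
    simp [h2]
  rw [hder.fderiv, hdet]
  -- differentiate `∫ g = ∫ f` along the line through `x`
  have hline : HasDerivAt (fun s => setCoord i x s) e (x i) := by
    have h3 : HasDerivAt (fun s : ℝ => (s - x i) • e) ((1 : ℝ) • e) (x i) :=
      ((hasDerivAt_id (x i)).sub_const (x i)).smul_const e
    rw [one_smul] at h3
    exact h3.const_add x
  have hy : HasDerivAt (fun s => lineCoord i a f g (setCoord i x s)) (L e) (x i) := by
    have h4 : HasFDerivAt (lineCoord i a f g) L (setCoord i x (x i)) := by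
      rw [setCoord_self]; exact hd.hasFDerivAt
    exact h4.comp_hasDerivAt (x i) hline
  have hG := (hasDerivAt_linePrim (a := a) (i := i) h.cont_right x
    (lineCoord i a f g (setCoord i x (x i)))).comp (x i) hy
  have hF := hasDerivAt_linePrim (a := a) (i := i) h.cont_left x (x i)
  have hEq : (linePrim i a g x) ∘ (fun s => lineCoord i a f g (setCoord i x s)) =
      linePrim i a f x := by
    ext s
    simpa using h.linePrim_lineCoord (setCoord i x s)
  rw [hEq] at hG
  have := hG.unique hF
  rwa [setCoord_self] at this

/-- Families of densities with the same mass on all lines in one coordinate direction are transported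
to each other along these lines. -/
lemma exists_transports_of_lineBalanced {Φ : (ℝ → ℝ) → ℕ∞ → Prop} (hΦ : IsRegularitySystem Φ)
    {f g : ℝ → EuclideanSpace ℝ (Fin n) → ℝ} (hf : RegularFamily Φ f) (hg : RegularFamily Φ g)
    {lo hi : Fin n → ℝ} (hb : ∀ t ∈ Icc (0 : ℝ) 1, LineBalanced i (lo i) (hi i) (f t) (g t))
    (hoff : ∀ t ∈ Icc (0 : ℝ) 1, ∀ x ∉ coordBox lo hi, f t x = g t x) :
    ∃ ψ, Transports Φ f g ψ ∧ ∀ t ∈ Icc (0 : ℝ) 1, ∀ x ∉ coordBox lo hi, ψ t x = x := by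
  classical
  set ψ : ℝ → EuclideanSpace ℝ (Fin n) ≃ₜ EuclideanSpace ℝ (Fin n) := fun t =>
    if ht : t ∈ Icc (0 : ℝ) 1 then (hb t ht).homeomorph else Homeomorph.refl _ with hψ
  have h1 : ∀ t ∈ Icc (0 : ℝ) 1, ∀ x, ψ t x = lineMap i (lo i) (f t) (g t) x := by
    intro t ht x; simp only [hψ, dif_pos ht]; rfl
  have h2 : ∀ t ∈ Icc (0 : ℝ) 1, ∀ x, (ψ t).symm x = lineMap i (lo i) (g t) (f t) x := by
    intro t ht x; simp only [hψ, dif_pos ht]; rfl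
  have h1' : ∀ t ∈ Icc (0 : ℝ) 1, (ψ t : _ → _) = lineMap i (lo i) (f t) (g t) := fun t ht =>
    funext (h1 t ht)
  refine ⟨ψ, ⟨fun t ht => ?_, fun τ k hk => ?_, fun τ k hk => ?_, fun t ht h x => ?_⟩,
    fun t ht x hx => ?_⟩
  · rw [h1' t ht]
    exact (hb t ht).map_densityMeasure (hb t ht).continuous_lineMap.measurable
  · have hτ := hΦ.mapsTo τ k hk
    exact (contDiffOn_lineMap (f := fun t => f (τ t)) (g := fun t => g (τ t))
      (fun t ht => hb _ (hτ ht)) (hf τ k hk) (hg τ k hk)).congr fun p hp => h1 _ (hτ hp.1) _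
  · have hτ := hΦ.mapsTo τ k hk
    exact (contDiffOn_lineMap (f := fun t => g (τ t)) (g := fun t => f (τ t))
      (fun t ht => (hb _ (hτ ht)).symm) (hg τ k hk) (hf τ k hk)).congr
        fun p hp => h2 _ (hτ hp.1) _
  · rw [h1' t ht]
    refine (hb t ht).jacobian ?_
    have := contDiff_of_contDiffOn_slab (contDiffOn_lineCoord (f := fun _ => f t)
      (g := fun _ => g t) (fun _ _ => hb t ht) (hf _ _ h) (hg _ _ h))
    exact this.differentiable (by simp) x
  · rw [h1 t ht]
    exact (hb t ht).lineMap_eq_self rfl rfl (hoff t ht) hx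

end LineFamilies

/-! ### Densities that differ in one box -/

section Bump

/-- A smooth function that is positive on `(a, b)` and vanishes elsewhere. -/
noncomputable def intervalBump (a b u : ℝ) : ℝ := expNegInvGlue (u - a) * expNegInvGlue (b - u)

lemma contDiff_intervalBump (a b : ℝ) (k : ℕ∞) : ContDiff ℝ k (intervalBump a b) :=
  (expNegInvGlue.contDiff.comp (contDiff_id.sub contDiff_const)).mul
    (expNegInvGlue.contDiff.comp (contDiff_const.sub contDiff_id))

lemma intervalBump_nonneg (a b u : ℝ) : 0 ≤ intervalBump a b u :=
  mul_nonneg (expNegInvGlue.nonneg _) (expNegInvGlue.nonneg _)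

lemma intervalBump_pos {a b u : ℝ} (h1 : a < u) (h2 : u < b) : 0 < intervalBump a b u :=
  mul_pos (expNegInvGlue.pos_of_pos (sub_pos.2 h1)) (expNegInvGlue.pos_of_pos (sub_pos.2 h2))

lemma intervalBump_eq_zero {a b u : ℝ} (h : ¬(a < u ∧ u < b)) : intervalBump a b u = 0 := by
  rw [not_and_or, not_lt, not_lt] at h
  rcases h with h | h
  · rw [intervalBump, expNegInvGlue.zero_of_nonpos (sub_nonpos.2 h), zero_mul]
  · rw [intervalBump, expNegInvGlue.zero_of_nonpos (sub_nonpos.2 h), mul_zero]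

lemma setIntegral_intervalBump_pos {a b : ℝ} (hab : a < b) :
    0 < ∫ s in Icc a b, intervalBump a b s := by
  have hc : Continuous (intervalBump a b) := (contDiff_intervalBump a b 0).continuous
  have hoff : ∀ s ∉ Icc a b, intervalBump a b s = 0 := fun s hs =>
    intervalBump_eq_zero fun h => hs ⟨h.1.le, h.2.le⟩
  rw [setIntegral_eq_integral_of_forall_compl_eq_zero hoff]
  refine hc.integral_pos_of_hasCompactSupport_nonneg_nonzero
    (HasCompactSupport.intro isCompact_Icc hoff) (intervalBump_nonneg a b) (x := (a + b) / 2) ?_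
  exact (intervalBump_pos (by linarith) (by linarith)).ne'

end Bump

section BoxSolver

variable {n : ℕ} {lo hi : Fin n → ℝ}

/-- The function with the same integrals as `h` along the lines in the direction `i`, whose profile on
each of these lines is a fixed bump function of the `i`-th coordinate. -/
noncomputable def lineAverage (lo hi : Fin n → ℝ) (i : Fin n) (h : EuclideanSpace ℝ (Fin n) → ℝ)
    (x : EuclideanSpace ℝ (Fin n)) : ℝ :=
  intervalBump (lo i) (hi i) (x i) * (∫ s in Icc (lo i) (hi i), intervalBump (lo i) (hi i) s)⁻¹ *
    ∫ s in Icc (lo i) (hi i), h (setCoord i x s)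

/-- Successive averaging along a list of coordinate directions. -/
noncomputable def lineAverages (lo hi : Fin n → ℝ) :
    List (Fin n) → (EuclideanSpace ℝ (Fin n) → ℝ) → EuclideanSpace ℝ (Fin n) → ℝ
  | [], h => h
  | i :: l, h => lineAverages lo hi l (lineAverage lo hi i h)

variable {h : EuclideanSpace ℝ (Fin n) → ℝ}

lemma lineAverage_eq_zero_off (hoff : ∀ x ∉ coordBox lo hi, h x = 0) (i : Fin n) :
    ∀ x ∉ coordBox lo hi, lineAverage lo hi i h x = 0 := by
  intro x hx
  simp only [coordBox, mem_ofPred_eq, not_forall] at hx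
  obtain ⟨j, hj⟩ := hx
  by_cases hji : j = i
  · subst hji
    rw [lineAverage, intervalBump_eq_zero fun hlt => hj ⟨hlt.1.le, hlt.2.le⟩, zero_mul, zero_mul]
  · have : ∀ s, h (setCoord i x s) = 0 := fun s => hoff _ fun hmem => hj (by
      have := hmem j
      rwa [setCoord_of_ne hji] at this)
    simp [lineAverage, this]

lemma setIntegral_line_lineAverage {i : Fin n} (hi' : lo i < hi i)
    (x : EuclideanSpace ℝ (Fin n)) :
    ∫ s in Icc (lo i) (hi i), lineAverage lo hi i h (setCoord i x s) =
      ∫ s in Icc (lo i) (hi i), h (setCoord i x s) := by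
  have hpos := setIntegral_intervalBump_pos hi'
  simp only [lineAverage, setCoord_same, setCoord_setCoord]
  rw [integral_mul_const, integral_mul_const, mul_inv_cancel₀ hpos.ne', one_mul]

/-- The profile of `h` along the lines in the direction `j` is the bump function. -/
def IsProportional (lo hi : Fin n → ℝ) (j : Fin n) (h : EuclideanSpace ℝ (Fin n) → ℝ) : Prop :=
  ∀ x y, intervalBump (lo j) (hi j) y * h x =
    intervalBump (lo j) (hi j) (x j) * h (setCoord j x y)

lemma isProportional_lineAverage_self (i : Fin n) :
    IsProportional lo hi i (lineAverage lo hi i h) := by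
  intro x y
  simp only [lineAverage, setCoord_same, setCoord_setCoord]
  ring

lemma IsProportional.lineAverage {j : Fin n} (hj : IsProportional lo hi j h) (i : Fin n) :
    IsProportional lo hi j (lineAverage lo hi i h) := by
  by_cases hij : i = j
  · subst hij; exact isProportional_lineAverage_self i
  intro x y
  have key : intervalBump (lo j) (hi j) y * ∫ s in Icc (lo i) (hi i), h (setCoord i x s) =
      intervalBump (lo j) (hi j) (x j) *
        ∫ s in Icc (lo i) (hi i), h (setCoord i (setCoord j x y) s) := by
    rw [← integral_const_mul, ← integral_const_mul]
    refine integral_congr_ae (Eventually.of_forall fun s => ?_)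
    have := hj (setCoord i x s) y
    rw [setCoord_of_ne (Ne.symm hij)] at this
    simp only [setCoord_comm hij]
    exact this
  simp only [_root_.lineAverage]
  rw [setCoord_of_ne hij]
  linear_combination (intervalBump (lo i) (hi i) (x i) *
    (∫ s in Icc (lo i) (hi i), intervalBump (lo i) (hi i) s)⁻¹) * key

lemma IsProportional.lineAverages {j : Fin n} (l : List (Fin n)) :
    ∀ {h : EuclideanSpace ℝ (Fin n) → ℝ}, (j ∈ l ∨ IsProportional lo hi j h) →
      IsProportional lo hi j (lineAverages lo hi l h) := by
  induction l with
  | nil => intro h hj; exact hj.resolve_left (by simp)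
  | cons i l ih =>
    intro h hj
    refine ih ?_
    rcases hj with hj | hj
    · rcases List.mem_cons.1 hj with rfl | hj
      · exact Or.inr (isProportional_lineAverage_self _)
      · exact Or.inl hj
    · exact Or.inr (hj.lineAverage i)

/-- A function with the bump profile in every direction is a multiple of the product of the bumps, so
it vanishes if its integral does. -/
lemma eq_zero_of_isProportional (hlt : ∀ i, lo i < hi i)
    (hprop : ∀ j, IsProportional lo hi j h) (hint : ∫ x, h x = 0)
    (x : EuclideanSpace ℝ (Fin n)) : h x = 0 := by
  classical
  set z : EuclideanSpace ℝ (Fin n) := WithLp.toLp 2 fun i => (lo i + hi i) / 2 with hz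
  set B : EuclideanSpace ℝ (Fin n) → ℝ := fun x => ∏ j, intervalBump (lo j) (hi j) (x j) with hB
  have step : ∀ s : Finset (Fin n), ∀ x : EuclideanSpace ℝ (Fin n),
      ∃ x' : EuclideanSpace ℝ (Fin n), (∀ j ∈ s, x' j = z j) ∧ (∀ j ∉ s, x' j = x j) ∧
        (∏ j ∈ s, intervalBump (lo j) (hi j) (z j)) * h x =
        (∏ j ∈ s, intervalBump (lo j) (hi j) (x j)) * h x' := by
    intro s x
    induction s using Finset.induction_on with
    | empty => exact ⟨x, by simp⟩
    | insert j s hj ih =>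
      obtain ⟨x', h1, h2, h3⟩ := ih
      refine ⟨setCoord j x' (z j), fun l hl => ?_, fun l hl => ?_, ?_⟩
      · by_cases hlj : l = j
        · subst hlj; simp
        · rw [setCoord_of_ne hlj, h1 l ((Finset.mem_insert.1 hl).resolve_left hlj)]
      · rw [Finset.mem_insert, not_or] at hl
        rw [setCoord_of_ne hl.1, h2 l hl.2]
      · rw [Finset.prod_insert hj, Finset.prod_insert hj]
        have := hprop j x' (z j)
        rw [h2 j hj] at this
        linear_combination intervalBump (lo j) (hi j) (z j) * h3 +
          (∏ j ∈ s, intervalBump (lo j) (hi j) (x j)) * this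
  have hBz : 0 < B z := Finset.prod_pos fun j _ => by
    have := hlt j
    exact intervalBump_pos (by simp only [hz]; linarith) (by simp only [hz]; linarith)
  have hall : ∀ x, B z * h x = B x * h z := by
    intro x
    obtain ⟨x', h1, -, h3⟩ := step Finset.univ x
    have : x' = z := by ext j; exact h1 j (Finset.mem_univ j)
    rwa [this] at h3
  have hBc : Continuous B := continuous_finsetProd _ fun j _ =>
    (contDiff_intervalBump _ _ 0).continuous.comp (contDiff_coord (k := 0) j).continuous
  have hBoff : ∀ x ∉ coordBox lo hi, B x = 0 := by
    intro x hx
    simp only [coordBox, mem_ofPred_eq, not_forall] at hx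
    obtain ⟨j, hj⟩ := hx
    exact Finset.prod_eq_zero (Finset.mem_univ j)
      (intervalBump_eq_zero fun hlt => hj ⟨hlt.1.le, hlt.2.le⟩)
  have hBint : 0 < ∫ x, B x := hBc.integral_pos_of_hasCompactSupport_nonneg_nonzero
    (HasCompactSupport.intro (isCompact_coordBox lo hi) hBoff)
    (fun x => Finset.prod_nonneg fun j _ => intervalBump_nonneg _ _ _) hBz.ne'
  have h0 : (∫ x, B x) * h z = 0 := by
    rw [← integral_mul_const, ← integral_congr_ae (Eventually.of_forall hall),
      integral_const_mul, hint, mul_zero]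
  have hz0 : h z = 0 := (mul_eq_zero.1 h0).resolve_left hBint.ne'
  have := hall x
  rw [hz0, mul_zero] at this
  exact (mul_eq_zero.1 this).resolve_left hBz.ne'

lemma continuous_lineAverage (hh : Continuous h) (i : Fin n) :
    Continuous (lineAverage lo hi i h) := by
  have h1 : RegularFamily (fun τ k => τ = id ∧ k = 0) fun (_ : ℝ) => h := by
    rintro τ k ⟨-, rfl⟩
    exact contDiffOn_zero.2 (hh.comp continuous_snd).continuousOn
  have h2 := h1.setIntegral_line i (lo i) (hi i) id 0 ⟨rfl, rfl⟩
  have h3 := (contDiff_of_contDiffOn_slab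
    (v := fun x => ∫ s in Icc (lo i) (hi i), h (setCoord i x s)) h2).continuous
  have h4 : Continuous fun x : EuclideanSpace ℝ (Fin n) => intervalBump (lo i) (hi i) (x i) :=
    (contDiff_intervalBump _ _ 0).continuous.comp (contDiff_coord (k := 0) i).continuous
  exact (h4.mul continuous_const).mul h3

lemma integral_lineAverage (hh : Continuous h) (hoff : ∀ x ∉ coordBox lo hi, h x = 0) {i : Fin n}
    (hi' : lo i < hi i) : ∫ x, lineAverage lo hi i h x = ∫ x, h x := by
  have hc := continuous_lineAverage (lo := lo) (hi := hi) hh i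
  have hoff' := lineAverage_eq_zero_off hoff i
  have hK := isCompact_coordBox lo hi
  rw [← sub_eq_zero, ← integral_sub
    (hc.integrable_of_hasCompactSupport (HasCompactSupport.intro hK hoff'))
    (hh.integrable_of_hasCompactSupport (HasCompactSupport.intro hK hoff))]
  refine integral_eq_zero_of_line (lo := lo) (hi := hi) (i := i) (hc.sub hh)
    (fun x hx => by rw [hoff' x hx, hoff x hx, sub_zero]) fun x => ?_
  rw [integral_sub, setIntegral_line_lineAverage hi', sub_self]
  · exact ((hc.comp (continuous_setCoord i x)).integrableOn_Icc)
  · exact ((hh.comp (continuous_setCoord i x)).integrableOn_Icc)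

lemma integral_lineAverages (hlt : ∀ i, lo i < hi i) (l : List (Fin n)) :
    ∀ {h : EuclideanSpace ℝ (Fin n) → ℝ}, Continuous h → (∀ x ∉ coordBox lo hi, h x = 0) →
      ∫ x, lineAverages lo hi l h x = ∫ x, h x := by
  induction l with
  | nil => intro h _ _; rfl
  | cons i l ih =>
    intro h hh hoff
    rw [lineAverages, ih (continuous_lineAverage hh i) (lineAverage_eq_zero_off hoff i),
      integral_lineAverage hh hoff (hlt i)]

lemma lineAverages_finRange_eq_zero (hlt : ∀ i, lo i < hi i) (hh : Continuous h)
    (hoff : ∀ x ∉ coordBox lo hi, h x = 0) (hint : ∫ x, h x = 0) (x : EuclideanSpace ℝ (Fin n)) :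
    lineAverages lo hi (List.finRange n) h x = 0 :=
  eq_zero_of_isProportional hlt
    (fun j => IsProportional.lineAverages _ (Or.inl (List.mem_finRange j)))
    (by rw [integral_lineAverages hlt _ hh hoff, hint]) x

variable {Φ : (ℝ → ℝ) → ℕ∞ → Prop} {u : ℝ → EuclideanSpace ℝ (Fin n) → ℝ}

lemma RegularFamily.lineAverage (hu : RegularFamily Φ u) (i : Fin n) :
    RegularFamily Φ fun t => lineAverage lo hi i (u t) := by
  have h4 : RegularFamily Φ fun (_ : ℝ) (x : EuclideanSpace ℝ (Fin n)) =>
      intervalBump (lo i) (hi i) (x i) :=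
    RegularFamily.of_contDiff fun k => (contDiff_intervalBump _ _ k).comp (contDiff_coord i)
  exact (h4.mul (RegularFamily.const _)).mul (hu.setIntegral_line i (lo i) (hi i))

lemma RegularFamily.exists_bound (hΦ : IsRegularitySystem Φ) (hu : RegularFamily Φ u)
    (hoff : ∀ t ∈ Icc (0 : ℝ) 1, ∀ x ∉ coordBox lo hi, u t x = 0) :
    ∃ C, 0 ≤ C ∧ ∀ t ∈ Icc (0 : ℝ) 1, ∀ x, |u t x| ≤ C := by
  obtain ⟨C, hC⟩ := (isCompact_Icc.prod (isCompact_coordBox lo hi)).exists_bound_of_continuousOn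
    ((hu.continuousOn hΦ).mono (prod_mono subset_rfl (subset_univ _)))
  refine ⟨max C 0, le_max_right _ _, fun t ht x => ?_⟩
  by_cases hx : x ∈ coordBox lo hi
  · exact (hC (t, x) ⟨ht, hx⟩).trans (le_max_left _ _)
  · rw [hoff t ht x hx, abs_zero]; exact le_max_right _ _

/-- Averaging along one direction, scaled down so that densities stay positive, is realized by a line
transport; a list of directions by a composition of line transports.  The constant `C` bounds all the
functions that occur, and `p` is a background density that dominates their multiples by `c`. -/
lemma exists_transports_lineAverages (hΦ : IsRegularitySystem Φ) (hlt : ∀ i, lo i < hi i)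
    (l : List (Fin n)) : ∀ {u : ℝ → EuclideanSpace ℝ (Fin n) → ℝ}, RegularFamily Φ u →
      (∀ t ∈ Icc (0 : ℝ) 1, ∀ x ∉ coordBox lo hi, u t x = 0) →
      ∃ C, 0 ≤ C ∧ ∀ (p : ℝ → EuclideanSpace ℝ (Fin n) → ℝ) (c : ℝ), 0 ≤ c → RegularFamily Φ p →
        (∀ t ∈ Icc (0 : ℝ) 1, ∀ x, 0 < p t x) →
        (∀ t ∈ Icc (0 : ℝ) 1, ∀ x ∈ coordBox lo hi, c * C < p t x) →
        ∃ ψ, Transports Φ (fun t x => p t x + c * u t x)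
          (fun t x => p t x + c * lineAverages lo hi l (u t) x) ψ ∧
          ∀ t ∈ Icc (0 : ℝ) 1, ∀ x ∉ coordBox lo hi, ψ t x = x := by
  induction l with
  | nil =>
    intro u _ _
    exact ⟨0, le_rfl, fun p c _ _ _ _ =>
      ⟨fun _ => Homeomorph.refl _, Transports.refl fun _ _ => rfl, fun _ _ _ _ => rfl⟩⟩
  | cons i l ih =>
    intro u hu hoff
    have hAu : RegularFamily Φ fun t => _root_.lineAverage lo hi i (u t) := hu.lineAverage i
    have hAoff : ∀ t ∈ Icc (0 : ℝ) 1, ∀ x ∉ coordBox lo hi, lineAverage lo hi i (u t) x = 0 :=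
      fun t ht => lineAverage_eq_zero_off (hoff t ht) i
    obtain ⟨C₁, hC₁, hC₁'⟩ := hu.exists_bound hΦ hoff
    obtain ⟨C₂, hC₂, hC₂'⟩ := hAu.exists_bound hΦ hAoff
    obtain ⟨C₃, hC₃, hC₃'⟩ := ih hAu hAoff
    refine ⟨C₁ + C₂ + C₃, by positivity, fun p c hc hp hp0 hpC => ?_⟩
    obtain ⟨φ, hφ, hφ'⟩ := hC₃' p c hc hp hp0 fun t ht x hx =>
      lt_of_le_of_lt (mul_le_mul_of_nonneg_left (by linarith) hc) (hpC t ht x hx)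
    have hpos : ∀ (v : ℝ → EuclideanSpace ℝ (Fin n) → ℝ),
        (∀ t ∈ Icc (0 : ℝ) 1, ∀ x ∉ coordBox lo hi, v t x = 0) →
        (∀ t ∈ Icc (0 : ℝ) 1, ∀ x, |v t x| ≤ C₁ + C₂ + C₃) →
        ∀ t ∈ Icc (0 : ℝ) 1, ∀ x, 0 < p t x + c * v t x := by
      intro v hv hvC t ht x
      by_cases hx : x ∈ coordBox lo hi
      · have h1 := hpC t ht x hx
        have h2 := mul_le_mul_of_nonneg_left (abs_le.1 (hvC t ht x)).1 hc
        linarith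
      · rw [hv t ht x hx, mul_zero, add_zero]
        exact hp0 t ht x
    have hr1 : RegularFamily Φ fun t x => p t x + c * u t x :=
      hp.add ((RegularFamily.const c).mul hu)
    have hr2 : RegularFamily Φ fun t x => p t x + c * lineAverage lo hi i (u t) x :=
      hp.add ((RegularFamily.const c).mul hAu)
    have hbal : ∀ t ∈ Icc (0 : ℝ) 1, LineBalanced i (lo i) (hi i) (fun x => p t x + c * u t x)
        fun x => p t x + c * lineAverage lo hi i (u t) x := by
      intro t ht
      have hcp := hp.continuous hΦ ht
      have hcu := hu.continuous hΦ ht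
      have hcA := hAu.continuous hΦ ht
      refine ⟨(hlt i).le, hr1.continuous hΦ ht, hr2.continuous hΦ ht,
        hpos u hoff (fun t ht x => (hC₁' t ht x).trans (by linarith)) t ht,
        hpos _ hAoff (fun t ht x => (hC₂' t ht x).trans (by linarith)) t ht, fun x hx => ?_,
        fun x => ?_⟩
      · have h1 : lineAverage lo hi i (u t) x = 0 := by
          rw [lineAverage, intervalBump_eq_zero (by
            rintro ⟨ha, hb⟩; rcases hx with hx | hx <;> linarith), zero_mul, zero_mul]
        have h2 : u t x = 0 := by
          -- `u t` vanishes on the open half-spaces off the box, so also on their boundaries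
          rcases hx with hx | hx
          · have hev : ∀ y ∈ Iio (lo i), u t (setCoord i x y) = 0 := fun y hy =>
              hoff t ht _ fun hmem => by have := (hmem i).1; simp at this; exact absurd hy this.not_gt
            have hcl := (hcu.comp (continuous_setCoord i x)).closure_preimage_subset {0}
            have hx' : x i ∈ closure (Iio (lo i)) := by rw [closure_Iio]; exact hx
            have := hcl (closure_mono (fun y hy => hev y hy) hx')
            simpa using this
          · have hev : ∀ y ∈ Ioi (hi i), u t (setCoord i x y) = 0 := fun y hy =>
              hoff t ht _ fun hmem => by have := (hmem i).2; simp at this; exact absurd hy this.not_gt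
            have hcl := (hcu.comp (continuous_setCoord i x)).closure_preimage_subset {0}
            have hx' : x i ∈ closure (Ioi (hi i)) := by rw [closure_Ioi]; exact hx
            have := hcl (closure_mono (fun y hy => hev y hy) hx')
            simpa using this
        rw [h1, h2]
      · have hint : ∀ v : EuclideanSpace ℝ (Fin n) → ℝ, Continuous v →
            IntervalIntegrable (fun s => v (setCoord i x s)) volume (lo i) (hi i) := fun v hv =>
          (hv.comp (continuous_setCoord i x)).intervalIntegrable _ _
        simp only [linePrim]
        rw [intervalIntegral.integral_add (hint _ hcp) ((hint _ hcu).const_mul c),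
          intervalIntegral.integral_add (hint _ hcp) ((hint _ hcA).const_mul c),
          intervalIntegral.integral_const_mul, intervalIntegral.integral_const_mul]
        congr 2
        rw [intervalIntegral.integral_of_le (hlt i).le, intervalIntegral.integral_of_le (hlt i).le,
          ← integral_Icc_eq_integral_Ioc, ← integral_Icc_eq_integral_Ioc,
          setIntegral_line_lineAverage (hlt i)]
    obtain ⟨ψ, hψ, hψ'⟩ := exists_transports_of_lineBalanced (i := i) (lo := lo) (hi := hi)
      hΦ hr1 hr2 hbal fun t ht x hx => by rw [hoff t ht x hx, hAoff t ht x hx]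
    refine ⟨fun t => (ψ t).trans (φ t), hψ.trans hφ, fun t ht x hx => ?_⟩
    rw [Homeomorph.trans_apply, hψ' t ht x hx, hφ' t ht x hx]

/-- Two families of positive densities that agree off a box and have the same mass are transported to
each other by homeomorphisms that are the identity off the box.  The difference is removed in many
small portions, so that all the densities in between are positive. -/
theorem exists_transports_of_eq_off_coordBox (hΦ : IsRegularitySystem Φ) (hlt : ∀ i, lo i < hi i)
    {f g : ℝ → EuclideanSpace ℝ (Fin n) → ℝ} (hf : RegularFamily Φ f) (hg : RegularFamily Φ g)
    (hf0 : ∀ t ∈ Icc (0 : ℝ) 1, ∀ x, 0 < f t x) (hg0 : ∀ t ∈ Icc (0 : ℝ) 1, ∀ x, 0 < g t x)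
    (hoff : ∀ t ∈ Icc (0 : ℝ) 1, ∀ x ∉ coordBox lo hi, f t x = g t x)
    (hint : ∀ t ∈ Icc (0 : ℝ) 1, ∫ x, (f t x - g t x) = 0) :
    ∃ ψ, Transports Φ f g ψ ∧ ∀ t ∈ Icc (0 : ℝ) 1, ∀ x ∉ coordBox lo hi, ψ t x = x := by
  have hu : RegularFamily Φ fun t x => f t x - g t x := hf.sub hg
  have huoff : ∀ t ∈ Icc (0 : ℝ) 1, ∀ x ∉ coordBox lo hi, f t x - g t x = 0 := fun t ht x hx =>
    sub_eq_zero.2 (hoff t ht x hx)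
  obtain ⟨C, hC, key⟩ := exists_transports_lineAverages hΦ hlt (List.finRange n) hu huoff
  -- a positive lower bound of both densities on the box
  obtain ⟨m, hm, hmf, hmg⟩ : ∃ m > 0, (∀ t ∈ Icc (0 : ℝ) 1, ∀ x ∈ coordBox lo hi, m ≤ f t x) ∧
      ∀ t ∈ Icc (0 : ℝ) 1, ∀ x ∈ coordBox lo hi, m ≤ g t x := by
    have hK := (isCompact_Icc (a := (0 : ℝ)) (b := 1)).prod (isCompact_coordBox lo hi)
    have hsub := prod_mono (subset_refl (Icc (0 : ℝ) 1)) (subset_univ (coordBox lo hi))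
    obtain ⟨m₁, hm₁, h₁⟩ := hK.exists_forall_le' ((hf.continuousOn hΦ).mono hsub)
      (a := 0) fun p hp => hf0 p.1 hp.1 p.2
    obtain ⟨m₂, hm₂, h₂⟩ := hK.exists_forall_le' ((hg.continuousOn hΦ).mono hsub)
      (a := 0) fun p hp => hg0 p.1 hp.1 p.2
    exact ⟨min m₁ m₂, lt_min hm₁ hm₂,
      fun t ht x hx => (min_le_left _ _).trans (h₁ (t, x) ⟨ht, hx⟩),
      fun t ht x hx => (min_le_right _ _).trans (h₂ (t, x) ⟨ht, hx⟩)⟩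
  obtain ⟨N, hN⟩ := exists_nat_gt (C / m)
  have hN0 : (0 : ℝ) < N := lt_of_le_of_lt (div_nonneg hC hm.le) hN
  have hNm : (N : ℝ)⁻¹ * C < m := by
    rw [inv_mul_lt_iff₀ hN0, ← div_lt_iff₀ hm]; exact hN
  have main : ∀ j : ℕ, j ≤ N → ∃ ψ,
      Transports Φ f (fun t x => f t x - j * (N : ℝ)⁻¹ * (f t x - g t x)) ψ ∧
      ∀ t ∈ Icc (0 : ℝ) 1, ∀ x ∉ coordBox lo hi, ψ t x = x := by
    intro j
    induction j with
    | zero =>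
      intro _
      exact ⟨fun _ => Homeomorph.refl _, Transports.refl fun t _ => by ext; simp,
        fun _ _ _ _ => rfl⟩
    | succ j ih =>
      intro hj
      obtain ⟨ψ, hψ, hψ'⟩ := ih (Nat.le_of_succ_le hj)
      have hs0 : (0 : ℝ) ≤ ((j + 1 : ℕ) : ℝ) * (N : ℝ)⁻¹ := by positivity
      have hs1 : ((j + 1 : ℕ) : ℝ) * (N : ℝ)⁻¹ ≤ 1 := by
        rw [← div_eq_mul_inv, div_le_one hN0]; exact_mod_cast hj
      have hpos : ∀ t ∈ Icc (0 : ℝ) 1, ∀ x,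
          0 < f t x - ((j + 1 : ℕ) : ℝ) * (N : ℝ)⁻¹ * (f t x - g t x) := by
        intro t ht x
        have h1 := hf0 t ht x
        have h2 := hg0 t ht x
        rcases eq_or_lt_of_le hs1 with h3 | h3
        · rw [h3]; linarith
        · nlinarith
      have hlow : ∀ t ∈ Icc (0 : ℝ) 1, ∀ x ∈ coordBox lo hi, (N : ℝ)⁻¹ * C <
          f t x - ((j + 1 : ℕ) : ℝ) * (N : ℝ)⁻¹ * (f t x - g t x) := by
        intro t ht x hx
        have h1 := hmf t ht x hx
        have h2 := hmg t ht x hx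
        refine hNm.trans_le ?_
        nlinarith
      obtain ⟨φ, hφ, hφ'⟩ := key _ (N : ℝ)⁻¹ (by positivity)
        (hf.sub ((RegularFamily.const _).mul hu)) hpos hlow
      refine ⟨fun t => (ψ t).trans (φ t), ?_, fun t ht x hx => ?_⟩
      · have e1 : (fun t x => f t x - (j : ℝ) * (N : ℝ)⁻¹ * (f t x - g t x)) = fun t x =>
            f t x - ((j + 1 : ℕ) : ℝ) * (N : ℝ)⁻¹ * (f t x - g t x) +
              (N : ℝ)⁻¹ * (f t x - g t x) := by
          ext t x; push_cast; ring
        rw [e1] at hψ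
        have h3 := hψ.trans hφ
        -- at times in `[0,1]` all the averages of `f - g` vanish
        refine h3.trans (φ := fun _ => Homeomorph.refl _) (Transports.refl fun t ht => ?_)
        ext x
        rw [lineAverages_finRange_eq_zero hlt (hu.continuous hΦ ht) (huoff t ht) (hint t ht)]
        simp
      · rw [Homeomorph.trans_apply, hψ' t ht x hx, hφ' t ht x hx]
  obtain ⟨ψ, hψ, hψ'⟩ := main N le_rfl
  refine ⟨ψ, ?_, hψ'⟩
  have e : (fun t x => f t x - (N : ℝ) * (N : ℝ)⁻¹ * (f t x - g t x)) = g := by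
    ext t x; rw [mul_inv_cancel₀ hN0.ne']; ring
  rwa [e] at hψ

end BoxSolver

/-! ### Chains of densities that change in one small box at a time -/

section Stages

variable {n : ℕ}

lemma mem_of_eq_off {B : Set (EuclideanSpace ℝ (Fin n))}
    {ψ : EuclideanSpace ℝ (Fin n) ≃ₜ EuclideanSpace ℝ (Fin n)} (hψ : ∀ x ∉ B, ψ x = x)
    {x : EuclideanSpace ℝ (Fin n)} (hx : x ∈ B) : ψ x ∈ B := by
  by_contra h
  have := ψ.injective (hψ _ h)
  rw [this] at h
  exact h hx

lemma dist_le_of_mem_coordBox {lo hi : Fin n → ℝ} {w : ℝ} (hw : ∀ i, hi i - lo i ≤ w)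
    {x y : EuclideanSpace ℝ (Fin n)} (hx : x ∈ coordBox lo hi) (hy : y ∈ coordBox lo hi) :
    dist x y ≤ √n * w := by
  rcases Nat.eq_zero_or_pos n with rfl | hn
  · rw [Subsingleton.elim x y, dist_self]; simp
  have hw0 : 0 ≤ w := by
    have h1 := hx ⟨0, hn⟩
    have h2 := hw ⟨0, hn⟩
    linarith [h1.1, h1.2]
  rw [EuclideanSpace.dist_eq, Real.sqrt_le_left (by positivity), mul_pow,
    Real.sq_sqrt (Nat.cast_nonneg n)]
  calc ∑ i, dist (x i) (y i) ^ 2 ≤ ∑ _i : Fin n, w ^ 2 := by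
        refine Finset.sum_le_sum fun i _ => ?_
        have : dist (x i) (y i) ≤ w := by
          rw [Real.dist_eq, abs_le]
          have h1 := hx i
          have h2 := hy i
          have h3 := hw i
          constructor <;> linarith
        exact pow_le_pow_left₀ dist_nonneg this 2
    _ = n * w ^ 2 := by simp

variable {Φ : (ℝ → ℝ) → ℕ∞ → Prop} {ι : Type*} [DecidableEq ι] {lo hi : ι → Fin n → ℝ}
  {d : Finset ι → ℝ → EuclideanSpace ℝ (Fin n) → ℝ}

/-- Changes of density in disjoint boxes are undone by maps that preserve each of these boxes. -/
lemma exists_transports_disjoint_boxes (hΦ : IsRegularitySystem Φ) (hlt : ∀ j i, lo j i < hi j i)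
    (hreg : ∀ s, RegularFamily Φ (d s)) (hpos : ∀ s, ∀ t ∈ Icc (0 : ℝ) 1, ∀ x, 0 < d s t x)
    (hoff : ∀ s, ∀ j ∉ s, ∀ t ∈ Icc (0 : ℝ) 1, ∀ x ∉ coordBox (lo j) (hi j),
      d (insert j s) t x = d s t x)
    (hint : ∀ s, ∀ j ∉ s, ∀ t ∈ Icc (0 : ℝ) 1, ∫ x, (d (insert j s) t x - d s t x) = 0)
    (b s : Finset ι) (hsb : Disjoint b s)
    (hdisj : ∀ j ∈ s, ∀ k ∈ s, j ≠ k → Disjoint (coordBox (lo j) (hi j)) (coordBox (lo k) (hi k))) :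
    ∃ ψ, Transports Φ (d (b ∪ s)) (d b) ψ ∧ ∀ t ∈ Icc (0 : ℝ) 1, ∀ x,
      (∀ j ∈ s, x ∈ coordBox (lo j) (hi j) → ψ t x ∈ coordBox (lo j) (hi j)) ∧
      ((∀ j ∈ s, x ∉ coordBox (lo j) (hi j)) → ψ t x = x) := by
  induction s using Finset.induction_on with
  | empty =>
    exact ⟨fun _ => Homeomorph.refl _, by rw [Finset.union_empty]; exact Transports.refl fun _ _ => rfl,
      fun t _ x => ⟨by simp, fun _ => rfl⟩⟩
  | insert j s hj ih =>
    rw [Finset.disjoint_insert_right] at hsb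
    obtain ⟨ψ, hψ, hψ'⟩ := ih hsb.2 fun k hk l hl => hdisj k (Finset.mem_insert_of_mem hk) l
      (Finset.mem_insert_of_mem hl)
    have hjbs : j ∉ b ∪ s := by simp [hsb.1, hj]
    obtain ⟨φ, hφ, hφ'⟩ := exists_transports_of_eq_off_coordBox hΦ (hlt j)
      (hreg (insert j (b ∪ s))) (hreg (b ∪ s)) (hpos _) (hpos _) (hoff _ j hjbs) (hint _ j hjbs)
    rw [Finset.union_insert]
    have hjk : ∀ k ∈ s, Disjoint (coordBox (lo j) (hi j)) (coordBox (lo k) (hi k)) := fun k hk =>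
      hdisj j (Finset.mem_insert_self j s) k (Finset.mem_insert_of_mem hk) (by
        rintro rfl; exact hj hk)
    refine ⟨fun t => (φ t).trans (ψ t), hφ.trans hψ, fun t ht x => ⟨fun k hk hx => ?_, fun hx => ?_⟩⟩
    · rw [Homeomorph.trans_apply]
      rcases Finset.mem_insert.1 hk with rfl | hk
      · have h1 := mem_of_eq_off (hφ' t ht) hx
        rw [(hψ' t ht _).2 fun l hl h2 => (hjk l hl).le_bot ⟨h1, h2⟩]
        exact h1
      · rw [hφ' t ht x fun h1 => (hjk k hk).le_bot ⟨h1, hx⟩]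
        exact (hψ' t ht x).1 k hk hx
    · rw [Homeomorph.trans_apply, hφ' t ht x (hx j (Finset.mem_insert_self j s)),
        (hψ' t ht x).2 fun k hk => hx k (Finset.mem_insert_of_mem hk)]

/-- If boxes of the same colour are disjoint, then each colour contributes one box diameter to the
displacement, whatever the number of boxes. -/
lemma exists_transports_of_coloring [Fintype ι] {κ : Type*} [Fintype κ] [DecidableEq κ]
    (hΦ : IsRegularitySystem Φ)
    (hlt : ∀ j i, lo j i < hi j i) (hreg : ∀ s, RegularFamily Φ (d s))
    (hpos : ∀ s, ∀ t ∈ Icc (0 : ℝ) 1, ∀ x, 0 < d s t x)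
    (hoff : ∀ s, ∀ j ∉ s, ∀ t ∈ Icc (0 : ℝ) 1, ∀ x ∉ coordBox (lo j) (hi j),
      d (insert j s) t x = d s t x)
    (hint : ∀ s, ∀ j ∉ s, ∀ t ∈ Icc (0 : ℝ) 1, ∫ x, (d (insert j s) t x - d s t x) = 0)
    (col : ι → κ) (hcol : ∀ j k, col j = col k → j ≠ k →
      Disjoint (coordBox (lo j) (hi j)) (coordBox (lo k) (hi k)))
    {w : ℝ} (hw : ∀ j i, hi j i - lo j i ≤ w) (hw0 : 0 ≤ w) :
    ∃ ψ, Transports Φ (d Finset.univ) (d ∅) ψ ∧ ∀ t ∈ Icc (0 : ℝ) 1, ∀ x,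
      dist (ψ t x) x ≤ Fintype.card κ * (√n * w) ∧
      ((∀ j, x ∉ coordBox (lo j) (hi j)) → ψ t x = x) := by
  have main : ∀ C : Finset κ, ∃ ψ,
      Transports Φ (d (Finset.univ.filter fun j => col j ∈ C)) (d ∅) ψ ∧
      ∀ t ∈ Icc (0 : ℝ) 1, ∀ x, dist (ψ t x) x ≤ C.card * (√n * w) ∧
      ((∀ j, x ∉ coordBox (lo j) (hi j)) → ψ t x = x) := by
    intro C
    induction C using Finset.induction_on with
    | empty =>
      exact ⟨fun _ => Homeomorph.refl _, Transports.refl fun t _ => by simp,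
        fun t _ x => ⟨by simp, fun _ => rfl⟩⟩
    | insert c C hc ih =>
      obtain ⟨ψ, hψ, hψ'⟩ := ih
      obtain ⟨φ, hφ, hφ'⟩ := exists_transports_disjoint_boxes hΦ hlt hreg hpos hoff hint
        (Finset.univ.filter fun j => col j ∈ C) (Finset.univ.filter fun j => col j = c)
        (Finset.disjoint_filter.2 fun j _ h1 h2 => hc (h2 ▸ h1))
        fun j hj k hk hjk => hcol j k (by
          rw [(Finset.mem_filter.1 hj).2, (Finset.mem_filter.1 hk).2]) hjk
      have e : (Finset.univ.filter fun j => col j ∈ insert c C) =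
          (Finset.univ.filter fun j => col j ∈ C) ∪ Finset.univ.filter fun j => col j = c := by
        ext j; simp [or_comm]
      rw [e]
      refine ⟨fun t => (φ t).trans (ψ t), hφ.trans hψ, fun t ht x => ⟨?_, fun hx => ?_⟩⟩
      · rw [Homeomorph.trans_apply, Finset.card_insert_of_notMem hc]
        have h1 : dist (φ t x) x ≤ √n * w := by
          by_cases hx : ∃ j ∈ Finset.univ.filter (fun j => col j = c), x ∈ coordBox (lo j) (hi j)
          · obtain ⟨j, hj, hxj⟩ := hx
            exact dist_le_of_mem_coordBox (hw j) ((hφ' t ht x).1 j hj hxj) hxj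
          · push Not at hx
            rw [(hφ' t ht x).2 hx, dist_self]
            positivity
        have h2 := (hψ' t ht (φ t x)).1
        have h3 := dist_triangle (ψ t (φ t x)) (φ t x) x
        push_cast
        linarith
      · rw [Homeomorph.trans_apply, (hφ' t ht x).2 fun j _ => hx j, (hψ' t ht x).2 hx]
  obtain ⟨ψ, hψ, hψ'⟩ := main Finset.univ
  simp only [Finset.mem_univ, Finset.filter_true] at hψ
  exact ⟨ψ, hψ, hψ'⟩

end Stages

/-! ### A smooth partition of unity on the unit cube -/

section Cells

/-- A smooth monotone function that vanishes up to `-1/4` and equals `1` from `1/4` on. -/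
noncomputable def cellStep (u : ℝ) : ℝ := Real.smoothTransition (2 * u + 1 / 2)

/-- The `j`-th function of a partition of unity of `[0,1]`; it is supported in the interval of length
`3 / (2 m)` around `j / m`. -/
noncomputable def lineCell (m j : ℕ) (z : ℝ) : ℝ :=
  cellStep (m * z - j + 1 / 2) - cellStep (m * z - j - 1 / 2)

lemma cellStep_monotone : Monotone cellStep := fun _ _ h =>
  Real.smoothTransition.monotone (by linarith)

lemma cellStep_zero {u : ℝ} (h : u ≤ -(1 / 4)) : cellStep u = 0 :=
  Real.smoothTransition.zero_of_nonpos (by linarith)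

lemma cellStep_one {u : ℝ} (h : 1 / 4 ≤ u) : cellStep u = 1 :=
  Real.smoothTransition.one_of_one_le (by linarith)

lemma contDiff_cellStep (k : ℕ∞) : ContDiff ℝ k cellStep :=
  Real.smoothTransition.contDiff.comp (by fun_prop)

lemma contDiff_lineCell (m j : ℕ) (k : ℕ∞) : ContDiff ℝ k (lineCell m j) :=
  ((contDiff_cellStep k).comp (by fun_prop)).sub ((contDiff_cellStep k).comp (by fun_prop))

lemma lineCell_nonneg (m j : ℕ) (z : ℝ) : 0 ≤ lineCell m j z :=
  sub_nonneg.2 (cellStep_monotone (by linarith))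

lemma lineCell_le_one (m j : ℕ) (z : ℝ) : lineCell m j z ≤ 1 := by
  have h1 : cellStep (m * z - j + 1 / 2) ≤ 1 := Real.smoothTransition.le_one _
  have h2 : 0 ≤ cellStep (m * z - j - 1 / 2) := Real.smoothTransition.nonneg _
  unfold lineCell; linarith

lemma lineCell_eq_one {m j : ℕ} {z : ℝ} (h : |m * z - j| ≤ 1 / 4) : lineCell m j z = 1 := by
  rw [abs_le] at h
  rw [lineCell, cellStep_one (by linarith), cellStep_zero (by linarith), sub_zero]

lemma lineCell_eq_zero {m j : ℕ} {z : ℝ} (h : 3 / 4 ≤ |m * z - j|) : lineCell m j z = 0 := by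
  rcases le_abs.1 h with h | h
  · rw [lineCell, cellStep_one (by linarith), cellStep_one (by linarith), sub_self]
  · rw [lineCell, cellStep_zero (by linarith), cellStep_zero (by linarith), sub_self]

lemma sum_lineCell {m : ℕ} {z : ℝ} (h0 : 0 ≤ z) (h1 : z ≤ 1) :
    ∑ j : Fin (m + 1), lineCell m j z = 1 := by
  have hm : (0 : ℝ) ≤ m := Nat.cast_nonneg m
  have tele : ∀ N : ℕ, ∑ j ∈ Finset.range N, lineCell m j z =
      cellStep (m * z + 1 / 2) - cellStep (m * z - N + 1 / 2) := by
    intro N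
    induction N with
    | zero => simp
    | succ N ih =>
      rw [Finset.sum_range_succ, ih, lineCell]
      push_cast
      rw [show (m : ℝ) * z - (N + 1) + 1 / 2 = m * z - N - 1 / 2 by ring]
      ring
  rw [Fin.sum_univ_eq_sum_range (fun j => lineCell m j z), tele, cellStep_one, cellStep_zero]
  · simp
  · push_cast; nlinarith
  · nlinarith

variable {n : ℕ}

/-- The product functions of a partition of unity of the unit cube. -/
noncomputable def cubeCell (m : ℕ) (J : Fin n → Fin (m + 1)) (z : EuclideanSpace ℝ (Fin n)) : ℝ :=
  ∏ i, lineCell m (J i) (z i)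

/-- A smooth function that is positive exactly in the open unit cube. -/
noncomputable def cubeBump (z : EuclideanSpace ℝ (Fin n)) : ℝ := ∏ i, intervalBump 0 1 (z i)

lemma contDiff_cubeCell (m : ℕ) (J : Fin n → Fin (m + 1)) (k : ℕ∞) :
    ContDiff ℝ k (cubeCell m J) :=
  contDiff_prod fun i _ => (contDiff_lineCell m (J i) k).comp (contDiff_coord i)

lemma contDiff_cubeBump (k : ℕ∞) : ContDiff ℝ k (cubeBump (n := n)) :=
  contDiff_prod fun i _ => (contDiff_intervalBump 0 1 k).comp (contDiff_coord i)

lemma cubeCell_nonneg (m : ℕ) (J : Fin n → Fin (m + 1)) (z : EuclideanSpace ℝ (Fin n)) :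
    0 ≤ cubeCell m J z := Finset.prod_nonneg fun _ _ => lineCell_nonneg _ _ _

lemma cubeCell_le_one (m : ℕ) (J : Fin n → Fin (m + 1)) (z : EuclideanSpace ℝ (Fin n)) :
    cubeCell m J z ≤ 1 :=
  Finset.prod_le_one (fun _ _ => lineCell_nonneg _ _ _) fun _ _ => lineCell_le_one _ _ _

lemma cubeBump_nonneg (z : EuclideanSpace ℝ (Fin n)) : 0 ≤ cubeBump z :=
  Finset.prod_nonneg fun _ _ => intervalBump_nonneg _ _ _

lemma cubeBump_le_one (z : EuclideanSpace ℝ (Fin n)) : cubeBump z ≤ 1 := by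
  have h : ∀ u, expNegInvGlue u ≤ 1 := by
    intro u
    unfold expNegInvGlue
    split_ifs with hu
    · exact zero_le_one
    · exact Real.exp_le_one_iff.2 (by
        have : 0 < u := not_le.1 hu
        have := inv_pos.2 this
        linarith)
  exact Finset.prod_le_one (fun _ _ => intervalBump_nonneg _ _ _) fun _ _ =>
    mul_le_one₀ (h _) (expNegInvGlue.nonneg _) (h _)

lemma cubeBump_pos {z : EuclideanSpace ℝ (Fin n)} (hz : z ∈ openUnitCube n) : 0 < cubeBump z :=
  Finset.prod_pos fun i _ => intervalBump_pos (hz i).1 (hz i).2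

lemma cubeBump_eq_zero {z : EuclideanSpace ℝ (Fin n)} (hz : z ∉ openUnitCube n) :
    cubeBump z = 0 := by
  simp only [openUnitCube, mem_ofPred_eq, not_forall] at hz
  obtain ⟨i, hi⟩ := hz
  exact Finset.prod_eq_zero (Finset.mem_univ i) (intervalBump_eq_zero hi)

lemma sum_cubeCell {m : ℕ} {z : EuclideanSpace ℝ (Fin n)} (hz : z ∈ unitCube n) :
    ∑ J : Fin n → Fin (m + 1), cubeCell m J z = 1 := by
  have h := Finset.prod_univ_sum (fun _ : Fin n => (Finset.univ : Finset (Fin (m + 1))))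
    (fun i j => lineCell m j (z i))
  rw [Fintype.piFinset_univ] at h
  unfold cubeCell
  rw [← h]
  exact Finset.prod_eq_one fun i _ => sum_lineCell (hz i).1 (hz i).2

lemma exists_cubeCell_pos {m : ℕ} (hm : 0 < m) (J : Fin n → Fin (m + 1)) :
    ∃ z ∈ openUnitCube n, 0 < cubeCell m J z := by
  have hm' : (0 : ℝ) < m := Nat.cast_pos.2 hm
  have hm1 : (1 : ℝ) ≤ m := Nat.one_le_cast.2 hm
  -- the point at relative position `J i / m`, moved inwards by at most `1 / (4 m)`
  refine ⟨WithLp.toLp 2 fun i => ((J i : ℝ) + 1 / 4 * (1 - 2 * ((J i : ℝ) / m))) / m,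
    fun i => ?_, Finset.prod_pos fun i _ => ?_⟩
  all_goals
    have h0 : (0 : ℝ) ≤ ((J i : ℕ) : ℝ) := Nat.cast_nonneg _
    have h1 : ((J i : ℕ) : ℝ) ≤ m := by exact_mod_cast Nat.lt_succ_iff.1 (J i).2
    set q : ℝ := ((J i : ℕ) : ℝ) / m with hq
    have hq0 : 0 ≤ q := div_nonneg h0 hm'.le
    have hq1 : q ≤ 1 := (div_le_one hm').2 h1
    have hqm : ((J i : ℕ) : ℝ) = q * m := by rw [hq]; field_simp
  · simp only
    rw [lt_div_iff₀ hm', div_lt_iff₀ hm', hqm, mul_div_cancel_right₀ _ hm'.ne']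
    constructor <;> nlinarith
  · rw [lineCell_eq_one]
    · exact one_pos
    · simp only
      rw [mul_div_cancel₀ _ hm'.ne', add_sub_cancel_left, abs_le]
      constructor <;> linarith

lemma isPreconnected_openUnitCube : IsPreconnected (openUnitCube n) := by
  refine Convex.isPreconnected fun x hx y hy a b ha hb hab i => ?_
  have h1 := hx i
  have h2 := hy i
  simp only [PiLp.add_apply, PiLp.smul_apply, smul_eq_mul]
  constructor
  · rcases eq_or_lt_of_le ha with rfl | ha
    · have : b = 1 := by linarith
      subst this; linarith
    · nlinarith
  · rcases eq_or_lt_of_le ha with rfl | ha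
    · have : b = 1 := by linarith
      subst this; linarith
    · nlinarith

lemma openUnitCube_subset : openUnitCube n ⊆ unitCube n := fun _ hx i =>
  ⟨(hx i).1.le, (hx i).2.le⟩

lemma isOpen_openUnitCube : IsOpen (openUnitCube n) := by
  have : openUnitCube n = ⋂ i, {x | 0 < x i ∧ x i < 1} := by
    ext x; simp [openUnitCube]
  rw [this]
  exact isOpen_iInter_of_finite fun i =>
    (isOpen_lt continuous_const (contDiff_coord (k := 0) i).continuous).inter
      (isOpen_lt (contDiff_coord (k := 0) i).continuous continuous_const)

lemma exists_lipschitz_cubeCell {m : ℕ} (hm : 0 < m) :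
    ∃ L : NNReal, ∀ J : Fin n → Fin (m + 1), LipschitzWith L (cubeCell m J) := by
  have hm' : (0 : ℝ) < m := Nat.cast_pos.2 hm
  have : ∀ J : Fin n → Fin (m + 1), ∃ L : NNReal, LipschitzWith L (cubeCell m J) := by
    intro J
    have hsupp : HasCompactSupport (cubeCell m J) := by
      refine HasCompactSupport.intro (isCompact_coordBox (fun i => ((J i : ℝ) - 1) / m)
        fun i => ((J i : ℝ) + 1) / m) fun z hz => ?_
      simp only [coordBox, mem_ofPred_eq, not_forall] at hz
      obtain ⟨i, hi⟩ := hz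
      refine Finset.prod_eq_zero (Finset.mem_univ i) (lineCell_eq_zero ?_)
      by_contra hlt
      rw [not_le, abs_lt] at hlt
      refine hi ⟨?_, ?_⟩
      · rw [div_le_iff₀ hm']; linarith
      · rw [le_div_iff₀ hm']; linarith
    exact ContDiff.lipschitzWith_of_hasCompactSupport hsupp (contDiff_cubeCell m J 1) (by simp)
  choose L hL using this
  exact ⟨Finset.univ.sup L, fun J => (hL J).weaken (Finset.le_sup (Finset.mem_univ J))⟩

/-- The mass that adjacent cells have in common. -/
noncomputable def cellWeight (m : ℕ) (J K : Fin n → Fin (m + 1)) : ℝ :=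
  ∫ z, cubeBump z * (cubeCell m J z * cubeCell m K z)

lemma integrable_cubeBump_mul {v : EuclideanSpace ℝ (Fin n) → ℝ} (hv : Continuous v) :
    Integrable fun z => cubeBump z * v z := by
  refine ((contDiff_cubeBump 0).continuous.mul hv).integrable_of_hasCompactSupport ?_
  refine HasCompactSupport.intro (isCompact_coordBox (fun _ => 0) fun _ => 1) fun z hz => ?_
  rw [Pi.mul_apply, cubeBump_eq_zero fun h => hz (openUnitCube_subset h), zero_mul]

lemma cellWeight_comm (m : ℕ) (J K : Fin n → Fin (m + 1)) :
    cellWeight m J K = cellWeight m K J := by simp only [cellWeight, mul_comm (cubeCell m J _)]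

lemma sum_antisymm_eq_zero {ι : Type*} (s : Finset ι) {w : ι → ι → ℝ} (hw : ∀ j k, w j k = w k j)
    (v : ι → ℝ) : ∑ j ∈ s, ∑ k ∈ s, w j k * (v j - v k) = 0 := by
  have h : ∑ j ∈ s, ∑ k ∈ s, w j k * (v j - v k) = -∑ j ∈ s, ∑ k ∈ s, w j k * (v j - v k) := by
    conv_lhs => rw [Finset.sum_comm]
    simp only [← Finset.sum_neg_distrib]
    refine Finset.sum_congr rfl fun j _ => Finset.sum_congr rfl fun k _ => ?_
    rw [hw k j]; ring
  linarith

/-- The kernel of the weighted graph Laplacian of the cells consists of the constants.  For a kernel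
element `v` the function `∑ v J * cubeCell m J` takes finitely many values on the open cube, which is
connected. -/
lemma eq_of_cellLaplacian_eq_zero {m : ℕ} (hm : 0 < m) {v : (Fin n → Fin (m + 1)) → ℝ}
    (hv : ∀ J, ∑ K, cellWeight m J K * (v J - v K) = 0) (J K : Fin n → Fin (m + 1)) :
    v J = v K := by
  have hcont : ∀ J : Fin n → Fin (m + 1), Continuous (cubeCell m J) := fun J =>
    (contDiff_cubeCell m J 0).continuous
  set q : EuclideanSpace ℝ (Fin n) → ℝ := fun z =>
    ∑ J, ∑ K, cubeCell m J z * cubeCell m K z * (v J - v K) ^ 2 with hq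
  have hqc : Continuous q := continuous_finsetSum _ fun J _ => continuous_finsetSum _ fun K _ =>
    ((hcont J).mul (hcont K)).mul continuous_const
  have hterm : ∀ J K z, 0 ≤ cubeCell m J z * cubeCell m K z * (v J - v K) ^ 2 := fun J K z =>
    mul_nonneg (mul_nonneg (cubeCell_nonneg _ _ _) (cubeCell_nonneg _ _ _)) (sq_nonneg _)
  have hq0 : ∀ z, 0 ≤ q z := fun z => Finset.sum_nonneg fun J _ => Finset.sum_nonneg fun K _ =>
    hterm J K z
  -- the Dirichlet form of `v` vanishes
  have hform : ∫ z, cubeBump z * q z = 0 := by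
    have e1 : ∀ z, cubeBump z * q z =
        ∑ J, ∑ K, (v J - v K) ^ 2 * (cubeBump z * (cubeCell m J z * cubeCell m K z)) := by
      intro z
      simp only [hq, Finset.mul_sum]
      refine Finset.sum_congr rfl fun J _ => Finset.sum_congr rfl fun K _ => by ring
    simp only [e1]
    have hi : ∀ J K : Fin n → Fin (m + 1), Integrable fun z =>
        (v J - v K) ^ 2 * (cubeBump z * (cubeCell m J z * cubeCell m K z)) := fun J K =>
      (integrable_cubeBump_mul ((hcont J).mul (hcont K))).const_mul _
    rw [integral_finsetSum _ fun J _ => integrable_finsetSum _ fun K _ => hi J K]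
    have e2 : ∀ J, ∫ z, ∑ K, (v J - v K) ^ 2 *
        (cubeBump z * (cubeCell m J z * cubeCell m K z)) =
        ∑ K, (v J - v K) ^ 2 * cellWeight m J K := by
      intro J
      rw [integral_finsetSum _ fun K _ => hi J K]
      exact Finset.sum_congr rfl fun K _ => integral_const_mul _ _
    simp only [e2]
    have e3 : ∑ J, ∑ K, (v J - v K) ^ 2 * cellWeight m J K =
        2 * ∑ J, v J * ∑ K, cellWeight m J K * (v J - v K) := by
      have e4 : ∑ J, ∑ K, (v J - v K) ^ 2 * cellWeight m J K -
          2 * ∑ J, v J * ∑ K, cellWeight m J K * (v J - v K) =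
          ∑ J, ∑ K, (-cellWeight m J K * (v J + v K)) * (v J - v K) := by
        simp only [Finset.mul_sum, ← Finset.sum_sub_distrib]
        exact Finset.sum_congr rfl fun J _ => Finset.sum_congr rfl fun K _ => by ring
      have e5 := sum_antisymm_eq_zero Finset.univ
        (w := fun J K => -cellWeight m J K * (v J + v K))
        (fun J K => by rw [cellWeight_comm, add_comm]) v
      linarith
    rw [e3]
    simp [hv]
  have hzero : ∀ z ∈ openUnitCube n, q z = 0 := by
    intro z hz
    by_contra hne
    have hpos : 0 < ∫ z, cubeBump z * q z := by
      refine ((contDiff_cubeBump 0).continuous.mul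
        hqc).integral_pos_of_hasCompactSupport_nonneg_nonzero ?_ (fun z =>
        mul_nonneg (cubeBump_nonneg z) (hq0 z)) (mul_ne_zero (cubeBump_pos hz).ne' hne)
      refine HasCompactSupport.intro (isCompact_coordBox (fun _ => 0) fun _ => 1) fun z hz => ?_
      rw [Pi.mul_apply, cubeBump_eq_zero fun h => hz (openUnitCube_subset h), zero_mul]
    exact hpos.ne' hform
  have hpair : ∀ z ∈ openUnitCube n, ∀ J K, cubeCell m J z * cubeCell m K z * (v J - v K) = 0 := by
    intro z hz J K
    have h1 := (Finset.sum_eq_zero_iff_of_nonneg (fun J _ => Finset.sum_nonneg fun K _ =>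
      hterm J K z)).1 (hzero z hz) J (Finset.mem_univ J)
    have h2 := (Finset.sum_eq_zero_iff_of_nonneg fun K _ => hterm J K z).1 h1 K (Finset.mem_univ K)
    rcases mul_eq_zero.1 h2 with h3 | h3
    · rw [h3, zero_mul]
    · rw [pow_eq_zero_iff two_ne_zero] at h3
      rw [h3, mul_zero]
  set V : EuclideanSpace ℝ (Fin n) → ℝ := fun z => ∑ K, cubeCell m K z * v K with hV
  have hVc : Continuous V := continuous_finsetSum _ fun K _ => (hcont K).mul continuous_const
  have hVeq : ∀ z ∈ openUnitCube n, ∀ J, 0 < cubeCell m J z → V z = v J := by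
    intro z hz J hJ
    have h1 : ∑ K, cubeCell m K z * (v J - v K) = 0 := by
      refine Finset.sum_eq_zero fun K _ => ?_
      have := hpair z hz J K
      rw [mul_assoc] at this
      exact (mul_eq_zero.1 this).resolve_left hJ.ne'
    simp only [mul_sub, Finset.sum_sub_distrib, ← Finset.sum_mul,
      sum_cubeCell (openUnitCube_subset hz), one_mul] at h1
    exact (sub_eq_zero.1 h1).symm
  have himage : (V '' openUnitCube n).Subsingleton := by
    have hfin : (V '' openUnitCube n).Finite := by
      refine (finite_range v).subset ?_
      rintro _ ⟨z, hz, rfl⟩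
      have h1 := sum_cubeCell (m := m) (openUnitCube_subset hz)
      obtain ⟨J, -, hJ⟩ : ∃ J ∈ Finset.univ, 0 < cubeCell m J z :=
        Finset.exists_lt_of_sum_lt (by rw [h1]; simp)
      exact ⟨J, (hVeq z hz J hJ).symm⟩
    have hconn := isPreconnected_openUnitCube.image V hVc.continuousOn
    by_contra hns
    exact hfin.not_infinite (hconn.infinite_of_nontrivial (not_subsingleton_iff.1 hns))
  obtain ⟨x, hx, hxJ⟩ := exists_cubeCell_pos hm J
  obtain ⟨y, hy, hyK⟩ := exists_cubeCell_pos hm K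
  rw [← hVeq x hx J hxJ, ← hVeq y hy K hyK]
  exact himage (mem_image_of_mem V hx) (mem_image_of_mem V hy)

/-- A weighted graph Laplacian whose kernel consists of the constants has a linear right inverse on the
vectors of sum zero, here written as a matrix. -/
lemma exists_laplacian_inverse {ι : Type*} [Fintype ι] [DecidableEq ι] [Nonempty ι] {w : ι → ι → ℝ}
    (hw : ∀ j k, w j k = w k j)
    (hker : ∀ v : ι → ℝ, (∀ j, ∑ k, w j k * (v j - v k) = 0) → ∀ j k, v j = v k) :
    ∃ G : ι → ι → ℝ, ∀ c : ι → ℝ, ∑ j, c j = 0 →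
      ∀ j, ∑ k, w j k * ((∑ l, G j l * c l) - ∑ l, G k l * c l) = c j := by
  -- adding a constant matrix makes the Laplacian invertible
  set A : Matrix ι ι ℝ := fun j k => (if j = k then ∑ l, w j l else 0) - w j k + 1 with hA
  have hmul : ∀ v j, (A.mulVec v) j = ∑ k, w j k * (v j - v k) + ∑ k, v k := by
    intro v j
    have hdiag : ∑ k, (if j = k then ∑ l, w j l else 0) * v k = ∑ l, w j l * v j := by
      rw [Finset.sum_eq_single j (fun k _ hk => by rw [if_neg (Ne.symm hk), zero_mul])
        (fun h => absurd (Finset.mem_univ j) h), if_pos rfl, Finset.sum_mul]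
    simp only [Matrix.mulVec, dotProduct, hA, add_mul, sub_mul, one_mul, Finset.sum_add_distrib,
      Finset.sum_sub_distrib, mul_sub, hdiag]
  have hsum : ∀ v, ∑ j, (A.mulVec v) j = Fintype.card ι * ∑ k, v k := by
    intro v
    simp only [hmul, Finset.sum_add_distrib]
    rw [sum_antisymm_eq_zero Finset.univ hw v]
    simp
  have hcard : (Fintype.card ι : ℝ) ≠ 0 := by exact_mod_cast Fintype.card_ne_zero
  have hsum0 : ∀ v, ∑ j, (A.mulVec v) j = 0 → ∑ k, v k = 0 := by
    intro v hv
    rw [hsum] at hv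
    exact (mul_eq_zero.1 hv).resolve_left hcard
  have hinj : Function.Injective A.mulVec := by
    rw [← Matrix.coe_mulVecLin, ← LinearMap.ker_eq_bot, LinearMap.ker_eq_bot']
    intro v hv
    rw [Matrix.mulVecLin_apply] at hv
    have h1 : ∑ k, v k = 0 := hsum0 v (by rw [hv]; simp)
    have h2 : ∀ j k, v j = v k := hker v fun j => by
      have := hmul v j
      rw [hv, h1] at this
      simpa using this.symm
    ext j
    have h3 : ∑ k, v k = Fintype.card ι * v j := by
      rw [Finset.sum_congr rfl fun k _ => h2 k j]
      simp
    rw [h1] at h3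
    exact (mul_eq_zero.1 h3.symm).resolve_left hcard
  have hunit : IsUnit A := Matrix.mulVec_injective_iff_isUnit.1 hinj
  refine ⟨fun j l => A⁻¹ j l, fun c hc j => ?_⟩
  have h1 : A.mulVec (A⁻¹.mulVec c) = c := by
    rw [Matrix.mulVec_mulVec, Matrix.mul_nonsing_inv _ ((Matrix.isUnit_iff_isUnit_det A).1 hunit),
      Matrix.one_mulVec]
  have h2 : ∑ k, (A⁻¹.mulVec c) k = 0 := hsum0 _ (by rw [h1, hc])
  have h3 := hmul (A⁻¹.mulVec c) j
  rw [h1, h2, add_zero] at h3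
  exact h3.symm

end Cells

/-! ### Transport with small displacement -/

section SmallDisplacement

/-- The partial sums of the decomposition of `f - g` into cells keep the density positive: the
correction is controlled by the cells that are left out. -/
lemma pos_add_sum_cells {ι : Type*} [Fintype ι] [DecidableEq ι] (s : Finset ι) {X b : ι → ℝ}
    {f g θ B : ℝ} (hX : ∀ j, 0 ≤ X j) (hX1 : ∑ j, X j = 1) (hb : ∀ j, |b j| ≤ B) (hf : 0 < f)
    (hB : 2 * B < g) (hB0 : 0 ≤ B) (hθ0 : 0 ≤ θ) (hθ1 : θ ≤ 1) :
    0 < g + ∑ j ∈ s, X j * (f - g + θ * ∑ k, X k * (b k - b j)) := by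
  set x := ∑ j ∈ s, X j with hx
  set y := ∑ j ∈ sᶜ, X j with hy
  set U := ∑ j ∈ s, X j * b j with hU
  set W := ∑ j ∈ sᶜ, X j * b j with hW
  have hxy : x + y = 1 := by rw [← hX1, hx, hy, Finset.sum_add_sum_compl]
  have hUW : ∑ k, X k * b k = U + W := by rw [hU, hW, Finset.sum_add_sum_compl]
  have hx0 : 0 ≤ x := Finset.sum_nonneg fun j _ => hX j
  have hy0 : 0 ≤ y := Finset.sum_nonneg fun j _ => hX j
  have hbound : ∀ r : Finset ι, |∑ j ∈ r, X j * b j| ≤ B * ∑ j ∈ r, X j := by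
    intro r
    refine (Finset.abs_sum_le_sum_abs _ _).trans ?_
    rw [Finset.mul_sum]
    refine Finset.sum_le_sum fun j _ => ?_
    rw [abs_mul, abs_of_nonneg (hX j), mul_comm]
    exact mul_le_mul_of_nonneg_right (hb j) (hX j)
  have hU' := abs_le.1 (hbound s)
  have hW' := abs_le.1 (hbound sᶜ)
  rw [← hU, ← hx] at hU'
  rw [← hW, ← hy] at hW'
  have hinner : ∀ j, ∑ k, X k * (b k - b j) = U + W - b j := by
    intro j
    simp only [mul_sub, Finset.sum_sub_distrib, ← Finset.sum_mul, hX1, one_mul, hUW]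
  have hsum : ∑ j ∈ s, X j * (f - g + θ * ∑ k, X k * (b k - b j)) =
      x * (f - g) + θ * (x * (U + W) - U) := by
    simp only [hinner, mul_add, Finset.sum_add_distrib, ← Finset.sum_mul]
    congr 1
    have : ∀ j, X j * (θ * (U + W - b j)) = θ * (X j * (U + W) - X j * b j) := fun j => by ring
    simp only [this]
    rw [← Finset.mul_sum, Finset.sum_sub_distrib, ← Finset.sum_mul, ← hx, ← hU, mul_add]
  rw [hsum]
  have hcorr : -(2 * B * y) ≤ x * (U + W) - U := by
    have hx1 : x ≤ 1 := by linarith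
    have e : x * (U + W) - U = x * W - y * U := by
      have : x = 1 - y := by linarith
      rw [this]; ring
    rw [e]
    have h1 : x * W ≥ -(B * y) := by
      have := mul_le_mul_of_nonneg_left hW'.1 hx0
      have h2 : x * (B * y) ≤ 1 * (B * y) := mul_le_mul_of_nonneg_right hx1 (by positivity)
      linarith
    have h2 : y * U ≤ B * y := by
      have := mul_le_mul_of_nonneg_left hU'.2 hy0
      have h3 : y * (B * x) ≤ y * (B * 1) :=
        mul_le_mul_of_nonneg_left (mul_le_mul_of_nonneg_left hx1 hB0) hy0
      linarith
    linarith
  have hcorr' : -(2 * B * y) ≤ θ * (x * (U + W) - U) := by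
    have h1 := mul_le_mul_of_nonneg_left hcorr hθ0
    have h2 : θ * (2 * B * y) ≤ 1 * (2 * B * y) := mul_le_mul_of_nonneg_right hθ1 (by positivity)
    linarith
  have hg : g + x * (f - g) = y * g + x * f := by
    have : y = 1 - x := by linarith
    rw [this]; ring
  have hmain : 0 < y * (g - 2 * B) + x * f := by
    rcases eq_or_lt_of_le hx0 with h0 | h0
    · have : y = 1 := by linarith
      rw [this, ← h0]; linarith
    · have h1 : 0 ≤ y * (g - 2 * B) := mul_nonneg hy0 (by linarith)
      have h2 : 0 < x * f := mul_pos h0 hf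
      linarith
  nlinarith

variable {n : ℕ}

/-- The affine map that takes the cube with lowest corner `a` and side `s` to the unit cube. -/
noncomputable def cubeChart (a : EuclideanSpace ℝ (Fin n)) (s : ℝ)
    (x : EuclideanSpace ℝ (Fin n)) : EuclideanSpace ℝ (Fin n) := s⁻¹ • (x - a)

lemma cubeChart_apply (a : EuclideanSpace ℝ (Fin n)) (s : ℝ) (x : EuclideanSpace ℝ (Fin n))
    (i : Fin n) : cubeChart a s x i = s⁻¹ * (x i - a i) := rfl

lemma contDiff_cubeChart (a : EuclideanSpace ℝ (Fin n)) (s : ℝ) (k : ℕ∞) :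
    ContDiff ℝ k (cubeChart a s) := by
  unfold cubeChart; fun_prop

lemma cubeChart_mem_unitCube {a : EuclideanSpace ℝ (Fin n)} {s : ℝ} (hs : 0 < s)
    {x : EuclideanSpace ℝ (Fin n)} : cubeChart a s x ∈ unitCube n ↔ x ∈ closedCube a s := by
  refine forall_congr' fun i => ?_
  rw [cubeChart_apply, inv_mul_le_iff₀ hs, mul_one, mul_nonneg_iff_of_pos_left (inv_pos.2 hs)]
  constructor <;> rintro ⟨h1, h2⟩ <;> constructor <;> linarith

lemma integral_comp_cubeChart (a : EuclideanSpace ℝ (Fin n)) {s : ℝ} (hs : 0 < s)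
    (v : EuclideanSpace ℝ (Fin n) → ℝ) : ∫ x, v (cubeChart a s x) = s ^ n * ∫ z, v z := by
  unfold cubeChart
  rw [integral_sub_right_eq_self (fun x => v (s⁻¹ • x)) a,
    Measure.integral_comp_inv_smul_of_nonneg volume v hs.le, finrank_euclideanSpace_fin, smul_eq_mul]

/-- On cubes whose side is bounded below, weak closeness of the densities makes the displacement
small.  With a partition of unity `X J`, a bump function `θ` and a potential `b`, the difference `f - g`
is the sum of the pieces `q J = X J * (f - g + θ * ∑ K, X K * (b K - b J))`.  The integrals of all the
pieces vanish if `b` solves a Poisson equation for the graph Laplacian of the cells; its right hand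
side consists of integrals of `f - g` against Lipschitz functions, so `b` is small.  The pieces are
removed one after the other, each by a map supported in the box of its cell. -/
lemma exists_transports_small_of_le_side (n : ℕ) {ρ ε μ : ℝ} (hρ : 0 < ρ) (hε : 0 < ε)
    (hμ : 0 < μ) : ∃ δ > 0, ∀ {Φ : (ℝ → ℝ) → ℕ∞ → Prop}, IsRegularitySystem Φ →
      ∀ (a : EuclideanSpace ℝ (Fin n)) (s : ℝ), ε ≤ s → s ≤ 1 →
      ∀ {f g : ℝ → EuclideanSpace ℝ (Fin n) → ℝ}, RegularFamily Φ f → RegularFamily Φ g →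
      (∀ t ∈ Icc (0 : ℝ) 1, ∀ x, 0 < f t x) → (∀ t ∈ Icc (0 : ℝ) 1, ∀ x, 0 < g t x) →
      (∀ t ∈ Icc (0 : ℝ) 1, ∀ x ∈ closedCube a s, μ ≤ g t x) →
      (∀ t ∈ Icc (0 : ℝ) 1, ∀ x ∉ closedCube a s, f t x = g t x) →
      (∀ t ∈ Icc (0 : ℝ) 1, ∫ x, (f t x - g t x) = 0) →
      (∀ t ∈ Icc (0 : ℝ) 1, ∀ φ : EuclideanSpace ℝ (Fin n) → ℝ, LipschitzWith 1 φ →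
        (∀ x, φ x ∈ Icc (0 : ℝ) 1) → |∫ x, φ x * (f t x - g t x)| ≤ δ) →
      ∃ ψ, Transports Φ f g ψ ∧ (∀ t ∈ Icc (0 : ℝ) 1, ∀ x ∉ closedCube a s, ψ t x = x) ∧
        ∀ t ∈ Icc (0 : ℝ) 1, ∀ x, dist (ψ t x) x ≤ ρ := by
  -- the number of cells per side
  obtain ⟨m, hm⟩ := exists_nat_gt ((2 : ℝ) ^ n * √n * (3 / 2) / ρ)
  have hm' : (0 : ℝ) < m := lt_of_le_of_lt (by positivity) hm
  have hm0 : 0 < m := Nat.cast_pos.1 hm'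
  obtain ⟨L, hL⟩ := exists_lipschitz_cubeCell (n := n) hm0
  obtain ⟨G, hG⟩ := exists_laplacian_inverse (cellWeight_comm (n := n) m) fun v hv =>
    eq_of_cellLaplacian_eq_zero hm0 hv
  set Γ : ℝ := ∑ J, ∑ K, |G J K| with hΓ
  have hΓ0 : 0 ≤ Γ := Finset.sum_nonneg fun _ _ => Finset.sum_nonneg fun _ _ => abs_nonneg _
  -- a Lipschitz constant of the cells after rescaling to a cube of side at least `ε`
  set Λ : ℝ := 1 + L / ε with hΛ
  have hL0 : (0 : ℝ) ≤ L := L.2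
  have hΛ1 : 1 ≤ Λ := by
    rw [hΛ]
    have : 0 ≤ (L : ℝ) / ε := by positivity
    linarith
  have hΛ0 : 0 < Λ := by linarith
  refine ⟨μ * ε ^ n / (4 * (Γ + 1) * Λ), by positivity, ?_⟩
  intro Φ hΦ a s hεs hs1 f g hf hg hf0 hg0 hgμ hoff hint hweak
  have hs : 0 < s := hε.trans_le hεs
  set δ := μ * ε ^ n / (4 * (Γ + 1) * Λ) with hδ
  set X : (Fin n → Fin (m + 1)) → EuclideanSpace ℝ (Fin n) → ℝ := fun J x =>
    cubeCell m J (cubeChart a s x) with hX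
  set θ : EuclideanSpace ℝ (Fin n) → ℝ := fun x => cubeBump (cubeChart a s x) with hθ
  have hXsm : ∀ J (k : ℕ∞), ContDiff ℝ k (X J) := fun J k =>
    (contDiff_cubeCell m J k).comp (contDiff_cubeChart a s k)
  have hθsm : ∀ k : ℕ∞, ContDiff ℝ k θ := fun k =>
    (contDiff_cubeBump k).comp (contDiff_cubeChart a s k)
  have hXc : ∀ J, Continuous (X J) := fun J => (hXsm J 0).continuous
  have hh : RegularFamily Φ fun t x => f t x - g t x := hf.sub hg
  have hhoff : ∀ t ∈ Icc (0 : ℝ) 1, ∀ x ∉ closedCube a s, f t x - g t x = 0 := fun t ht x hx =>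
    sub_eq_zero.2 (hoff t ht x hx)
  have hR : IsCompact (closedCube a s) := isCompact_coordBox (fun i => a i) fun i => a i + s
  have hθoff : ∀ x ∉ closedCube a s, θ x = 0 := fun x hx => cubeBump_eq_zero fun h =>
    hx ((cubeChart_mem_unitCube hs).1 (openUnitCube_subset h))
  have hXsum : ∀ x ∈ closedCube a s, ∑ J, X J x = 1 := fun x hx =>
    sum_cubeCell ((cubeChart_mem_unitCube hs).2 hx)
  -- the masses that the cells lack, and the potential that balances them
  set c : (Fin n → Fin (m + 1)) → ℝ → ℝ := fun J t =>
    ∫ y in closedCube a s, X J y * (f t y - g t y) with hc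
  set b : (Fin n → Fin (m + 1)) → ℝ → ℝ := fun J t => ∑ K, G J K * (c K t / s ^ n) with hb
  set q : (Fin n → Fin (m + 1)) → ℝ → EuclideanSpace ℝ (Fin n) → ℝ := fun J t x =>
    X J x * (f t x - g t x + θ x * ∑ K, X K x * (b K t - b J t)) with hq
  have hceq : ∀ J, ∀ t ∈ Icc (0 : ℝ) 1, c J t = ∫ y, X J y * (f t y - g t y) := fun J t ht =>
    setIntegral_eq_integral_of_forall_compl_eq_zero fun x hx => by rw [hhoff t ht x hx, mul_zero]
  have hhint : ∀ t ∈ Icc (0 : ℝ) 1, ∀ v : EuclideanSpace ℝ (Fin n) → ℝ, Continuous v →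
      Integrable fun x => v x * (f t x - g t x) := fun t ht v hv =>
    (hv.mul (hh.continuous hΦ ht)).integrable_of_hasCompactSupport
      (HasCompactSupport.intro hR fun x hx => by
        rw [Pi.mul_apply, hhoff t ht x hx, mul_zero])
  have hcbound : ∀ J, ∀ t ∈ Icc (0 : ℝ) 1, |c J t| ≤ Λ * δ := by
    intro J t ht
    have hlip : LipschitzWith 1 fun x => Λ⁻¹ * X J x := by
      refine LipschitzWith.of_dist_le_mul fun x y => ?_
      have h1 : dist (X J x) (X J y) ≤ L * dist (cubeChart a s x) (cubeChart a s y) :=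
        (hL J).dist_le_mul _ _
      have h2 : dist (cubeChart a s x) (cubeChart a s y) = s⁻¹ * dist x y := by
        rw [cubeChart, cubeChart, dist_smul₀, dist_sub_right, Real.norm_of_nonneg (inv_nonneg.2 hs.le)]
      have h3 : L * s⁻¹ ≤ Λ := by
        have : (L : ℝ) * s⁻¹ ≤ L * ε⁻¹ :=
          mul_le_mul_of_nonneg_left (inv_anti₀ hε hεs) hL0
        rw [hΛ, div_eq_mul_inv]; linarith
      rw [Real.dist_eq, ← mul_sub, abs_mul, abs_of_pos (inv_pos.2 hΛ0), ← Real.dist_eq,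
        NNReal.coe_one, one_mul, inv_mul_le_iff₀ hΛ0]
      rw [h2, ← mul_assoc] at h1
      exact h1.trans (mul_le_mul_of_nonneg_right h3 dist_nonneg)
    have hmem : ∀ x, Λ⁻¹ * X J x ∈ Icc (0 : ℝ) 1 := fun x =>
      ⟨mul_nonneg (inv_nonneg.2 hΛ0.le) (cubeCell_nonneg _ _ _),
        mul_le_one₀ (inv_le_one_of_one_le₀ hΛ1) (cubeCell_nonneg _ _ _) (cubeCell_le_one _ _ _)⟩
    have h4 := hweak t ht _ hlip hmem
    simp only [mul_assoc] at h4
    rw [integral_const_mul, ← hceq J t ht, abs_mul, abs_of_pos (inv_pos.2 hΛ0),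
      inv_mul_le_iff₀ hΛ0] at h4
    exact h4
  set B := Γ * (Λ * δ / ε ^ n) with hB
  have hδ0 : 0 < δ := by positivity
  have hB0 : 0 ≤ B := by positivity
  have hBμ : 2 * B < μ := by
    have : B = μ * (Γ / (4 * (Γ + 1))) := by
      rw [hB, hδ]; field_simp
    rw [this]
    have h2 : Γ / (4 * (Γ + 1)) < 1 / 2 := by rw [div_lt_div_iff₀ (by positivity) two_pos]; linarith
    nlinarith
  have hbbound : ∀ J, ∀ t ∈ Icc (0 : ℝ) 1, |b J t| ≤ B := by
    intro J t ht
    calc |b J t| ≤ ∑ K, |G J K * (c K t / s ^ n)| := Finset.abs_sum_le_sum_abs _ _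
      _ ≤ ∑ K, |G J K| * (Λ * δ / ε ^ n) := by
          refine Finset.sum_le_sum fun K _ => ?_
          rw [abs_mul, abs_div, abs_of_pos (pow_pos hs n)]
          refine mul_le_mul_of_nonneg_left ?_ (abs_nonneg _)
          exact div_le_div₀ (by positivity) (hcbound K t ht) (by positivity)
            (pow_le_pow_left₀ hε.le hεs n)
      _ = (∑ K, |G J K|) * (Λ * δ / ε ^ n) := by rw [Finset.sum_mul]
      _ ≤ B := by
          refine mul_le_mul_of_nonneg_right ?_ (by positivity)
          exact Finset.single_le_sum (f := fun J => ∑ K, |G J K|)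
            (fun _ _ => Finset.sum_nonneg fun _ _ => abs_nonneg _) (Finset.mem_univ J)
  -- every piece has zero integral, by the choice of the potential
  have hqint : ∀ J, ∀ t ∈ Icc (0 : ℝ) 1, ∫ x, q J t x = 0 := by
    intro J t ht
    have hci : ∀ K, Integrable fun x => θ x * (X J x * X K x) := by
      intro K
      refine ((hθsm 0).continuous.mul ((hXc J).mul (hXc K))).integrable_of_hasCompactSupport
        (HasCompactSupport.intro hR fun x hx => ?_)
      rw [Pi.mul_apply, hθoff x hx, zero_mul]
    have e1 : ∀ x, q J t x = X J x * (f t x - g t x) +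
        ∑ K, (b K t - b J t) * (θ x * (X J x * X K x)) := by
      intro x
      simp only [hq, mul_add, Finset.mul_sum]
      congr 1
      exact Finset.sum_congr rfl fun K _ => by ring
    have hw : ∀ K, ∫ x, θ x * (X J x * X K x) = s ^ n * cellWeight m J K := fun K =>
      integral_comp_cubeChart a hs fun z => cubeBump z * (cubeCell m J z * cubeCell m K z)
    simp only [e1]
    rw [integral_add (hhint t ht _ (hXc J)) (integrable_finsetSum _ fun K _ =>
      (hci K).const_mul _), ← hceq J t ht, integral_finsetSum _ fun K _ => (hci K).const_mul _]
    simp only [integral_const_mul, hw]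
    have hcsum : ∑ K, c K t / s ^ n = 0 := by
      rw [← Finset.sum_div]
      have : ∑ K, c K t = 0 := by
        calc ∑ K, c K t = ∫ y, ∑ K, X K y * (f t y - g t y) := by
              rw [integral_finsetSum _ fun K _ => hhint t ht _ (hXc K)]
              exact Finset.sum_congr rfl fun K _ => hceq K t ht
          _ = ∫ y, (f t y - g t y) := by
              refine integral_congr_ae (Eventually.of_forall fun y => ?_)
              simp only [← Finset.sum_mul]
              by_cases hy : y ∈ closedCube a s
              · rw [hXsum y hy, one_mul]
              · rw [hhoff t ht y hy, mul_zero]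
          _ = 0 := hint t ht
      rw [this, zero_div]
    have h5 := hG (fun K => c K t / s ^ n) hcsum J
    have h6 : ∑ K, cellWeight m J K * (b J t - b K t) = c J t / s ^ n := h5
    have h7 : ∑ K, (b K t - b J t) * (s ^ n * cellWeight m J K) =
        -(s ^ n * ∑ K, cellWeight m J K * (b J t - b K t)) := by
      rw [Finset.mul_sum, ← Finset.sum_neg_distrib]
      exact Finset.sum_congr rfl fun K _ => by ring
    rw [h7, h6, mul_div_cancel₀ _ (pow_pos hs n).ne', add_neg_cancel]
  -- the boxes that carry the cells, cut off at the faces of the cube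
  set lo : (Fin n → Fin (m + 1)) → Fin n → ℝ := fun J i =>
    a i + s * max 0 ((((J i : ℕ) : ℝ) - 3 / 4) / m) with hlo
  set hi : (Fin n → Fin (m + 1)) → Fin n → ℝ := fun J i =>
    a i + s * min 1 ((((J i : ℕ) : ℝ) + 3 / 4) / m) with hhi
  have hboxiff : ∀ J (x : EuclideanSpace ℝ (Fin n)), x ∈ coordBox (lo J) (hi J) ↔
      ∀ i, (0 ≤ cubeChart a s x i ∧ cubeChart a s x i ≤ 1) ∧
        |m * cubeChart a s x i - (J i : ℕ)| ≤ 3 / 4 := by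
    intro J x
    refine forall_congr' fun i => ?_
    have hx : x i = a i + s * cubeChart a s x i := by
      rw [cubeChart_apply, mul_inv_cancel_left₀ hs.ne']; ring
    rw [hx]
    simp only [hlo, hhi, add_le_add_iff_left, mul_le_mul_iff_right₀ hs, max_le_iff, le_min_iff,
      div_le_iff₀ hm', le_div_iff₀ hm', abs_le]
    constructor
    · rintro ⟨⟨h1, h2⟩, h3, h4⟩
      exact ⟨⟨h1, h3⟩, by linarith, by linarith⟩
    · rintro ⟨⟨h1, h2⟩, h3, h4⟩
      exact ⟨⟨h1, by linarith⟩, h2, by linarith⟩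
  have hboxR : ∀ J, coordBox (lo J) (hi J) ⊆ closedCube a s := fun J x hx =>
    (cubeChart_mem_unitCube hs).1 fun i => ((hboxiff J x).1 hx i).1
  have hqoff : ∀ J, ∀ t ∈ Icc (0 : ℝ) 1, ∀ x ∉ coordBox (lo J) (hi J), q J t x = 0 := by
    intro J t ht x hx
    by_cases hxR : x ∈ closedCube a s
    · have h1 := (cubeChart_mem_unitCube hs).2 hxR
      have h2 : ∃ i, ¬ |m * cubeChart a s x i - (J i : ℕ)| ≤ 3 / 4 := by
        by_contra h
        push Not at h
        exact hx ((hboxiff J x).2 fun i => ⟨h1 i, h i⟩)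
      obtain ⟨i, hi⟩ := h2
      have h3 : X J x = 0 := Finset.prod_eq_zero (Finset.mem_univ i)
        (lineCell_eq_zero (not_le.1 hi).le)
      simp only [hq]
      rw [h3, zero_mul]
    · simp only [hq]
      rw [hhoff t ht x hxR, hθoff x hxR, zero_mul, add_zero, mul_zero]
  have hqreg : ∀ J, RegularFamily Φ (q J) := by
    intro J
    have hXreg : ∀ J, RegularFamily Φ fun (_ : ℝ) x => X J x := fun J =>
      RegularFamily.of_contDiff (hXsm J)
    have hcreg : ∀ J, RegularFamily Φ fun t (_ : EuclideanSpace ℝ (Fin n)) => c J t := fun J =>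
      ((hXreg J).mul hh).setIntegral hR
    have hbreg : ∀ J, RegularFamily Φ fun t (_ : EuclideanSpace ℝ (Fin n)) => b J t := by
      intro J
      refine RegularFamily.sum fun K _ => (RegularFamily.const _).mul ?_
      simp only [div_eq_mul_inv]
      exact (hcreg K).mul (RegularFamily.const _)
    exact (hXreg J).mul (hh.add ((RegularFamily.of_contDiff hθsm).mul
      (RegularFamily.sum fun K _ => (hXreg K).mul ((hbreg K).sub (hbreg J)))))
  set d : Finset (Fin n → Fin (m + 1)) → ℝ → EuclideanSpace ℝ (Fin n) → ℝ := fun S t x =>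
    g t x + ∑ J ∈ S, q J t x with hd
  have hdpos : ∀ S, ∀ t ∈ Icc (0 : ℝ) 1, ∀ x, 0 < d S t x := by
    intro S t ht x
    by_cases hx : x ∈ closedCube a s
    · exact pos_add_sum_cells S (fun J => cubeCell_nonneg _ _ _) (hXsum x hx)
        (fun J => hbbound J t ht) (hf0 t ht x) (hBμ.trans_le (hgμ t ht x hx)) hB0
        (cubeBump_nonneg _) (cubeBump_le_one _)
    · simp only [hd]
      rw [Finset.sum_eq_zero fun J _ => hqoff J t ht x fun h => hx (hboxR J h), add_zero]
      exact hg0 t ht x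
  have hdinsert : ∀ S, ∀ J ∉ S, ∀ t x, d (insert J S) t x = d S t x + q J t x := by
    intro S J hJ t x
    simp only [hd]
    rw [Finset.sum_insert hJ]; ring
  -- the colour of a cell is the parity of its index: boxes of one colour are disjoint
  have hcol : ∀ J K : Fin n → Fin (m + 1),
      (fun i => (⟨(J i : ℕ) % 2, Nat.mod_lt _ two_pos⟩ : Fin 2)) =
        (fun i => (⟨(K i : ℕ) % 2, Nat.mod_lt _ two_pos⟩ : Fin 2)) → J ≠ K →
      Disjoint (coordBox (lo J) (hi J)) (coordBox (lo K) (hi K)) := by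
    intro J K hJK hne
    rw [Set.disjoint_left]
    intro x hxJ hxK
    refine hne (funext fun i => Fin.ext ?_)
    have h1 := abs_le.1 ((hboxiff J x).1 hxJ i).2
    have h2 := abs_le.1 ((hboxiff K x).1 hxK i).2
    have h3 : (J i : ℕ) % 2 = (K i : ℕ) % 2 := congrArg Fin.val (congrFun hJK i)
    have h4 : ((J i : ℕ) : ℝ) < ((K i : ℕ) + 2 : ℕ) := by push_cast; linarith
    have h5 : ((K i : ℕ) : ℝ) < ((J i : ℕ) + 2 : ℕ) := by push_cast; linarith
    rw [Nat.cast_lt] at h4 h5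
    omega
  have hlohi : ∀ J i, lo J i < hi J i := by
    intro J i
    have h1 : ((J i : ℕ) : ℝ) ≤ m := by exact_mod_cast Nat.lt_succ_iff.1 (J i).2
    have h0 : (0 : ℝ) ≤ ((J i : ℕ) : ℝ) := Nat.cast_nonneg _
    simp only [hlo, hhi, add_lt_add_iff_left, mul_lt_mul_iff_right₀ hs, max_lt_iff, lt_min_iff]
    refine ⟨⟨one_pos, ?_⟩, by positivity, ?_⟩
    · rw [div_lt_one hm']; linarith
    · exact div_lt_div_of_pos_right (by linarith) hm'
  have hwidth : ∀ J i, hi J i - lo J i ≤ 3 / 2 / m := by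
    intro J i
    have h1 : min 1 (((J i : ℕ) + 3 / 4) / (m : ℝ)) - max 0 (((J i : ℕ) - 3 / 4) / (m : ℝ)) ≤
        3 / 2 / m := by
      have h2 := min_le_right 1 (((J i : ℕ) + 3 / 4) / (m : ℝ))
      have h3 := le_max_right 0 (((J i : ℕ) - 3 / 4) / (m : ℝ))
      have h4 : ((J i : ℕ) + 3 / 4) / (m : ℝ) - ((J i : ℕ) - 3 / 4) / (m : ℝ) = 3 / 2 / m := by
        ring
      linarith
    have h5 : 0 ≤ (3 / 2 / m : ℝ) := by positivity
    simp only [hlo, hhi]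
    calc _ = s * (min 1 (((J i : ℕ) + 3 / 4) / (m : ℝ)) - max 0 (((J i : ℕ) - 3 / 4) / (m : ℝ))) := by
          ring
      _ ≤ s * (3 / 2 / m) := mul_le_mul_of_nonneg_left h1 hs.le
      _ ≤ 3 / 2 / m := by nlinarith
  obtain ⟨ψ, hψ, hψ'⟩ := exists_transports_of_coloring (d := d) (lo := lo) (hi := hi) hΦ
    hlohi (fun S => hg.add (RegularFamily.sum fun J _ => hqreg J)) hdpos
    (fun S J hJ t ht x hx => by rw [hdinsert S J hJ, hqoff J t ht x hx, add_zero])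
    (fun S J hJ t ht => by
      simp only [hdinsert S J hJ, add_sub_cancel_left]
      exact hqint J t ht)
    (fun J i => (⟨(J i : ℕ) % 2, Nat.mod_lt _ two_pos⟩ : Fin 2)) hcol
    (w := 3 / 2 / m) hwidth (by positivity)
  have hd0 : d ∅ = g := by
    ext t x; simp [hd]
  rw [hd0] at hψ
  -- the pieces add up to `f - g`, because the terms with the potential are antisymmetric
  refine ⟨_, (Transports.refl fun t ht => ?_).trans hψ, fun t ht x hx => ?_, fun t ht x => ?_⟩
  · ext x
    simp only [hd]
    by_cases hx : x ∈ closedCube a s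
    · have h1 : ∀ J, q J t x = X J x * (f t x - g t x) +
          θ x * ∑ K, X J x * X K x * (b K t - b J t) := by
        intro J
        simp only [hq, mul_add, Finset.mul_sum]
        congr 1
        exact Finset.sum_congr rfl fun K _ => by ring
      simp only [h1, Finset.sum_add_distrib, ← Finset.sum_mul, ← Finset.mul_sum]
      rw [hXsum x hx, Finset.sum_comm, sum_antisymm_eq_zero Finset.univ
        (w := fun K J => X J x * X K x) (fun J K => mul_comm _ _) fun K => b K t]
      ring
    · rw [Finset.sum_eq_zero fun J _ => hqoff J t ht x fun h => hx (hboxR J h), add_zero,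
        hoff t ht x hx]
  · exact (hψ' t ht x).2 fun J h => hx (hboxR J h)
  · refine (hψ' t ht x).1.trans ?_
    rw [Fintype.card_pi]
    simp only [Fintype.card_fin, Finset.prod_const, Finset.card_univ, Nat.cast_pow,
      Nat.cast_ofNat]
    rw [div_lt_iff₀ hρ] at hm
    rw [← mul_assoc, ← mul_div_assoc, div_le_iff₀ hm']
    linarith

end SmallDisplacement

/-! ### From densities on the cube to densities on the whole space -/

section Cutoff

variable {n : ℕ}

/-- A smooth cutoff function between `R` and the complement of the open unit cube. -/
structure IsCutoff (R : Set (EuclideanSpace ℝ (Fin n))) (κ : EuclideanSpace ℝ (Fin n) → ℝ) :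
    Prop where
  contDiff : ∀ k : ℕ∞, ContDiff ℝ k κ
  mem_Icc : ∀ x, κ x ∈ Icc (0 : ℝ) 1
  eq_one : ∀ x ∈ R, κ x = 1
  eventually_zero : ∀ x ∉ openUnitCube n, ∀ᶠ y in 𝓝 x, κ y = 0

lemma exists_isCutoff {R : Set (EuclideanSpace ℝ (Fin n))} (hR : IsClosed R)
    (hsub : R ⊆ openUnitCube n) : ∃ κ, IsCutoff R κ := by
  obtain ⟨κ, h0, h1, h2⟩ := exists_contMDiffMap_zero_one_nhds_of_isClosed
    (modelWithCornersSelf ℝ (EuclideanSpace ℝ (Fin n))) (n := (⊤ : ℕ∞))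
    isOpen_openUnitCube.isClosed_compl hR (disjoint_compl_left_iff_subset.2 hsub)
  refine ⟨κ, fun k => ?_, h2, fun x hx => h1.self_of_nhdsSet x hx, fun x hx =>
    h0.filter_mono (nhds_le_nhdsSet hx)⟩
  exact (contMDiff_iff_contDiff.1 κ.contMDiff).of_le (by exact_mod_cast le_top)

/-- The density that equals `u` where `κ = 1` and equals `1` where `κ = 0`. -/
noncomputable def cutoffDensity (κ u : EuclideanSpace ℝ (Fin n) → ℝ)
    (x : EuclideanSpace ℝ (Fin n)) : ℝ := κ x * u x + (1 - κ x)

variable {R : Set (EuclideanSpace ℝ (Fin n))} {κ : EuclideanSpace ℝ (Fin n) → ℝ}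

lemma IsCutoff.eq_zero (hκ : IsCutoff R κ) {x : EuclideanSpace ℝ (Fin n)}
    (hx : x ∉ openUnitCube n) : κ x = 0 := (hκ.eventually_zero x hx).self_of_nhds

lemma IsCutoff.cutoffDensity_pos (hκ : IsCutoff R κ) {u : EuclideanSpace ℝ (Fin n) → ℝ}
    (hu : ∀ x ∈ unitCube n, 0 < u x) (x : EuclideanSpace ℝ (Fin n)) : 0 < cutoffDensity κ u x := by
  unfold cutoffDensity
  by_cases hx : x ∈ openUnitCube n
  · have h1 := hu x (openUnitCube_subset hx)
    have h2 := hκ.mem_Icc x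
    rcases eq_or_lt_of_le h2.1 with h | h
    · rw [← h]; norm_num
    · have := mul_pos h h1
      linarith [h2.2]
  · rw [hκ.eq_zero hx]; norm_num

lemma IsCutoff.cutoffDensity_eq (hκ : IsCutoff R κ) (u : EuclideanSpace ℝ (Fin n) → ℝ)
    {x : EuclideanSpace ℝ (Fin n)} (hx : x ∈ R) : cutoffDensity κ u x = u x := by
  rw [cutoffDensity, hκ.eq_one x hx]; ring

lemma IsCutoff.contDiffOn_cutoffDensity (hκ : IsCutoff R κ)
    {u : ℝ → EuclideanSpace ℝ (Fin n) → ℝ} {k : ℕ∞}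
    (hu : ContDiffOn ℝ k (fun p : ℝ × EuclideanSpace ℝ (Fin n) => u p.1 p.2)
      (Icc (0 : ℝ) 1 ×ˢ unitCube n)) :
    ContDiffOn ℝ k (fun p : ℝ × EuclideanSpace ℝ (Fin n) => cutoffDensity κ (u p.1) p.2)
      (Icc (0 : ℝ) 1 ×ˢ univ) := by
  have hκ2 : ContDiff ℝ k fun p : ℝ × EuclideanSpace ℝ (Fin n) => κ p.2 :=
    (hκ.contDiff k).comp contDiff_snd
  have hprod : ContDiffOn ℝ k (fun p : ℝ × EuclideanSpace ℝ (Fin n) => κ p.2 * u p.1 p.2)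
      (Icc (0 : ℝ) 1 ×ˢ univ) := by
    rintro ⟨t, x⟩ ⟨ht, -⟩
    by_cases hx : x ∈ openUnitCube n
    · have h1 := hu (t, x) ⟨ht, openUnitCube_subset hx⟩
      refine hκ2.contDiffAt.contDiffWithinAt.mul (h1.mono_of_mem_nhdsWithin ?_)
      have h2 : (univ : Set ℝ) ×ˢ unitCube n ∈ 𝓝 (t, x) := prod_mem_nhds univ_mem
        (mem_of_superset (isOpen_openUnitCube.mem_nhds hx) openUnitCube_subset)
      filter_upwards [self_mem_nhdsWithin, mem_nhdsWithin_of_mem_nhds h2] with p hp hp2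
      exact ⟨hp.1, hp2.2⟩
    · have h3 : ∀ᶠ p : ℝ × EuclideanSpace ℝ (Fin n) in 𝓝 (t, x), κ p.2 = 0 :=
        (continuous_snd.tendsto (t, x)).eventually (hκ.eventually_zero x hx)
      refine (contDiffWithinAt_const (c := (0 : ℝ))).congr_of_eventuallyEq ?_ ?_
      · filter_upwards [mem_nhdsWithin_of_mem_nhds h3] with p hp
        have hp' : κ p.2 = 0 := hp
        rw [hp', zero_mul]
      · simp only [hκ.eq_zero hx, zero_mul]
  exact hprod.add (contDiff_const.sub hκ2).contDiffOn

lemma eq_of_notMem_of_diffSupport {f g : EuclideanSpace ℝ (Fin n) → ℝ}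
    (h : diffSupport f g ⊆ R) {x : EuclideanSpace ℝ (Fin n)} (hx : x ∈ unitCube n) (hxR : x ∉ R) :
    f x = g x := by
  by_contra hne
  exact hxR (h (subset_closure ⟨hx, sub_ne_zero.2 hne⟩))

/-- The difference of the extended densities is the extension by zero of the difference. -/
lemma IsCutoff.cutoffDensity_sub (hκ : IsCutoff R κ) {f g : EuclideanSpace ℝ (Fin n) → ℝ}
    (h : diffSupport f g ⊆ R) (x : EuclideanSpace ℝ (Fin n)) :
    cutoffDensity κ f x - cutoffDensity κ g x = (unitCube n).indicator (fun x => f x - g x) x := by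
  have e : cutoffDensity κ f x - cutoffDensity κ g x = κ x * (f x - g x) := by
    unfold cutoffDensity; ring
  rw [e]
  by_cases hx : x ∈ unitCube n
  · rw [indicator_of_mem hx]
    by_cases hxR : x ∈ R
    · rw [hκ.eq_one x hxR, one_mul]
    · rw [eq_of_notMem_of_diffSupport h hx hxR, sub_self, mul_zero]
  · rw [indicator_of_notMem hx, hκ.eq_zero fun hx' => hx (openUnitCube_subset hx'), zero_mul]

lemma setIntegral_eq_densityMeasure {u : EuclideanSpace ℝ (Fin n) → ℝ} (hu : Continuous u)
    (hu0 : ∀ x, 0 < u x) {A : Set (EuclideanSpace ℝ (Fin n))} (hA : MeasurableSet A) :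
    ∫ x in A, u x = (densityMeasure u A).toReal := by
  rw [densityMeasure, withDensity_apply _ hA, integral_eq_lintegral_of_nonneg_ae
    (Eventually.of_forall fun x => (hu0 x).le) hu.aestronglyMeasurable]

lemma isCompact_unitCube : IsCompact (unitCube n) := isCompact_coordBox (fun _ => 0) fun _ => 1

lemma measurableSet_unitCube : MeasurableSet (unitCube n) := isCompact_unitCube.measurableSet

lemma moveSupport_subset (hR : IsClosed R)
    {ψ : EuclideanSpace ℝ (Fin n) ≃ₜ EuclideanSpace ℝ (Fin n)} (hoff : ∀ x ∉ R, ψ x = x) :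
    moveSupport ψ ⊆ R :=
  closure_minimal (fun x hx => by_contra fun h => hx.2 (hoff x h)) hR

/-- A transport map between the extended densities that is the identity off `R` is a solution for the
original densities. -/
lemma isSolution_of_cutoff (hκ : IsCutoff R κ) (hR : IsClosed R) (hRsub : R ⊆ openUnitCube n)
    {f g : EuclideanSpace ℝ (Fin n) → ℝ} (hg : ContinuousOn g (unitCube n))
    (hg0 : ∀ x ∈ unitCube n, 0 < g x) (hf : IsAdmissible g f) (hfc : Continuous (cutoffDensity κ f))
    (hgc : Continuous (cutoffDensity κ g)) (hsupp : diffSupport f g ⊆ R)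
    {ψ : EuclideanSpace ℝ (Fin n) ≃ₜ EuclideanSpace ℝ (Fin n)} (hoff : ∀ x ∉ R, ψ x = x)
    (hmap : (densityMeasure (cutoffDensity κ f)).map ψ = densityMeasure (cutoffDensity κ g))
    (hreg : ∀ k : ℕ∞, ContDiffOn ℝ k f (unitCube n) → ContDiffOn ℝ k g (unitCube n) →
      ContDiff ℝ k ψ ∧ ContDiff ℝ k ψ.symm)
    (hjac : ContDiffOn ℝ 1 f (unitCube n) → ContDiffOn ℝ 1 g (unitCube n) →
      ∀ x, cutoffDensity κ g (ψ x) * (fderiv ℝ ψ x).det = cutoffDensity κ f x) :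
    IsSolution g f ψ where
  eq_off_cube x hx := hoff x fun h => hx (openUnitCube_subset (hRsub h))
  eq_near_boundary := (moveSupport_subset hR hoff).trans hRsub
  contDiff := hreg
  mass_eq A hA hAQ := by
    have hRQ : R ⊆ unitCube n := hRsub.trans openUnitCube_subset
    have hARm : MeasurableSet (A ∩ R) := hA.inter hR.measurableSet
    have hψm : ∀ B, MeasurableSet B → MeasurableSet (ψ '' B) := fun B hB =>
      ψ.measurableEmbedding.measurableSet_image.2 hB
    have himR : ψ '' (A ∩ R) ⊆ R := by
      rintro _ ⟨x, hx, rfl⟩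
      exact mem_of_eq_off hoff hx.2
    have himage : ψ '' A = ψ '' (A ∩ R) ∪ A \ R := by
      have h1 : ψ '' (A \ R) = A \ R := by
        ext y
        constructor
        · rintro ⟨x, hx, rfl⟩
          rw [hoff x hx.2]; exact hx
        · exact fun hy => ⟨y, hy, hoff y hy.2⟩
      rw [← h1, ← image_union, inter_union_sdiff]
    have hdisj : Disjoint (ψ '' (A ∩ R)) (A \ R) :=
      Set.disjoint_left.2 fun x h1 h2 => h2.2 (himR h1)
    have hdisj' : Disjoint (A ∩ R) (A \ R) := Set.disjoint_left.2 fun x h1 h2 => h2.2 h1.2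
    have hgi : IntegrableOn g (unitCube n) := hg.integrableOn_compact isCompact_unitCube
    have hfi : IntegrableOn f (unitCube n) := hf.continuousOn.integrableOn_compact isCompact_unitCube
    have hpart : ∫ y in ψ '' (A ∩ R), g y = ∫ x in A ∩ R, f x := by
      rw [setIntegral_congr_fun (hψm _ hARm) fun y hy => (hκ.cutoffDensity_eq g (himR hy)).symm,
        setIntegral_congr_fun hARm fun y hy => (hκ.cutoffDensity_eq f hy.2).symm,
        setIntegral_eq_densityMeasure hgc (hκ.cutoffDensity_pos hg0) (hψm _ hARm),
        setIntegral_eq_densityMeasure hfc (hκ.cutoffDensity_pos hf.pos) hARm, ← hmap,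
        Measure.map_apply ψ.continuous.measurable (hψm _ hARm), ψ.injective.preimage_image]
    calc ∫ y in ψ '' A, g y = (∫ y in ψ '' (A ∩ R), g y) + ∫ y in A \ R, g y := by
          rw [himage, setIntegral_union hdisj (hA.diff hR.measurableSet)
            (hgi.mono_set (himR.trans hRQ)) (hgi.mono_set (sdiff_subset.trans hAQ))]
      _ = (∫ x in A ∩ R, f x) + ∫ x in A \ R, f x := by
          rw [hpart, setIntegral_congr_fun (hA.diff hR.measurableSet) fun y hy =>
            (eq_of_notMem_of_diffSupport hsupp (hAQ hy.1) hy.2).symm]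
      _ = ∫ x in A, f x := by
          rw [← setIntegral_union hdisj' (hA.diff hR.measurableSet)
            (hfi.mono_set (inter_subset_left.trans hAQ)) (hfi.mono_set (sdiff_subset.trans hAQ)),
            inter_union_sdiff]
  jacobian_eq hf1 hg1 x hx := by
    by_cases hxR : x ∈ R
    · have := hjac hf1 hg1 x
      rwa [hκ.cutoffDensity_eq f hxR, hκ.cutoffDensity_eq g (mem_of_eq_off hoff hxR)] at this
    · have h1 : (ψ : _ → _) =ᶠ[𝓝 x] id := by
        filter_upwards [hR.isOpen_compl.mem_nhds hxR] with y hy using hoff y hy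
      have h2 : (ContinuousLinearMap.id ℝ (EuclideanSpace ℝ (Fin n))).det = 1 := LinearMap.det_id
      rw [h1.fderiv_eq, fderiv_id, h2, mul_one, hoff x hxR, eq_of_notMem_of_diffSupport hsupp hx hxR]

end Cutoff

/-! ### The weak distance -/

section WeakDist

variable {n : ℕ} {f g : EuclideanSpace ℝ (Fin n) → ℝ}

lemma setIntegral_cubeMeasure (hf : ContinuousOn f (unitCube n)) (hf0 : ∀ x ∈ unitCube n, 0 < f x)
    (φ : EuclideanSpace ℝ (Fin n) → ℝ) :
    ∫ x in unitCube n, φ x ∂cubeMeasure f = ∫ x in unitCube n, φ x * f x := by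
  rw [cubeMeasure, restrict_withDensity measurableSet_unitCube, Measure.restrict_restrict
    measurableSet_unitCube, inter_self, integral_withDensity_eq_integral_toReal_smul₀
    (hf.aemeasurable measurableSet_unitCube).ennreal_ofReal
    (Eventually.of_forall fun _ => ENNReal.ofReal_lt_top)]
  refine setIntegral_congr_fun measurableSet_unitCube fun x hx => ?_
  simp only [smul_eq_mul]
  rw [ENNReal.toReal_ofReal (hf0 x hx).le, mul_comm]

lemma abs_integral_sub_le_weakDist (hf : ContinuousOn f (unitCube n))
    (hf0 : ∀ x ∈ unitCube n, 0 < f x) (hg : ContinuousOn g (unitCube n))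
    (hg0 : ∀ x ∈ unitCube n, 0 < g x) {φ : EuclideanSpace ℝ (Fin n) → ℝ} (hφ : LipschitzWith 1 φ)
    (hφ1 : ∀ x, φ x ∈ Icc (0 : ℝ) 1) :
    |∫ x in unitCube n, φ x * (f x - g x)| ≤ weakDist (cubeMeasure f) (cubeMeasure g) := by
  have hint : ∀ {u φ : EuclideanSpace ℝ (Fin n) → ℝ}, ContinuousOn u (unitCube n) →
      ContinuousOn φ (unitCube n) → IntegrableOn (fun x => φ x * u x) (unitCube n) :=
    fun hu hφ => (hφ.mul hu).integrableOn_compact isCompact_unitCube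
  have hle : ∀ {u φ : EuclideanSpace ℝ (Fin n) → ℝ}, ContinuousOn u (unitCube n) →
      (∀ x ∈ unitCube n, 0 < u x) → ContinuousOn φ (unitCube n) →
      (∀ x ∈ unitCube n, φ x ∈ Icc (0 : ℝ) 1) →
      |∫ x in unitCube n, φ x * u x| ≤ ∫ x in unitCube n, u x := by
    intro u φ hu hu0 hφ hφ1
    rw [abs_of_nonneg (setIntegral_nonneg measurableSet_unitCube fun x hx =>
      mul_nonneg (hφ1 x hx).1 (hu0 x hx).le)]
    refine setIntegral_mono_on (hint hu hφ) (hu.integrableOn_compact isCompact_unitCube)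
      measurableSet_unitCube fun x hx => ?_
    have := mul_le_mul_of_nonneg_right (hφ1 x hx).2 (hu0 x hx).le
    linarith
  refine le_csSup ⟨(∫ x in unitCube n, f x) + ∫ x in unitCube n, g x, ?_⟩
    ⟨φ, hφ.lipschitzOnWith, fun x _ => hφ1 x, ?_⟩
  · rintro r ⟨φ', hφ', hφ1', rfl⟩
    rw [setIntegral_cubeMeasure hf hf0, setIntegral_cubeMeasure hg hg0]
    exact (abs_sub _ _).trans (add_le_add (hle hf hf0 hφ'.continuousOn hφ1')
      (hle hg hg0 hφ'.continuousOn hφ1'))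
  · rw [setIntegral_cubeMeasure hf hf0, setIntegral_cubeMeasure hg hg0,
      ← integral_sub (hint hf hφ.continuous.continuousOn) (hint hg hφ.continuous.continuousOn)]
    simp only [mul_sub]

lemma homeoDist_nonneg (h k : EuclideanSpace ℝ (Fin n) ≃ₜ EuclideanSpace ℝ (Fin n)) :
    0 ≤ homeoDist h k :=
  Real.sSup_nonneg (by rintro _ ⟨x, -, rfl⟩; positivity)

lemma homeoDist_le {h k : EuclideanSpace ℝ (Fin n) ≃ₜ EuclideanSpace ℝ (Fin n)} {ρ : ℝ}
    (hρ : 0 ≤ ρ) (hle : ∀ x ∈ unitCube n, dist (h x) (k x) + dist (h.symm x) (k.symm x) ≤ ρ) :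
    homeoDist h k ≤ ρ :=
  Real.sSup_le (by rintro _ ⟨x, hx, rfl⟩; exact hle x hx) hρ

lemma homeoDist_refl_le {h : EuclideanSpace ℝ (Fin n) ≃ₜ EuclideanSpace ℝ (Fin n)} {ρ : ℝ}
    (hρ : 0 ≤ ρ) (hle : ∀ x, dist (h x) x ≤ ρ) : homeoDist h (Homeomorph.refl _) ≤ 2 * ρ := by
  refine homeoDist_le (by positivity) fun x _ => ?_
  have h1 := hle x
  have h2 := hle (h.symm x)
  rw [Homeomorph.apply_symm_apply, dist_comm] at h2
  simp only [Homeomorph.refl_apply, Homeomorph.refl_symm, id_eq]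
  linarith

end WeakDist

/-! ### Families of solutions -/

section SolutionFamilies

variable {n : ℕ}

/-- The conclusion of the parametric theorem: solutions for the densities `F t`, `t ∈ [0,1]`, which
are supported in `R`, are `ρ`-close to the identity, and depend regularly on `t`. -/
def HasSolutionFamily (g : EuclideanSpace ℝ (Fin n) → ℝ) (F : ℝ → EuclideanSpace ℝ (Fin n) → ℝ)
    (R : Set (EuclideanSpace ℝ (Fin n))) (ρ : ℝ) : Prop :=
  ∃ ψ : ℝ → EuclideanSpace ℝ (Fin n) ≃ₜ EuclideanSpace ℝ (Fin n),
    (∀ t ∈ Icc (0 : ℝ) 1, IsSolution g (F t) (ψ t) ∧ moveSupport (ψ t) ⊆ R ∧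
      homeoDist (ψ t) (Homeomorph.refl _) ≤ ρ) ∧
    (∀ t₀ ∈ Icc (0 : ℝ) 1,
      Tendsto (fun t => homeoDist (ψ t) (ψ t₀)) (𝓝[Icc (0 : ℝ) 1] t₀) (𝓝 0)) ∧
    (∀ k : ℕ∞,
      ContDiffOn ℝ k (fun p : ℝ × EuclideanSpace ℝ (Fin n) => F p.1 p.2)
        (Icc (0 : ℝ) 1 ×ˢ unitCube n) →
      ContDiffOn ℝ k g (unitCube n) →
      ContDiffOn ℝ k (fun p : ℝ × EuclideanSpace ℝ (Fin n) => ψ p.1 p.2)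
        (Icc (0 : ℝ) 1 ×ˢ univ))

/-- The regularity of the densities `F t` and `g` on the cube, as a system of hypotheses. -/
def cubeRegularity (g : EuclideanSpace ℝ (Fin n) → ℝ) (F : ℝ → EuclideanSpace ℝ (Fin n) → ℝ)
    (τ : ℝ → ℝ) (k : ℕ∞) : Prop :=
  MapsTo τ (Icc (0 : ℝ) 1) (Icc (0 : ℝ) 1) ∧
    ContDiffOn ℝ k (fun p : ℝ × EuclideanSpace ℝ (Fin n) => F (τ p.1) p.2)
      (Icc (0 : ℝ) 1 ×ˢ unitCube n) ∧ ContDiffOn ℝ k g (unitCube n)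

/-- A continuous family of admissible densities whose differences from `g` are supported in `R`. -/
structure IsAdmissibleFamily (g : EuclideanSpace ℝ (Fin n) → ℝ)
    (F : ℝ → EuclideanSpace ℝ (Fin n) → ℝ) (R : Set (EuclideanSpace ℝ (Fin n))) : Prop where
  cont_left : ContinuousOn g (unitCube n)
  pos_left : ∀ x ∈ unitCube n, 0 < g x
  cont : ContinuousOn (fun p : ℝ × EuclideanSpace ℝ (Fin n) => F p.1 p.2)
    (Icc (0 : ℝ) 1 ×ˢ unitCube n)
  admissible : ∀ t ∈ Icc (0 : ℝ) 1, IsAdmissible g (F t)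
  isCompact : IsCompact R
  subset : R ⊆ openUnitCube n
  support_subset : ∀ t ∈ Icc (0 : ℝ) 1, diffSupport (F t) g ⊆ R

variable {g : EuclideanSpace ℝ (Fin n) → ℝ} {F : ℝ → EuclideanSpace ℝ (Fin n) → ℝ}
  {R : Set (EuclideanSpace ℝ (Fin n))} {κ : EuclideanSpace ℝ (Fin n) → ℝ}

lemma IsAdmissibleFamily.isRegularitySystem (hF : IsAdmissibleFamily g F R) :
    IsRegularitySystem (cubeRegularity g F) where
  mapsTo _ _ h := h.1
  id_zero := ⟨mapsTo_id _, contDiffOn_zero.2 hF.cont, contDiffOn_zero.2 hF.cont_left⟩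

lemma IsCutoff.regularFamily_left (hκ : IsCutoff R κ) :
    RegularFamily (cubeRegularity g F) fun t => cutoffDensity κ (F t) := fun τ _ h =>
  hκ.contDiffOn_cutoffDensity (u := fun t => F (τ t)) h.2.1

lemma IsCutoff.regularFamily_right (hκ : IsCutoff R κ) :
    RegularFamily (cubeRegularity g F) fun _ => cutoffDensity κ g := fun _ _ h =>
  hκ.contDiffOn_cutoffDensity (u := fun _ => g) (h.2.2.comp contDiff_snd.contDiffOn fun _ hp => hp.2)

lemma IsAdmissibleFamily.cutoffDensity_eq_off (hF : IsAdmissibleFamily g F R) (hκ : IsCutoff R κ)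
    {t : ℝ} (ht : t ∈ Icc (0 : ℝ) 1) {x : EuclideanSpace ℝ (Fin n)} (hx : x ∉ R) :
    cutoffDensity κ (F t) x = cutoffDensity κ g x := by
  rw [← sub_eq_zero, hκ.cutoffDensity_sub (hF.support_subset t ht)]
  by_cases hxQ : x ∈ unitCube n
  · rw [indicator_of_mem hxQ, eq_of_notMem_of_diffSupport (hF.support_subset t ht) hxQ hx, sub_self]
  · exact indicator_of_notMem hxQ _

lemma IsAdmissibleFamily.integral_cutoffDensity_sub (hF : IsAdmissibleFamily g F R)
    (hκ : IsCutoff R κ) {t : ℝ} (ht : t ∈ Icc (0 : ℝ) 1) (φ : EuclideanSpace ℝ (Fin n) → ℝ) :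
    ∫ x, φ x * (cutoffDensity κ (F t) x - cutoffDensity κ g x) =
      ∫ x in unitCube n, φ x * (F t x - g x) := by
  rw [← integral_indicator measurableSet_unitCube]
  refine integral_congr_ae (Eventually.of_forall fun x => ?_)
  simp only [hκ.cutoffDensity_sub (hF.support_subset t ht)]
  by_cases hx : x ∈ unitCube n
  · rw [indicator_of_mem hx, indicator_of_mem hx]
  · rw [indicator_of_notMem hx, indicator_of_notMem hx, mul_zero]

lemma IsAdmissibleFamily.integral_eq_zero (hF : IsAdmissibleFamily g F R)
    (hκ : IsCutoff R κ) {t : ℝ} (ht : t ∈ Icc (0 : ℝ) 1) :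
    ∫ x, (cutoffDensity κ (F t) x - cutoffDensity κ g x) = 0 := by
  have h := hF.integral_cutoffDensity_sub hκ ht fun _ => 1
  simp only [one_mul] at h
  rw [h, integral_sub, (hF.admissible t ht).integral_eq, sub_self]
  · exact (hF.admissible t ht).continuousOn.integrableOn_compact isCompact_unitCube
  · exact hF.cont_left.integrableOn_compact isCompact_unitCube

lemma IsAdmissibleFamily.hasSolutionFamily_of_transports (hF : IsAdmissibleFamily g F R)
    (hκ : IsCutoff R κ) {ψ : ℝ → EuclideanSpace ℝ (Fin n) ≃ₜ EuclideanSpace ℝ (Fin n)}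
    (hψ : Transports (cubeRegularity g F) (fun t => cutoffDensity κ (F t))
      (fun _ => cutoffDensity κ g) ψ)
    (hoff : ∀ t ∈ Icc (0 : ℝ) 1, ∀ x ∉ R, ψ t x = x) {ρ : ℝ} (hρ : 0 ≤ ρ)
    (hdist : ∀ t ∈ Icc (0 : ℝ) 1, ∀ x, dist (ψ t x) x ≤ ρ) :
    HasSolutionFamily g F R (2 * ρ) := by
  have hΦ := hF.isRegularitySystem
  have hR : IsClosed R := hF.isCompact.isClosed
  have hconst : ∀ t ∈ Icc (0 : ℝ) 1, ∀ k : ℕ∞, ContDiffOn ℝ k (F t) (unitCube n) →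
      ContDiffOn ℝ k g (unitCube n) → cubeRegularity g F (fun _ => t) k := fun t ht k h1 h2 =>
    ⟨fun _ _ => ht, h1.comp contDiff_snd.contDiffOn fun _ hp => hp.2, h2⟩
  refine ⟨ψ, fun t ht => ⟨?_, moveSupport_subset hR (hoff t ht), homeoDist_refl_le hρ (hdist t ht)⟩,
    fun t₀ ht₀ => ?_, fun k h1 h2 => hψ.contDiffOn id k ⟨mapsTo_id _, h1, h2⟩⟩
  · exact isSolution_of_cutoff hκ hR hF.subset hF.cont_left hF.pos_left (hF.admissible t ht)
      (hκ.regularFamily_left.continuous hΦ ht) (hκ.regularFamily_right.continuous hΦ ht)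
      (hF.support_subset t ht) (hoff t ht) (hψ.map_eq t ht)
      (fun k h1 h2 => hψ.contDiff (hconst t ht k h1 h2))
      fun h1 h2 => hψ.jacobian t ht (hconst t ht 1 h1 h2)
  · have hc1 : ContinuousOn (fun p : ℝ × EuclideanSpace ℝ (Fin n) => ψ p.1 p.2)
        (Icc (0 : ℝ) 1 ×ˢ univ) := (hψ.contDiffOn id 0 hΦ.id_zero).continuousOn
    have hc2 : ContinuousOn (fun p : ℝ × EuclideanSpace ℝ (Fin n) => (ψ p.1).symm p.2)
        (Icc (0 : ℝ) 1 ×ˢ univ) := (hψ.contDiffOn_symm id 0 hΦ.id_zero).continuousOn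
    rw [Metric.tendsto_nhds]
    intro ε hε
    filter_upwards [eventually_forall_dist_lt_of_continuousOn_prod isCompact_unitCube hc1 ht₀
        (ε := ε / 4) (by positivity),
      eventually_forall_dist_lt_of_continuousOn_prod isCompact_unitCube hc2 ht₀
        (ε := ε / 4) (by positivity)] with t h1 h2
    rw [Real.dist_eq, sub_zero, abs_of_nonneg (homeoDist_nonneg _ _)]
    have : homeoDist (ψ t) (ψ t₀) ≤ ε / 2 := by
      refine homeoDist_le (by positivity) fun x hx => ?_
      have h3 := h1 x hx
      have h4 := h2 x hx
      rw [dist_eq_norm, dist_eq_norm]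
      linarith
    linarith

/-- If all the densities equal `g` on the cube, then the identity is a solution. -/
lemma IsAdmissibleFamily.hasSolutionFamily_of_eqOn (hF : IsAdmissibleFamily g F R)
    (h : ∀ t ∈ Icc (0 : ℝ) 1, EqOn (F t) g (unitCube n)) {ρ : ℝ} (hρ : 0 ≤ ρ) :
    HasSolutionFamily g F ∅ ρ := by
  have hE : IsAdmissibleFamily g F ∅ := by
    refine ⟨hF.cont_left, hF.pos_left, hF.cont, hF.admissible, isCompact_empty, empty_subset _,
      fun t ht => ?_⟩
    refine closure_minimal ?_ isClosed_empty
    rintro x ⟨hx, hne⟩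
    exact hne (sub_eq_zero.2 (h t ht hx))
  obtain ⟨κ, hκ⟩ := exists_isCutoff (n := n) isClosed_empty (empty_subset _)
  obtain ⟨ψ, h1, h2, h3⟩ := hE.hasSolutionFamily_of_transports hκ (ρ := 0)
    (ψ := fun _ => Homeomorph.refl _)
    (Transports.refl fun t ht => funext fun x => hE.cutoffDensity_eq_off hκ ht (notMem_empty x))
    (fun _ _ _ _ => rfl) le_rfl fun _ _ x => by simp
  exact ⟨ψ, fun t ht => ⟨(h1 t ht).1, (h1 t ht).2.1, (h1 t ht).2.2.trans (by simpa using hρ)⟩, h2, h3⟩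

lemma HasSolutionFamily.mono {R' : Set (EuclideanSpace ℝ (Fin n))} {ρ ρ' : ℝ}
    (h : HasSolutionFamily g F R ρ) (hR : R ⊆ R') (hρ : ρ ≤ ρ') : HasSolutionFamily g F R' ρ' := by
  obtain ⟨ψ, h1, h2, h3⟩ := h
  exact ⟨ψ, fun t ht => ⟨(h1 t ht).1, (h1 t ht).2.1.trans hR, (h1 t ht).2.2.trans hρ⟩, h2, h3⟩

/-- In a box, solutions exist; they displace points at most by the diameter of the box. -/
lemma IsAdmissibleFamily.hasSolutionFamily_coordBox {lo hi : Fin n → ℝ}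
    (hF : IsAdmissibleFamily g F (coordBox lo hi)) (hlt : ∀ i, lo i < hi i) {w : ℝ} (hw0 : 0 ≤ w)
    (hw : ∀ i, hi i - lo i ≤ w) : HasSolutionFamily g F (coordBox lo hi) (2 * (√n * w)) := by
  have hΦ := hF.isRegularitySystem
  obtain ⟨κ, hκ⟩ := exists_isCutoff hF.isCompact.isClosed hF.subset
  obtain ⟨ψ, hψ, hoff⟩ := exists_transports_of_eq_off_coordBox hΦ hlt hκ.regularFamily_left
    hκ.regularFamily_right (fun t ht => hκ.cutoffDensity_pos (hF.admissible t ht).pos)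
    (fun t ht => hκ.cutoffDensity_pos hF.pos_left)
    (fun t ht x hx => hF.cutoffDensity_eq_off hκ ht hx) fun t ht => hF.integral_eq_zero hκ ht
  refine hF.hasSolutionFamily_of_transports hκ hψ hoff (by positivity) fun t ht x => ?_
  by_cases hx : x ∈ coordBox lo hi
  · exact dist_le_of_mem_coordBox hw (mem_of_eq_off (hoff t ht) hx) hx
  · rw [hoff t ht x hx, dist_self]; positivity

/-- A box that contains points where the densities differ is not degenerate, because the densities
differ on an open set. -/
lemma lt_of_ne_of_diffSupport_subset {f g : EuclideanSpace ℝ (Fin n) → ℝ}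
    (hf : ContinuousOn f (unitCube n)) (hg : ContinuousOn g (unitCube n)) {lo hi : Fin n → ℝ}
    (hsub : coordBox lo hi ⊆ openUnitCube n) (hsupp : diffSupport f g ⊆ coordBox lo hi)
    {x : EuclideanSpace ℝ (Fin n)} (hx : x ∈ unitCube n) (hne : f x ≠ g x) (i : Fin n) :
    lo i < hi i := by
  by_contra hle
  rw [not_lt] at hle
  have hmem : ∀ y ∈ unitCube n, f y ≠ g y → y ∈ coordBox lo hi := fun y hy hy' => by
    by_contra h
    exact hy' (eq_of_notMem_of_diffSupport hsupp hy h)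
  have hxo := hsub (hmem x hx hne)
  have hQ : unitCube n ∈ 𝓝 x := mem_of_superset (isOpen_openUnitCube.mem_nhds hxo) openUnitCube_subset
  have hev : ∀ᶠ y in 𝓝 x, y ∈ unitCube n ∧ f y ≠ g y :=
    (show ∀ᶠ y in 𝓝 x, y ∈ unitCube n from hQ).and
      (((hf.continuousAt hQ).ne_iff_eventually_ne (hg.continuousAt hQ)).1 hne)
  have hline : Tendsto (setCoord i x) (𝓝[≠] (x i)) (𝓝 x) := by
    have h1 := (continuous_setCoord i x).tendsto (x i)
    rw [setCoord_self] at h1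
    exact h1.mono_left nhdsWithin_le_nhds
  obtain ⟨y, hy, hyne⟩ := ((hline.eventually hev).and self_mem_nhdsWithin).exists
  have h1 := hmem _ hy.1 hy.2 i
  have h2 := hmem x hx hne i
  rw [setCoord_same] at h1
  exact hyne (show y = x i by linarith)

lemma eqOn_of_isAdmissible_zero {f g : EuclideanSpace ℝ (Fin 0) → ℝ} (h : IsAdmissible g f) :
    EqOn f g (unitCube 0) := by
  intro x _
  have hQ : unitCube 0 = univ := eq_univ_of_forall fun x i => i.elim0
  have hc : ∀ u : EuclideanSpace ℝ (Fin 0) → ℝ, ∫ y in unitCube 0, u y = u x := by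
    intro u
    rw [hQ, Measure.restrict_univ, volume_euclideanSpace_eq_dirac, integral_dirac,
      Subsingleton.elim x 0]
  rw [← hc f, ← hc g, h.integral_eq]

end SolutionFamilies

/-! ### Boxes and cubes around compact sets -/

section Enclosing

variable {n : ℕ}

/-- The bounding box of a compact set: its faces touch the set. -/
lemma exists_boundingBox {K : Set (EuclideanSpace ℝ (Fin n))} (hK : IsCompact K)
    (hne : K.Nonempty) : ∃ lo hi : Fin n → ℝ, K ⊆ coordBox lo hi ∧
      ∀ i, (∃ x ∈ K, x i = lo i) ∧ ∃ x ∈ K, x i = hi i := by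
  have hc : ∀ i : Fin n, ContinuousOn (fun x : EuclideanSpace ℝ (Fin n) => x i) K := fun i =>
    Continuous.continuousOn (by fun_prop)
  choose x hx hxmin using fun i => hK.exists_isMinOn hne (hc i)
  choose y hy hymax using fun i => hK.exists_isMaxOn hne (hc i)
  exact ⟨fun i => x i i, fun i => y i i, fun z hz i => ⟨hxmin i hz, hymax i hz⟩, fun i =>
    ⟨⟨x i, hx i, rfl⟩, ⟨y i, hy i, rfl⟩⟩⟩

lemma exists_closedCube_of_isCompact {K : Set (EuclideanSpace ℝ (Fin n))} (hK : IsCompact K)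
    (hsub : K ⊆ openUnitCube n) : ∃ (a : EuclideanSpace ℝ (Fin n)) (s : ℝ),
      closedCube a s ⊆ openUnitCube n ∧ K ⊆ closedCube a s := by
  have key : ∀ η : ℝ, 0 < η → closedCube (WithLp.toLp 2 fun _ : Fin n => η) (1 - 2 * η) ⊆
      openUnitCube n := fun η hη x hx i => by
    have := hx i
    simp only at this
    exact ⟨by linarith, by linarith⟩
  rcases K.eq_empty_or_nonempty with rfl | hne
  · exact ⟨_, _, key 1 one_pos, empty_subset _⟩
  obtain ⟨lo, hi, hbox, htouch⟩ := exists_boundingBox hK hne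
  have hη : ∀ᶠ η : ℝ in 𝓝[>] 0, ∀ i, η ≤ lo i ∧ η ≤ 1 - hi i := by
    refine eventually_all.2 fun i => ?_
    obtain ⟨⟨x, hx, hxi⟩, ⟨y, hy, hyi⟩⟩ := htouch i
    have h1 : 0 < lo i := hxi ▸ (hsub hx i).1
    have h2 : 0 < 1 - hi i := by
      rw [← hyi]; exact sub_pos.2 (hsub hy i).2
    exact ((eventually_le_nhds h1).filter_mono nhdsWithin_le_nhds).and
      ((eventually_le_nhds h2).filter_mono nhdsWithin_le_nhds)
  obtain ⟨η, hη, hη0⟩ := (hη.and self_mem_nhdsWithin).exists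
  refine ⟨_, _, key η hη0, fun x hx i => ?_⟩
  have h1 := hbox hx i
  have h2 := hη i
  simp only
  exact ⟨by linarith, by linarith⟩

lemma isCompact_closedCube (a : EuclideanSpace ℝ (Fin n)) (s : ℝ) : IsCompact (closedCube a s) :=
  isCompact_coordBox (fun i => a i) fun i => a i + s

lemma isCompact_diffSupport {f g : EuclideanSpace ℝ (Fin n) → ℝ} : IsCompact (diffSupport f g) :=
  isCompact_unitCube.of_isClosed_subset isClosed_closure
    (closure_minimal (fun _ hx => hx.1) isCompact_unitCube.isClosed)

lemma side_lt_one_of_closedCube_subset {a : EuclideanSpace ℝ (Fin n)} {s : ℝ} (hs : 0 ≤ s)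
    (h : closedCube a s ⊆ openUnitCube n) (i : Fin n) : s < 1 := by
  have h1 := h (show a ∈ closedCube a s from fun i => ⟨le_rfl, by linarith⟩) i
  have h2 := h (show (WithLp.toLp 2 fun i => a i + s) ∈ closedCube a s from fun i =>
    ⟨by simpa using hs, le_rfl⟩) i
  simp only at h2
  linarith [h1.1, h2.2]

end Enclosing

/-! ### The modulus of continuity -/

section Modulus

variable {n : ℕ} {g : EuclideanSpace ℝ (Fin n) → ℝ} {F : ℝ → EuclideanSpace ℝ (Fin n) → ℝ}

/-- The weak distance separates continuous densities: test with a cone function at a point where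
the densities differ. -/
lemma IsAdmissibleFamily.eqOn_of_weakDist_nonpos {R : Set (EuclideanSpace ℝ (Fin n))}
    (hF : IsAdmissibleFamily g F R) {t : ℝ} (ht : t ∈ Icc (0 : ℝ) 1)
    (hd : weakDist (cubeMeasure (F t)) (cubeMeasure g) ≤ 0) : EqOn (F t) g (unitCube n) := by
  obtain ⟨κ, hκ⟩ := exists_isCutoff hF.isCompact.isClosed hF.subset
  set D : EuclideanSpace ℝ (Fin n) → ℝ := fun x => cutoffDensity κ (F t) x - cutoffDensity κ g x
    with hD
  have hDc : Continuous D :=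
    (hκ.regularFamily_left.continuous hF.isRegularitySystem ht).sub
      (hκ.regularFamily_right.continuous hF.isRegularitySystem ht)
  intro x hx
  by_contra hne
  have hDx : D x ≠ 0 := by
    simp only [hD, hκ.cutoffDensity_sub (hF.support_subset t ht), indicator_of_mem hx]
    exact sub_ne_zero.2 hne
  have hev : ∀ᶠ y in 𝓝 x, 0 < D y * D x :=
    ((hDc.mul continuous_const).tendsto x).eventually_const_lt (mul_self_pos.2 hDx)
  obtain ⟨r, hr, hball⟩ := Metric.eventually_nhds_iff.1 hev
  have hm : 0 < min r 1 := lt_min hr one_pos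
  set φ : EuclideanSpace ℝ (Fin n) → ℝ := fun y => max 0 (min r 1 - dist y x) with hφ
  have hφ0 : ∀ y, r ≤ dist y x → φ y = 0 := fun y hy =>
    max_eq_left (by linarith [min_le_left r 1])
  have hφL : LipschitzWith 1 φ := LipschitzWith.of_le_add fun y z => by
    refine max_le (add_nonneg (le_max_left _ _) dist_nonneg) ?_
    have h1 := le_max_right 0 (min r 1 - dist z x)
    have h2 := dist_triangle z y x
    rw [dist_comm z y] at h2
    simp only [hφ]
    linarith
  have hφI : ∀ y, φ y ∈ Icc (0 : ℝ) 1 := fun y =>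
    ⟨le_max_left _ _, max_le zero_le_one (by
      linarith [min_le_right r 1, dist_nonneg (x := y) (y := x)])⟩
  have hle := (abs_integral_sub_le_weakDist (hF.admissible t ht).continuousOn
    (hF.admissible t ht).pos hF.cont_left hF.pos_left hφL hφI).trans hd
  rw [← hF.integral_cutoffDensity_sub hκ ht] at hle
  have hzero : ∫ y, φ y * D y = 0 := abs_nonpos_iff.1 hle
  have hpos : 0 < ∫ y, φ y * D y * D x := by
    refine Continuous.integral_pos_of_hasCompactSupport_nonneg_nonzero (x := x)
      ((hφL.continuous.mul hDc).mul continuous_const) ?_ (fun y => ?_) ?_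
    · refine HasCompactSupport.intro (isCompact_closedBall x r) fun y hy => ?_
      rw [Metric.mem_closedBall, not_le] at hy
      rw [hφ0 y hy.le, zero_mul, zero_mul]
    · rcases lt_or_ge (dist y x) r with h | h
      · have := mul_nonneg (hφI y).1 (hball h).le
        simpa only [Pi.zero_apply, mul_assoc] using this
      · simp [hφ0 y h]
    · have hφx : φ x = min r 1 := by simp only [hφ, dist_self, sub_zero, max_eq_right hm.le]
      rw [hφx]
      exact mul_ne_zero (mul_ne_zero hm.ne' hDx) hDx
  rw [integral_mul_const, hzero, zero_mul] at hpos
  exact lt_irrefl _ hpos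

variable {a : EuclideanSpace ℝ (Fin n)} {s : ℝ}

/-- Either there is nothing to do, or the cube is not degenerate.  The first case covers dimension
zero and cubes with empty interior. -/
lemma IsAdmissibleFamily.eqOn_or_side (hF : IsAdmissibleFamily g F (closedCube a s)) :
    (∀ t ∈ Icc (0 : ℝ) 1, EqOn (F t) g (unitCube n)) ∨ 0 < s ∧ s < 1 := by
  by_contra! hcon
  obtain ⟨⟨t, ht, hne⟩, hs⟩ := hcon
  rcases n.eq_zero_or_pos with rfl | hn
  · exact hne (eqOn_of_isAdmissible_zero (hF.admissible t ht))
  have : ∃ x ∈ unitCube n, F t x ≠ g x := by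
    simpa only [EqOn, not_forall, exists_prop] using hne
  obtain ⟨x, hx, hxne⟩ := this
  have h := lt_of_ne_of_diffSupport_subset (lo := fun i => a i) (hi := fun i => a i + s)
    (hF.admissible t ht).continuousOn hF.cont_left hF.subset (hF.support_subset t ht) hx hxne ⟨0, hn⟩
  have hs0 : 0 < s := by simpa using h
  exact (hs hs0).not_gt (side_lt_one_of_closedCube_subset hs0.le hF.subset ⟨0, hn⟩)

lemma IsAdmissibleFamily.hasSolutionFamily_closedCube
    (hF : IsAdmissibleFamily g F (closedCube a s)) {w : ℝ} (hw0 : 0 ≤ w) (hw : s ≤ w) :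
    HasSolutionFamily g F (closedCube a s) (2 * (√n * w)) := by
  rcases hF.eqOn_or_side with h | h
  · exact (hF.hasSolutionFamily_of_eqOn h (by positivity)).mono (empty_subset _) le_rfl
  · exact hF.hasSolutionFamily_coordBox (lo := fun i => a i) (hi := fun i => a i + s)
      (fun i => by simpa using h.1) hw0 fun i => by simpa using hw

/-- Densities weakly close to `g` have solutions close to the identity, uniformly in the cube that
carries the difference: in a small cube every map is close to the identity, and in a large one the
weak closeness is used. -/
lemma exists_hasSolutionFamily_of_weakDist_le (hg : ContinuousOn g (unitCube n))
    (hg0 : ∀ x ∈ unitCube n, 0 < g x) {ρ : ℝ} (hρ : 0 < ρ) :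
    ∃ δ > 0, ∀ (F : ℝ → EuclideanSpace ℝ (Fin n) → ℝ) (a : EuclideanSpace ℝ (Fin n)) (s : ℝ),
      IsAdmissibleFamily g F (closedCube a s) →
      (∀ t ∈ Icc (0 : ℝ) 1, weakDist (cubeMeasure (F t)) (cubeMeasure g) ≤ δ) →
      HasSolutionFamily g F (closedCube a s) ρ := by
  obtain ⟨x₀, hx₀, hmin⟩ := isCompact_unitCube.exists_isMinOn
    (⟨0, fun i => ⟨le_rfl, zero_le_one⟩⟩ : (unitCube n).Nonempty) hg
  have hn : 0 ≤ √(n : ℝ) := Real.sqrt_nonneg _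
  -- a cube of side less than `ε` has diameter less than `ρ / 2`
  obtain ⟨δ, hδ, hsmall⟩ := exists_transports_small_of_le_side n (ρ := ρ / 2)
    (ε := ρ / (2 * (√n + 1))) (by positivity) (by positivity) (hg0 x₀ hx₀)
  refine ⟨δ, hδ, fun F a s hF hd => ?_⟩
  rcases hF.eqOn_or_side with h | h
  · exact (hF.hasSolutionFamily_of_eqOn h hρ.le).mono (empty_subset _) le_rfl
  rcases lt_or_ge s (ρ / (2 * (√n + 1))) with hs | hs
  · refine (hF.hasSolutionFamily_closedCube h.1.le le_rfl).mono Subset.rfl ?_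
    rw [lt_div_iff₀ (by positivity)] at hs
    nlinarith [h.1]
  · obtain ⟨κ, hκ⟩ := exists_isCutoff hF.isCompact.isClosed hF.subset
    obtain ⟨ψ, hψ, hoff, hdist⟩ := hsmall hF.isRegularitySystem a s hs h.2.le
      hκ.regularFamily_left hκ.regularFamily_right
      (fun t ht => hκ.cutoffDensity_pos (hF.admissible t ht).pos)
      (fun t ht => hκ.cutoffDensity_pos hF.pos_left)
      (fun t ht x hx => by
        rw [hκ.cutoffDensity_eq g hx]
        exact hmin (openUnitCube_subset (hF.subset hx)))
      (fun t ht x hx => hF.cutoffDensity_eq_off hκ ht hx) (fun t ht => hF.integral_eq_zero hκ ht)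
      (fun t ht φ hφ hφ1 => by
        rw [hF.integral_cutoffDensity_sub hκ ht]
        exact (abs_integral_sub_le_weakDist (hF.admissible t ht).continuousOn
          (hF.admissible t ht).pos hF.cont_left hF.pos_left hφ hφ1).trans (hd t ht))
    have := hF.hasSolutionFamily_of_transports hκ hψ hoff (by positivity) hdist
    exact this.mono Subset.rfl (by linarith)

/-- A modulus of continuity from quantified smallness: `r c` exceeds the infimum of the bounds
available for `c` by `c`, so that it is itself such a bound. -/
lemma exists_modulus {P : ℝ → ℝ → Prop} {B : ℝ} (hB : 0 ≤ B)
    (hanti : ∀ {c c' ρ}, c ≤ c' → P c' ρ → P c ρ) (hmono : ∀ {c ρ ρ'}, ρ ≤ ρ' → P c ρ → P c ρ')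
    (hall : ∀ c, P c B) (hsmall : ∀ ρ > 0, ∃ δ > 0, P δ ρ) (hzero : ∀ c ≤ 0, P c 0) :
    ∃ r : ℝ → ℝ, Tendsto r (𝓝 0) (𝓝 0) ∧ ∀ c, P c (r c) := by
  classical
  refine ⟨fun c => if c ≤ 0 then 0 else sInf {ρ | 0 ≤ ρ ∧ P c ρ} + c, ?_, fun c => ?_⟩
  · rw [Metric.tendsto_nhds]
    intro ε hε
    obtain ⟨δ, hδ, hP⟩ := hsmall (ε / 2) (by positivity)
    filter_upwards [Metric.ball_mem_nhds (0 : ℝ) (lt_min hδ (half_pos hε))] with c hc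
    rw [Metric.mem_ball, Real.dist_eq, sub_zero, lt_min_iff] at hc
    rw [Real.dist_eq, sub_zero]
    split_ifs with h
    · rwa [abs_zero]
    · have hc0 : 0 < c := not_le.1 h
      rw [abs_of_pos hc0] at hc
      have h1 : 0 ≤ sInf {ρ | 0 ≤ ρ ∧ P c ρ} := Real.sInf_nonneg fun ρ hρ => hρ.1
      have h2 : sInf {ρ | 0 ≤ ρ ∧ P c ρ} ≤ ε / 2 :=
        csInf_le ⟨0, fun ρ hρ => hρ.1⟩ ⟨by positivity, hanti hc.1.le hP⟩
      rw [abs_of_nonneg (by linarith)]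
      linarith [hc.2]
  · simp only
    split_ifs with h
    · exact hzero c h
    · obtain ⟨ρ, hρ, hlt⟩ := exists_lt_of_csInf_lt (s := {ρ | 0 ≤ ρ ∧ P c ρ}) ⟨B, hB, hall c⟩
        (lt_add_of_pos_right _ (not_le.1 h))
      exact hmono hlt.le hρ.2

end Modulus

/-! ### Single densities as constant families -/

section Constant

variable {n : ℕ} {f g : EuclideanSpace ℝ (Fin n) → ℝ} {R : Set (EuclideanSpace ℝ (Fin n))}

lemma IsAdmissible.isAdmissibleFamily_const (hf : IsAdmissible g f)
    (hg : ContinuousOn g (unitCube n)) (hg0 : ∀ x ∈ unitCube n, 0 < g x) (hR : IsCompact R)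
    (hsub : R ⊆ openUnitCube n) (hsupp : diffSupport f g ⊆ R) :
    IsAdmissibleFamily g (fun _ => f) R where
  cont_left := hg
  pos_left := hg0
  cont := hf.continuousOn.comp continuousOn_snd fun _ hp => hp.2
  admissible _ _ := hf
  isCompact := hR
  subset := hsub
  support_subset _ _ := hsupp

lemma HasSolutionFamily.exists_isSolution {ρ : ℝ} (h : HasSolutionFamily g (fun _ => f) R ρ) :
    ∃ ψ : EuclideanSpace ℝ (Fin n) ≃ₜ EuclideanSpace ℝ (Fin n), IsSolution g f ψ ∧
      moveSupport ψ ⊆ R ∧ homeoDist ψ (Homeomorph.refl _) ≤ ρ := by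
  obtain ⟨ψ, hψ, -⟩ := h
  exact ⟨ψ 0, hψ 0 ⟨le_rfl, zero_le_one⟩⟩

/-- The bounding box of the support of `f - g` lies in every cube that contains this support, so
that a solution in the bounding box is localized in all these cubes. -/
lemma IsAdmissible.exists_isSolution_forall_closedCube (hf : IsAdmissible g f)
    (hg : ContinuousOn g (unitCube n)) (hg0 : ∀ x ∈ unitCube n, 0 < g x) :
    ∃ ψ : EuclideanSpace ℝ (Fin n) ≃ₜ EuclideanSpace ℝ (Fin n), IsSolution g f ψ ∧
      ∀ (a : EuclideanSpace ℝ (Fin n)) (s : ℝ), diffSupport f g ⊆ closedCube a s →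
        moveSupport ψ ⊆ closedCube a s := by
  by_cases h : EqOn f g (unitCube n)
  · obtain ⟨ψ, h1, h2, -⟩ := ((hf.isAdmissibleFamily_const hg hg0 isCompact_diffSupport
      hf.support_subset Subset.rfl).hasSolutionFamily_of_eqOn (fun _ _ => h)
      le_rfl).exists_isSolution
    exact ⟨ψ, h1, fun a s _ => h2.trans (empty_subset _)⟩
  have : ∃ x ∈ unitCube n, f x ≠ g x := by
    simpa only [EqOn, not_forall, exists_prop] using h
  obtain ⟨x, hx, hne⟩ := this
  obtain ⟨lo, hi, hbox, htouch⟩ := exists_boundingBox (K := diffSupport f g) isCompact_diffSupport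
    ⟨x, subset_closure ⟨hx, sub_ne_zero.2 hne⟩⟩
  have hsub : coordBox lo hi ⊆ openUnitCube n := fun y hy i => by
    obtain ⟨⟨u, hu, hui⟩, ⟨v, hv, hvi⟩⟩ := htouch i
    have h1 := hf.support_subset hu i
    have h2 := hf.support_subset hv i
    have h3 := hy i
    exact ⟨by linarith [h1.1, h3.1], by linarith [h2.2, h3.2]⟩
  have hlt := lt_of_ne_of_diffSupport_subset hf.continuousOn hg hsub hbox hx hne
  have hw : ∀ i, hi i - lo i ≤ 1 := fun i => by
    obtain ⟨⟨u, hu, hui⟩, ⟨v, hv, hvi⟩⟩ := htouch i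
    have h1 := hf.support_subset hu i
    have h2 := hf.support_subset hv i
    linarith [h1.1, h2.2]
  obtain ⟨ψ, h1, h2, -⟩ := ((hf.isAdmissibleFamily_const hg hg0 (isCompact_coordBox lo hi) hsub
    hbox).hasSolutionFamily_coordBox hlt zero_le_one hw).exists_isSolution
  refine ⟨ψ, h1, fun a s hs => h2.trans fun y hy i => ?_⟩
  obtain ⟨⟨u, hu, hui⟩, ⟨v, hv, hvi⟩⟩ := htouch i
  have h3 := hs hu i
  have h4 := hs hv i
  have h5 := hy i
  exact ⟨by linarith [h3.1, h5.1], by linarith [h4.2, h5.2]⟩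

end Constant

theorem theorem3p2 (n : ℕ) (g : EuclideanSpace ℝ (Fin n) → ℝ)
    (hg : ContinuousOn g (unitCube n)) (hg0 : ∀ x ∈ unitCube n, 0 < g x) :
    -- existence, with one map localized in all admissible cubes
    (∀ f : EuclideanSpace ℝ (Fin n) → ℝ, IsAdmissible g f →
      ∃ ψ : EuclideanSpace ℝ (Fin n) ≃ₜ EuclideanSpace ℝ (Fin n),
        IsSolution g f ψ ∧
        ∀ (a : EuclideanSpace ℝ (Fin n)) (s : ℝ), closedCube a s ⊆ openUnitCube n →
          diffSupport f g ⊆ closedCube a s → moveSupport ψ ⊆ closedCube a s) ∧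
    -- a modulus of continuity that depends only on `g`
    ∃ r : ℝ → ℝ, Tendsto r (𝓝 0) (𝓝 0) ∧
      -- coerciveness
      (∀ f : EuclideanSpace ℝ (Fin n) → ℝ, IsAdmissible g f →
        ∃ ψ : EuclideanSpace ℝ (Fin n) ≃ₜ EuclideanSpace ℝ (Fin n),
          IsSolution g f ψ ∧
          homeoDist ψ (Homeomorph.refl _) ≤ r (weakDist (cubeMeasure f) (cubeMeasure g))) ∧
      -- coerciveness together with localization in a given cube
      (∀ f : EuclideanSpace ℝ (Fin n) → ℝ, IsAdmissible g f →
        ∀ (a : EuclideanSpace ℝ (Fin n)) (s : ℝ), closedCube a s ⊆ openUnitCube n →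
          diffSupport f g ⊆ closedCube a s →
          ∃ ψ : EuclideanSpace ℝ (Fin n) ≃ₜ EuclideanSpace ℝ (Fin n),
            IsSolution g f ψ ∧ moveSupport ψ ⊆ closedCube a s ∧
            homeoDist ψ (Homeomorph.refl _) ≤ r (weakDist (cubeMeasure f) (cubeMeasure g))) ∧
      -- the parametric version
      (∀ F : ℝ → EuclideanSpace ℝ (Fin n) → ℝ,
        ContinuousOn (fun p : ℝ × EuclideanSpace ℝ (Fin n) => F p.1 p.2)
          (Icc (0 : ℝ) 1 ×ˢ unitCube n) →
        (∀ t ∈ Icc (0 : ℝ) 1, IsAdmissible g (F t)) →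
        ∀ (a : EuclideanSpace ℝ (Fin n)) (s : ℝ), closedCube a s ⊆ openUnitCube n →
          (∀ t ∈ Icc (0 : ℝ) 1, diffSupport (F t) g ⊆ closedCube a s) →
          ∀ c : ℝ,
            (∀ t ∈ Icc (0 : ℝ) 1, weakDist (cubeMeasure (F t)) (cubeMeasure g) ≤ c) →
            ∃ ψ : ℝ → EuclideanSpace ℝ (Fin n) ≃ₜ EuclideanSpace ℝ (Fin n),
              (∀ t ∈ Icc (0 : ℝ) 1, IsSolution g (F t) (ψ t) ∧
                moveSupport (ψ t) ⊆ closedCube a s ∧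
                homeoDist (ψ t) (Homeomorph.refl _) ≤ r c) ∧
              (∀ t₀ ∈ Icc (0 : ℝ) 1,
                Tendsto (fun t => homeoDist (ψ t) (ψ t₀)) (𝓝[Icc (0 : ℝ) 1] t₀) (𝓝 0)) ∧
              (∀ k : ℕ∞,
                ContDiffOn ℝ k (fun p : ℝ × EuclideanSpace ℝ (Fin n) => F p.1 p.2)
                  (Icc (0 : ℝ) 1 ×ˢ unitCube n) →
                ContDiffOn ℝ k g (unitCube n) →
                ContDiffOn ℝ k (fun p : ℝ × EuclideanSpace ℝ (Fin n) => ψ p.1 p.2)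
                  (Icc (0 : ℝ) 1 ×ˢ univ))) := by
  obtain ⟨r, hr, hP⟩ := exists_modulus
    (P := fun c ρ => ∀ (F : ℝ → EuclideanSpace ℝ (Fin n) → ℝ) (a : EuclideanSpace ℝ (Fin n))
      (s : ℝ), IsAdmissibleFamily g F (closedCube a s) →
      (∀ t ∈ Icc (0 : ℝ) 1, weakDist (cubeMeasure (F t)) (cubeMeasure g) ≤ c) →
      HasSolutionFamily g F (closedCube a s) ρ) (B := 2 * (√n * 1)) (by positivity)
    (fun hc h F a s hF hd => h F a s hF fun t ht => (hd t ht).trans hc)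
    (fun hρ h F a s hF hd => (h F a s hF hd).mono Subset.rfl hρ)
    (fun c F a s hF _ => by
      rcases le_total s 1 with hs | hs
      · exact hF.hasSolutionFamily_closedCube zero_le_one hs
      · rcases hF.eqOn_or_side with h | h
        · exact (hF.hasSolutionFamily_of_eqOn h (by positivity)).mono (empty_subset _) le_rfl
        · exact absurd h.2 hs.not_gt)
    (fun ρ hρ => exists_hasSolutionFamily_of_weakDist_le hg hg0 hρ)
    (fun c hc F a s hF hd => (hF.hasSolutionFamily_of_eqOn (fun t ht =>
      hF.eqOn_of_weakDist_nonpos ht ((hd t ht).trans hc)) le_rfl).mono (empty_subset _) le_rfl)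
  have hloc : ∀ f : EuclideanSpace ℝ (Fin n) → ℝ, IsAdmissible g f →
      ∀ (a : EuclideanSpace ℝ (Fin n)) (s : ℝ), closedCube a s ⊆ openUnitCube n →
        diffSupport f g ⊆ closedCube a s →
        ∃ ψ : EuclideanSpace ℝ (Fin n) ≃ₜ EuclideanSpace ℝ (Fin n),
          IsSolution g f ψ ∧ moveSupport ψ ⊆ closedCube a s ∧
          homeoDist ψ (Homeomorph.refl _) ≤ r (weakDist (cubeMeasure f) (cubeMeasure g)) :=
    fun f hf a s hsub hsupp => (hP _ _ a s (hf.isAdmissibleFamily_const hg hg0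
      (isCompact_closedCube a s) hsub hsupp) fun _ _ => le_rfl).exists_isSolution
  refine ⟨fun f hf => ?_, r, hr, fun f hf => ?_, hloc, fun F hF hadm a s hsub hsupp c hc =>
    hP c F a s ⟨hg, hg0, hF, hadm, isCompact_closedCube a s, hsub, hsupp⟩ hc⟩
  · obtain ⟨ψ, h1, h2⟩ := hf.exists_isSolution_forall_closedCube hg hg0
    exact ⟨ψ, h1, fun a s _ hs => h2 a s hs⟩
  · obtain ⟨a, s, hsub, hsupp⟩ := exists_closedCube_of_isCompact
      (isCompact_diffSupport (f := f) (g := g)) hf.support_subset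
    obtain ⟨ψ, h1, -, h2⟩ := hloc f hf a s hsub hsupp
    exact ⟨ψ, h1, h2⟩
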